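/- **Setting.** Let $\mathfrak g$ be a finite-dimensional simple Lie algebra over $\mathbb C$ with Cartan subalgebra $\mathfrak h$, root system $\Delta$, positive roots $\Delta^+$, simple roots $\alpha_i$ and coroots $\alpha_i^\vee$ ($i\in I$), highest root $\theta$, and $\rho=\frac12\sum_{\alpha\in\Delta^+}\alpha$. Let $\mathfrak g_{\mathrm{af}}$ be the associated untwisted affine Lie algebra with Cartan subalgebra $\mathfrak h_{\mathrm{af}}=\mathfrak h\oplus\mathbb Cc\oplus\mathbb Cd$, null root $\delta$, $I_{\mathrm{af}}=I\sqcup\{0\}$, $\alpha_0=-\theta+\delta$, $\alpha_0^\vee=-\theta^\vee+c$. Let $P_{\mathrm{af}}\subset\mathfrak h_{\mathrm{af}}^*$ be an integral weight lattice: it contains all $\alpha_i$, all $\alpha_i^\vee$ $(i\in I_{\mathrm{af}})$ are integral on it, and it contains chosen $\Lambda_i$ with $\langle\alpha_j^\vee,\Lambda_i\rangle=\delta_{ij}$ for $i,j\in I_{\mathrm{af}}$. Put $\varpi_i=\Lambda_i-\langle c,\Lambda_i\rangle\Lambda_0$ for $i\in I$, let $\lambda\in P^+=\sum_{i\in I}\mathbb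 Z_{\ge0}\varpi_i$, and $J=\{i\in I\mid\langle\alpha_i^\vee,\lambda\rangle=0\}$. Let $W_{\mathrm{af}}=\langle r_i\mid i\in I_{\mathrm{af}}\rangle$ and $W=\langle r_i\mid i\in I\rangle$ (with length function $\ell$) be the Weyl groups; $W_{\mathrm{af}}=W\ltimes\{t_\xi\mid\xi\in Q^\vee\}$, where $Q^\vee=\bigoplus_{i\in I}\mathbb Z\alpha_i^\vee$ and $t_\xi$ is translation by $\xi$. The real roots are $\alpha+n\delta$ ($\alpha\in\Delta$, $n\in\mathbb Z$); such a root is positive if $n>0$, or $n=0$ and $\alpha\in\Delta^+$. Write $r_\beta$ for the reflection in a real root $\beta$. For $x=vt_\zeta$ ($v\in W$, $\zeta\in Q^\vee$) let $\ell^{\frac\infty2}(x)=\ell(v)+2\langle\zeta,\rho\rangle$. Let $(W^J)_{\mathrm{af}}$ be the set of $x\in W_{\mathrm{af}}$ such that $x\beta$ is positive for every positive real root $\beta=\alpha+n\delta$ with $\alpha\in\Delta\cap\bigoplus_{j\in J}\mathbb Z\alpha_j$. *Semi-infinite LS paths.* The semi-infinite Bruhat graph has vertex set $(W^J)_{\mathrm{af}}$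 and edges $x\xrightarrow{\beta}r_\beta x$ for $\beta$ a positive real root with $x,r_\beta x\in(W^J)_{\mathrm{af}}$ and $\ell^{\frac\infty2}(r_\beta x)=\ell^{\frac\infty2}(x)+1$; write $x\le y$ if there is a directed path from $x$ to $y$. For $0<a\le1$ rational, the $a$-subgraph keeps the edges with $a\langle\beta^\vee,x\lambda\rangle\in\mathbb Z$. $\mathbb B^{\frac\infty2}(\lambda)$ is the set of $\eta=(x_1,\dots,x_s;a_0,\dots,a_s)$, $s\ge1$, with $x_1>\cdots>x_s$ in $(W^J)_{\mathrm{af}}$, rational numbers $0=a_0<\cdots<a_s=1$, and a directed path from $x_{u+1}$ to $x_u$ in the $a_u$-subgraph for $1\le u\le s-1$. *LS paths.* On $W_{\mathrm{af}}\lambda$ let $\le$ be the partial order generated by $\mu\le r_\beta\mu$ for $\beta$ a positive real root with $\langle\beta^\vee,\mu\rangle\in\mathbb Z_{>0}$. Its graph has the edges $\mu\xrightarrow{\beta}\nu$ where $\nu$ covers $\mu$, $\nu=r_\beta\mu$ and $\langle\beta^\vee,\mu\rangle>0$; the $a$-subgraph keeps those with $a\langle\beta^\vee,\mu\rangle\in\mathbb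 Z$. $\mathbb B(\lambda)$ is the set of $\pi=(\nu_1,\dots,\nu_s;a_0,\dots,a_s)$, $s\ge 1$, with $\nu_1>\cdots>\nu_s$ in $W_{\mathrm{af}}\lambda$, rational numbers $0=a_0<\cdots<a_s=1$, and a directed path from $\nu_{u+1}$ to $\nu_u$ in the $a_u$-subgraph for $1\le u\le s-1$. Identify $\pi$ with the piecewise linear map on $[0,1]$ with $\pi(0)=0$ and direction vector $\nu_u$ on $[a_{u-1},a_u]$. Put $\overline\eta=(x_1\lambda,\dots,x_s\lambda;a_0,\dots,a_s)$ for $\eta$ as above. *Root operators.* For $i\in I_{\mathrm{af}}$ put $H(t)=\langle\alpha_i^\vee,\pi(t)\rangle$ and $m=\min_{[0,1]}H$, where $\pi=\overline\eta$. If $m=0$, then $e_i\eta:=\mathbf 0$. Otherwise let $t_1=\min\{t\mid H(t)=m\}$, $t_0=\max\{t\le t_1\mid H(t)=m+1\}$, and $a_{p-1}\le t_0<a_p$, $t_1=a_q$; then $$e_i\eta:=(x_1,\dots,x_p,r_ix_p,\dots,r_ix_q,x_{q+1},\dots,x_s;\,a_0,\dots,a_{p-1},t_0,a_p,\dots,a_s),$$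 where $x_p,a_{p-1}$ are dropped if $t_0=a_{p-1}$, and $x_{q+1},a_q$ are dropped if $r_ix_q=x_{q+1}$. If $H(1)-m=0$, then $f_i\eta:=\mathbf 0$. Otherwise let $t_0=\max\{t\mid H(t)=m\}$, $t_1=\min\{t\ge t_0\mid H(t)=m+1\}$, and $t_0=a_p$, $a_q<t_1\le a_{q+1}$; then $$f_i\eta:=(x_1,\dots,x_p,r_ix_{p+1},\dots,r_ix_{q+1},x_{q+1},\dots,x_s;\,a_0,\dots,a_q,t_1,a_{q+1},\dots,a_s),$$ where $x_{q+1},a_{q+1}$ are dropped if $t_1=a_{q+1}$, and $x_p,a_p$ are dropped if $x_p=r_ix_{p+1}$. Set $e_i\mathbf 0=f_i\mathbf 0=\mathbf 0$. The operators $e_i,f_i$ on LS paths are given by the same formulas, with $\nu_u$ in place of $x_u$ and $H$ taken for $\pi$ itself. **Theorem.** 1. The set $\mathbb B^{\frac\infty2}(\lambda)\sqcup\{\mathbf 0\}$ is stable under $e_i$ and $f_i$ for all $i\in I_{\mathrm{af}}$. 2. For $\eta\in\mathbb B^{\frac\infty2}(\lambda)$ and $i\in I_{\mathrm{af}}$ put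 $\mathrm{wt}(\eta)=\overline\eta(1)$, $\varepsilon_i(\eta)=\max\{n\ge0\mid e_i^n\eta\ne\mathbf 0\}$, $\varphi_i(\eta)=\max\{n\ge0\mid f_i^n\eta\ne\mathbf 0\}$. These maxima exist, $\mathrm{wt}(\eta)\in P_{\mathrm{af}}$, and $\mathbb B^{\frac\infty2}(\lambda)$ with $\mathrm{wt}$, $e_i$, $f_i$, $\varepsilon_i$, $\varphi_i$ ($i\in I_{\mathrm{af}}$) is a crystal with weights in $P_{\mathrm{af}}$ (in the sense of Kashiwara). 3. Likewise $\mathbb B(\lambda)$, with $\mathrm{wt}(\pi)=\pi(1)$, the operators $e_i,f_i$, and $\varepsilon_i,\varphi_i$ defined by the same maxima, is a crystal with weights in $P_{\mathrm{af}}$. Moreover $\overline\eta\in\mathbb B(\lambda)$ for all $\eta\in\mathbb B^{\frac\infty2}(\lambda)$, and $\eta\mapsto\overline\eta$ (with $\mathbf 0\mapsto\mathbf 0$) is a surjective strict morphism of crystals $\mathbb B^{\frac\infty2}(\lambda)\to\mathbb B(\lambda)$: it preserves $\mathrm{wt}$, $\varepsilon_i$, $\varphi_i$ and commutes with all $e_i$,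 $f_i$. -/

import Mathlib

namespace SiLS

noncomputable section

/-! ## Untwisted affine root data

A finite-dimensional simple Lie algebra over `ℂ` enters through its root system: a finite, reduced,
irreducible, crystallographic root system `P : RootPairing ι ℂ M N` (roots in `M`, the dual of the
Cartan subalgebra, and coroots in `N`, the Cartan subalgebra) with a base `b`, and the index `θ` of
its highest root. The index set `I` of the simple roots is `b.support`, and
`I_af = I ⊔ {0}` is `Option b.support`, with `none` in the role of `0`. -/

/-- The dual `𝔥_af^* = 𝔥^* ⊕ ℂ Λ ⊕ ℂ δ` of the Cartan subalgebra of the affine Lie algebra: the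
triple `(μ, k, z)` restricts to `μ` on `𝔥`, and takes the values `k` at the canonical central
element `c` and `z` at the scaling element `d`. -/
abbrev AffDual (M : Type*) := M × ℂ × ℂ

/-- The Cartan subalgebra `𝔥_af = 𝔥 ⊕ ℂ c ⊕ ℂ d` of the untwisted affine Lie algebra. -/
abbrev AffCartan (N : Type*) := N × ℂ × ℂ

section RootData

variable {ι M N : Type*} [Fintype ι] [AddCommGroup M] [Module ℂ M] [AddCommGroup N] [Module ℂ N]

/-- The canonical pairing `𝔥_af × 𝔥_af^* → ℂ`, as a functional on `𝔥_af^*` for each `h`. -/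
def pair (P : RootPairing ι ℂ M N) (h : AffCartan N) : AffDual M →ₗ[ℂ] ℂ :=
  (P.toLinearMap.flip h.1).comp (LinearMap.fst ℂ M (ℂ × ℂ)) +
    h.2.1 • (LinearMap.fst ℂ ℂ ℂ).comp (LinearMap.snd ℂ M (ℂ × ℂ)) +
    h.2.2 • (LinearMap.snd ℂ ℂ ℂ).comp (LinearMap.snd ℂ M (ℂ × ℂ))

/-- The canonical central element `c`. -/
def central (N : Type*) [AddCommGroup N] : AffCartan N := (0, 1, 0)

/-- The null root `δ`. -/
def nullRoot (M : Type*) [AddCommGroup M] : AffDual M := (0, 0, 1)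

/-- `j` is the index of the highest root: the difference with any root is a sum of simple roots. -/
def IsHighestRoot {P : RootPairing ι ℂ M N} (b : P.Base) (j : ι) : Prop :=
  ∀ k : ι, P.root j - P.root k ∈ AddSubmonoid.closure (P.root '' b.support)

/-- The factor which turns the canonical invariant form `P.CorootForm` on the finite Cartan
subalgebra into the normalized one, for which `(θ^∨ | θ^∨) = 2`. -/
def normFactor (P : RootPairing ι ℂ M N) (θ : ι) : ℂ :=
  2 / P.CorootForm (P.coroot θ) (P.coroot θ)

/-- The normalized invariant form `(ξ | ζ)` on the finite Cartan subalgebra. -/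
def normForm (P : RootPairing ι ℂ M N) (θ : ι) (ξ ζ : N) : ℂ :=
  normFactor P θ * P.CorootForm ξ ζ

/-- The identification `ν` of the finite Cartan subalgebra with its dual given by the normalized
form, that is `⟨ζ, ν ξ⟩ = (ξ | ζ)`. -/
def normIso (P : RootPairing ι ℂ M N) (θ : ι) (ξ : N) : M :=
  normFactor P θ • P.CoPolarization ξ

/-- The real root `α_j + n δ`; every real root is of this form for a unique `(j, n) : ι × ℤ`. -/
def realRoot (P : RootPairing ι ℂ M N) (β : ι × ℤ) : AffDual M :=
  (P.root β.1, 0, (β.2 : ℂ))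

/-- The coroot `(α + n δ)^∨ = α^∨ + (2 n / (α | α)) c` of a real root, where
`2 / (α | α) = (α^∨ | α^∨) / 2`. -/
def realCoroot (P : RootPairing ι ℂ M N) (θ : ι) (β : ι × ℤ) : AffCartan N :=
  (P.coroot β.1, (β.2 : ℂ) * (normForm P θ (P.coroot β.1) (P.coroot β.1) / 2), 0)

theorem pair_realCoroot_realRoot (P : RootPairing ι ℂ M N) (θ : ι) (β : ι × ℤ) :
    pair P (realCoroot P θ β) (realRoot P β) = 2 := by
  simp [pair, realCoroot, realRoot]

/-- The reflection `r_β : μ ↦ μ - ⟨β^∨, μ⟩ β` of `𝔥_af^*` with respect to a real root. -/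
def realRefl (P : RootPairing ι ℂ M N) (θ : ι) (β : ι × ℤ) : AffDual M ≃ₗ[ℂ] AffDual M :=
  Module.reflection (pair_realCoroot_realRoot P θ β)

variable {P : RootPairing ι ℂ M N} (b : P.Base) (θ : ι)

/-- The simple root `α_i`, `i ∈ I_af`, as a real root: `α_0 = -θ + δ`, and `α_i` for `i ∈ I` is the
simple root of the finite root system. -/
def simpleRoot : Option b.support → ι × ℤ
  | none => (P.reflectionPerm θ θ, 1)
  | some i => (i, 0)

/-- The simple reflection `r_i`, `i ∈ I_af`. -/
def simpleRefl (i : Option b.support) : AffDual M ≃ₗ[ℂ] AffDual M := realRefl P θ (simpleRoot b θ i)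

/-- The affine Weyl group `W_af = ⟨r_i | i ∈ I_af⟩`. -/
def affineWeyl : Subgroup (AffDual M ≃ₗ[ℂ] AffDual M) :=
  Subgroup.closure (Set.range (simpleRefl b θ))

/-- The finite Weyl group `W = ⟨r_i | i ∈ I⟩`, inside `W_af`. -/
def finiteWeyl : Subgroup (AffDual M ≃ₗ[ℂ] AffDual M) :=
  Subgroup.closure (Set.range fun i : b.support => simpleRefl b θ (some i))

/-- The length of an element of the finite Weyl group `W`: the least length of a word in the simple
reflections `r_i`, `i ∈ I`, that represents it. -/
def finiteLength (v : AffDual M ≃ₗ[ℂ] AffDual M) : ℕ :=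
  sInf {n | ∃ w : List b.support,
    w.length = n ∧ (w.map fun i => simpleRefl b θ (some i)).prod = v}

/-- The coroot lattice `Q^∨` of the finite root system. -/
def corootLattice : AddSubgroup N :=
  AddSubgroup.closure (P.coroot '' b.support)

/-- The translation
`t_ξ μ = μ + ⟨c, μ⟩ ν(ξ) - (⟨ξ, μ⟩ + (ξ | ξ) ⟨c, μ⟩ / 2) δ`, for `ξ` in the finite Cartan
subalgebra. -/
def translation (P : RootPairing ι ℂ M N) (θ : ι) (ξ : N) (μ : AffDual M) : AffDual M :=
  μ + pair P (central N) μ • ((normIso P θ ξ, 0, 0) : AffDual M) -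
    (pair P (ξ, 0, 0) μ + normForm P θ ξ ξ / 2 * pair P (central N) μ) • nullRoot M

section

variable [P.IsCrystallographic] [P.IsReduced]

/-- The positive real roots: `Δ^+ ⊔ {α + n δ | α ∈ Δ, n > 0}`. -/
def posRealRoots : Set (ι × ℤ) := {β | (b.IsPos β.1 ∧ β.2 = 0) ∨ 0 < β.2}

open scoped Classical in
/-- `2 ⟨ξ, ρ⟩`, where `2 ρ` is the sum of the positive roots of the finite root system. -/
def twoRho (ξ : N) : ℂ := ∑ j : ι with b.IsPos j, P.root' j ξ

/-- `x` has semi-infinite length `n`, that is, `x = v t_ζ` with `v ∈ W` and `ζ ∈ Q^∨`, and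
`n = ℓ(v) + 2 ⟨ζ, ρ⟩`. -/
def HasSiLength (x : AffDual M ≃ₗ[ℂ] AffDual M) (n : ℤ) : Prop :=
  ∃ v ∈ finiteWeyl b θ, ∃ ζ ∈ corootLattice b,
    (∀ μ, x μ = v (translation P θ ζ μ)) ∧ (n : ℂ) = finiteLength b θ v + twoRho b ζ

/-- The set `(Δ_J)_af^+` of positive real roots `α + n δ` with `α ∈ Δ_J = Δ ∩ Q_J`. -/
def posRealRootsJ (J : Set b.support) : Set (ι × ℤ) :=
  {β ∈ posRealRoots b |
    P.root β.1 ∈ AddSubgroup.closure ((fun i : b.support => P.root i) '' J)}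

/-- Peterson's coset representatives
`(W^J)_af = {x ∈ W_af | x β is a positive real root for all β ∈ (Δ_J)_af^+}`. -/
def cosetReps (J : Set b.support) : Set (AffDual M ≃ₗ[ℂ] AffDual M) :=
  {x | x ∈ affineWeyl b θ ∧
    ∀ β ∈ posRealRootsJ b J, x (realRoot P β) ∈ realRoot P '' posRealRoots b}

/-- The edges `x → r_β x` of the semi-infinite Bruhat graph on `(W^J)_af`, with label `β`. -/
def SiEdge (J : Set b.support) (β : ι × ℤ) (x y : AffDual M ≃ₗ[ℂ] AffDual M) : Prop :=
  β ∈ posRealRoots b ∧ x ∈ cosetReps b θ J ∧ y ∈ cosetReps b θ J ∧ y = realRefl P θ β * x ∧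
    ∃ n : ℤ, HasSiLength b θ x n ∧ HasSiLength b θ y (n + 1)

/-- The semi-infinite Bruhat order: there is a directed path from `x` to `y`. -/
def SiLE (J : Set b.support) (x y : AffDual M ≃ₗ[ℂ] AffDual M) : Prop :=
  x ∈ cosetReps b θ J ∧ Relation.ReflTransGen (fun u v => ∃ β, SiEdge b θ J β u v) x y

/-! ## LS paths and semi-infinite LS paths

A pair of sequences `(x_1, …, x_s ; a_0, …, a_s)` with `a_0 = 0` is encoded as the list
`[(x_1, a_1), …, (x_s, a_s)]`. -/

/-- The set `J_λ = {i ∈ I | ⟨α_i^∨, λ⟩ = 0}`. -/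
def stabIndex (lam : AffDual M) : Set b.support :=
  {i | pair P (realCoroot P θ (simpleRoot b θ (some i))) lam = 0}

/-- There is a directed path from `x` to `y` in the subgraph of the semi-infinite Bruhat graph
which has the edges `u → r_β u` with `a ⟨β^∨, u λ⟩ ∈ ℤ` only. -/
def SiPath (lam : AffDual M) (a : ℝ) (x y : AffDual M ≃ₗ[ℂ] AffDual M) : Prop :=
  Relation.ReflTransGen (fun u v => ∃ β, SiEdge b θ (stabIndex b θ lam) β u v ∧
    ∃ n : ℤ, (a : ℂ) * pair P (realCoroot P θ β) (u lam) = n) x y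

/-- Semi-infinite Lakshmibai-Seshadri paths of shape `λ`: pairs of sequences
`x_1 > ⋯ > x_s` in `(W^J)_af` (for the semi-infinite Bruhat order) and `0 = a_0 < ⋯ < a_s = 1` in
`ℚ`, with `s ≥ 1` and a directed path from `x_{u+1}` to `x_u` in the subgraph for `a_u`, for all
`1 ≤ u ≤ s - 1`. -/
def siLSPaths (lam : AffDual M) : Set (List ((AffDual M ≃ₗ[ℂ] AffDual M) × ℝ)) :=
  {η | (∀ p ∈ η, p.1 ∈ cosetReps b θ (stabIndex b θ lam) ∧ 0 < p.2 ∧ ∃ q : ℚ, p.2 = q) ∧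
    (∃ p, η.getLast? = some p ∧ p.2 = 1) ∧
    η.IsChain fun p p' => p.2 < p'.2 ∧
      (SiLE b θ (stabIndex b θ lam) p'.1 p.1 ∧ p'.1 ≠ p.1) ∧ SiPath b θ lam p.2 p'.1 p.1}

/-- The orbit `W_af λ`. -/
def orbit (lam : AffDual M) : Set (AffDual M) := {ν | ∃ x ∈ affineWeyl b θ, ν = x lam}

/-- The order `≤` on the orbit `W_af λ`, generated by `μ ≤ r_β μ` for positive real roots `β` such
that `⟨β^∨, μ⟩` is a positive integer. -/
def WtLE (lam μ ν : AffDual M) : Prop :=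
  μ ∈ orbit b θ lam ∧ Relation.ReflTransGen (fun κ κ' => ∃ β ∈ posRealRoots b,
    κ' = realRefl P θ β κ ∧ ∃ n : ℤ, 0 < n ∧ pair P (realCoroot P θ β) κ = n) μ ν

/-- The strict order on the orbit `W_af λ`. -/
def WtLT (lam μ ν : AffDual M) : Prop := WtLE b θ lam μ ν ∧ μ ≠ ν

/-- The edges `μ → ν` of the graph on `W_af λ`, with label `β`: `ν` covers `μ`, and `β` is the
positive real root with `ν = r_β μ` and `⟨β^∨, μ⟩ > 0`. -/
def WtEdge (lam : AffDual M) (β : ι × ℤ) (μ ν : AffDual M) : Prop :=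
  (WtLT b θ lam μ ν ∧ ¬ ∃ κ, WtLT b θ lam μ κ ∧ WtLT b θ lam κ ν) ∧
    β ∈ posRealRoots b ∧ ν = realRefl P θ β μ ∧ ∃ n : ℤ, 0 < n ∧ pair P (realCoroot P θ β) μ = n

/-- There is a directed path from `μ` to `ν` in the subgraph which has the edges `κ → r_β κ` with
`a ⟨β^∨, κ⟩ ∈ ℤ` only. -/
def WtPath (lam : AffDual M) (a : ℝ) (μ ν : AffDual M) : Prop :=
  Relation.ReflTransGen (fun κ κ' => ∃ β, WtEdge b θ lam β κ κ' ∧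
    ∃ n : ℤ, (a : ℂ) * pair P (realCoroot P θ β) κ = n) μ ν

/-- Lakshmibai-Seshadri paths of shape `λ`: pairs of sequences `ν_1 > ⋯ > ν_s` in `W_af λ` and
`0 = a_0 < ⋯ < a_s = 1` in `ℚ`, with `s ≥ 1` and a directed path from `ν_{u+1}` to `ν_u` in the
subgraph for `a_u`, for all `1 ≤ u ≤ s - 1`. -/
def LSPaths (lam : AffDual M) : Set (List (AffDual M × ℝ)) :=
  {π | (∀ p ∈ π, p.1 ∈ orbit b θ lam ∧ 0 < p.2 ∧ ∃ q : ℚ, p.2 = q) ∧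
    (∃ p, π.getLast? = some p ∧ p.2 = 1) ∧
    π.IsChain fun p p' => p.2 < p'.2 ∧ WtLT b θ lam p'.1 p.1 ∧ WtPath b θ lam p.2 p'.1 p.1}

end

/-- The projection `(x_1, …, x_s ; a_0, …, a_s) ↦ (x_1 λ, …, x_s λ ; a_0, …, a_s)`. -/
def proj (lam : AffDual M) (η : List ((AffDual M ≃ₗ[ℂ] AffDual M) × ℝ)) : List (AffDual M × ℝ) :=
  η.map fun p => (p.1 lam, p.2)

/-! ## Root operators -/

open scoped Classical in
/-- The value at time `t ≥ a` of the piecewise linear path that starts at `0` at the time `a` and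
has the given direction vectors on the successive intervals. -/
def pathFrom : ℝ → List (AffDual M × ℝ) → ℝ → AffDual M
  | _, [], _ => 0
  | a, (ν, a') :: l, t =>
    if t ≤ a' then ((t - a : ℝ) : ℂ) • ν else ((a' - a : ℝ) : ℂ) • ν + pathFrom a' l t

/-- The piecewise linear map `π : [0, 1] → 𝔥_af^*` of an LS path. -/
def pathMap (π : List (AffDual M × ℝ)) (t : ℝ) : AffDual M := pathFrom 0 π t

/-- The function `H_i^π(t) = ⟨α_i^∨, π(t)⟩` (its values are real, since the pairings of `α_i^∨`
with the direction vectors are integers). -/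
def height (π : List (AffDual M × ℝ)) (i : Option b.support) (t : ℝ) : ℝ :=
  (pair P (realCoroot P θ (simpleRoot b θ i)) (pathMap π t)).re

/-- `m_i^π = min {H_i^π(t) | t ∈ [0, 1]}`. -/
def minHeight (π : List (AffDual M × ℝ)) (i : Option b.support) : ℝ :=
  sInf (height b θ π i '' Set.Icc 0 1)

/-- `t_1 = min {t ∈ [0, 1] | H_i^π(t) = m_i^π}` for the operator `e_i`. -/
def eEnd (π : List (AffDual M × ℝ)) (i : Option b.support) : ℝ :=
  sInf {t | t ∈ Set.Icc 0 1 ∧ height b θ π i t = minHeight b θ π i}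

/-- `t_0 = max {t ∈ [0, t_1] | H_i^π(t) = m_i^π + 1}` for the operator `e_i`. -/
def eStart (π : List (AffDual M × ℝ)) (i : Option b.support) : ℝ :=
  sSup {t | t ∈ Set.Icc 0 (eEnd b θ π i) ∧ height b θ π i t = minHeight b θ π i + 1}

/-- `t_0 = max {t ∈ [0, 1] | H_i^π(t) = m_i^π}` for the operator `f_i`. -/
def fStart (π : List (AffDual M × ℝ)) (i : Option b.support) : ℝ :=
  sSup {t | t ∈ Set.Icc 0 1 ∧ height b θ π i t = minHeight b θ π i}

/-- `t_1 = min {t ∈ [t_0, 1] | H_i^π(t) = m_i^π + 1}` for the operator `f_i`. -/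
def fEnd (π : List (AffDual M × ℝ)) (i : Option b.support) : ℝ :=
  sInf {t | t ∈ Set.Icc (fStart b θ π i) 1 ∧ height b θ π i t = minHeight b θ π i + 1}

open scoped Classical in
/-- The rearrangement in the definition of `e_i`, where `r` is the action of `r_i`. With `p ≤ q`
such that `a_{p-1} ≤ t_0 < a_p` and `a_q = t_1`, the lists `before`, `mid` and `after` hold the
pieces `1, …, p - 1`, the pieces `p, …, q`, and the pieces `q + 1, …, s`. The result is
`(x_1, …, x_p, r x_p, …, r x_q, x_{q+1}, …, x_s ; a_0, …, a_{p-1}, t_0, a_p, …, a_q, …, a_s)`, where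
`x_p` and `a_{p-1}` are dropped if `t_0 = a_{p-1}`, and `x_{q+1}` and `a_q` are dropped if
`r x_q = x_{q+1}`. -/
def eReflect {X : Type*} (r : X → X) (t₀ t₁ : ℝ) (η : List (X × ℝ)) : List (X × ℝ) :=
  let before := η.filter fun p => p.2 ≤ t₀
  let mid := η.filter fun p => t₀ < p.2 ∧ p.2 ≤ t₁
  let after := η.filter fun p => t₁ < p.2
  let prevTime := (before.getLast?.map Prod.snd).getD 0
  let cut := if t₀ = prevTime then [] else mid.head?.toList.map fun p => (p.1, t₀)
  let mid' := mid.map fun p => (r p.1, p.2)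
  before ++ cut ++
    (if mid'.getLast?.map Prod.fst = after.head?.map Prod.fst then mid'.dropLast else mid') ++ after

open scoped Classical in
/-- The rearrangement in the definition of `f_i`, where `r` is the action of `r_i`. With `p ≤ q`
such that `a_p = t_0` and `a_q < t_1 ≤ a_{q+1}`, the lists `before`, `mid` and `after` hold the
pieces `1, …, p`, the pieces `p + 1, …, q`, and the pieces `q + 1, …, s`. The result is
`(x_1, …, x_p, r x_{p+1}, …, r x_{q+1}, x_{q+1}, …, x_s ;
a_0, …, a_p, …, a_q, t_1, a_{q+1}, …, a_s)`, where `x_{q+1}` and `a_{q+1}` are dropped if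
`t_1 = a_{q+1}`, and `x_p` and `a_p` are dropped if `x_p = r x_{p+1}`. -/
def fReflect {X : Type*} (r : X → X) (t₀ t₁ : ℝ) (η : List (X × ℝ)) : List (X × ℝ) :=
  let before := η.filter fun p => p.2 ≤ t₀
  let mid := η.filter fun p => t₀ < p.2 ∧ p.2 < t₁
  let after := η.filter fun p => t₀ < p.2 ∧ t₁ ≤ p.2
  let reflected := mid.map (fun p => (r p.1, p.2)) ++ after.head?.toList.map fun p => (r p.1, t₁)
  (if before.getLast?.map Prod.fst = reflected.head?.map Prod.fst then before.dropLast else before) ++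
    reflected ++ (if after.head?.map Prod.snd = some t₁ then after.tail else after)

open scoped Classical in
/-- The root operator `e_i` on a sequence `η` with projected path `π`; `none` stands for the
additional element `𝟎`. -/
def rootE {X : Type*} (i : Option b.support) (r : X → X) (π : List (AffDual M × ℝ))
    (η : List (X × ℝ)) : Option (List (X × ℝ)) :=
  if minHeight b θ π i = 0 then none
  else some (eReflect r (eStart b θ π i) (eEnd b θ π i) η)

open scoped Classical in
/-- The root operator `f_i` on a sequence `η` with projected path `π`. -/
def rootF {X : Type*} (i : Option b.support) (r : X → X) (π : List (AffDual M × ℝ))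
    (η : List (X × ℝ)) : Option (List (X × ℝ)) :=
  if height b θ π i 1 - minHeight b θ π i = 0 then none
  else some (fReflect r (fStart b θ π i) (fEnd b θ π i) η)

/-- The root operator `e_i` for LS paths. -/
def lsE (i : Option b.support) (π : List (AffDual M × ℝ)) : Option (List (AffDual M × ℝ)) :=
  rootE b θ i (fun ν => simpleRefl b θ i ν) π π

/-- The root operator `f_i` for LS paths. -/
def lsF (i : Option b.support) (π : List (AffDual M × ℝ)) : Option (List (AffDual M × ℝ)) :=
  rootF b θ i (fun ν => simpleRefl b θ i ν) π π

/-- The root operator `e_i` for semi-infinite LS paths of shape `λ`. -/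
def siE (lam : AffDual M) (i : Option b.support) (η : List ((AffDual M ≃ₗ[ℂ] AffDual M) × ℝ)) :
    Option (List ((AffDual M ≃ₗ[ℂ] AffDual M) × ℝ)) :=
  rootE b θ i (fun x => simpleRefl b θ i * x) (proj lam η) η

/-- The root operator `f_i` for semi-infinite LS paths of shape `λ`. -/
def siF (lam : AffDual M) (i : Option b.support) (η : List ((AffDual M ≃ₗ[ℂ] AffDual M) × ℝ)) :
    Option (List ((AffDual M ≃ₗ[ℂ] AffDual M) × ℝ)) :=
  rootF b θ i (fun x => simpleRefl b θ i * x) (proj lam η) η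

/-! ## Weight lattices and crystals -/

open scoped Classical in
/-- An integral weight lattice `P_af ⊂ 𝔥_af^*`: it contains the simple roots, the simple coroots
take integral values on it, and it contains the chosen fundamental weights `Λ_i`, `i ∈ I_af`. -/
structure WeightLattice where
  /-- The lattice `P_af`. -/
  lattice : AddSubgroup (AffDual M)
  simpleRoot_mem : ∀ i, realRoot P (simpleRoot b θ i) ∈ lattice
  integral : ∀ i, ∀ μ ∈ lattice, ∃ n : ℤ, pair P (realCoroot P θ (simpleRoot b θ i)) μ = n
  /-- The fundamental weights `Λ_i`. -/
  fund : Option b.support → AffDual M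
  fund_mem : ∀ i, fund i ∈ lattice
  pair_fund : ∀ i j, pair P (realCoroot P θ (simpleRoot b θ j)) (fund i) = if i = j then 1 else 0

variable {b θ}

/-- The level-zero fundamental weight `ϖ_i = Λ_i - ⟨c, Λ_i⟩ Λ_0`, `i ∈ I`. -/
def WeightLattice.levelZeroFund (L : WeightLattice b θ) (i : b.support) : AffDual M :=
  L.fund (some i) - pair P (central N) (L.fund (some i)) • L.fund none

/-- The level-zero dominant integral weight `∑_{i ∈ I} m_i ϖ_i`. -/
def WeightLattice.dominant (L : WeightLattice b θ) (m : b.support → ℕ) : AffDual M :=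
  ∑ i : b.support, m i • L.levelZeroFund i

/-- A crystal with weights in `P_af`, with underlying set `B`. The value `none : Option B` is the
additional element `𝟎`, and `⊥ : WithBot ℤ` is `-∞`. -/
structure Crystal (L : WeightLattice b θ) (B : Type*) where
  /-- The weight map. -/
  wt : B → L.lattice
  /-- The raising operators. -/
  e : Option b.support → B → Option B
  /-- The lowering operators. -/
  f : Option b.support → B → Option B
  /-- The maps `ε_i`. -/
  ε : Option b.support → B → WithBot ℤ
  /-- The maps `φ_i`. -/
  φ : Option b.support → B → WithBot ℤ
  φ_eq : ∀ i x, ∀ n : ℤ, pair P (realCoroot P θ (simpleRoot b θ i)) (wt x) = n →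
    φ i x = ε i x + (n : WithBot ℤ)
  wt_e : ∀ i x y, e i x = some y → (wt y : AffDual M) = wt x + realRoot P (simpleRoot b θ i)
  wt_f : ∀ i x y, f i x = some y → (wt y : AffDual M) = wt x - realRoot P (simpleRoot b θ i)
  ε_e : ∀ i x y, e i x = some y → ε i x = ε i y + 1
  φ_e : ∀ i x y, e i x = some y → φ i y = φ i x + 1
  ε_f : ∀ i x y, f i x = some y → ε i y = ε i x + 1
  φ_f : ∀ i x y, f i x = some y → φ i x = φ i y + 1
  e_iff_f : ∀ i x y, e i x = some y ↔ f i y = some x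
  e_bot : ∀ i x, φ i x = ⊥ → e i x = none
  f_bot : ∀ i x, φ i x = ⊥ → f i x = none

/-- A strict morphism of crystals: a map `ψ : B₁ ⊔ {𝟎} → B₂ ⊔ {𝟎}` with `ψ(𝟎) = 𝟎`, which
preserves `wt`, `ε_i`, `φ_i` at the elements of `B₁` not sent to `𝟎`, and commutes with all `e_i`
and `f_i` (extended by `e_i 𝟎 = f_i 𝟎 = 𝟎`). -/
structure IsStrictMorphism {L : WeightLattice b θ} {B₁ B₂ : Type*} (C₁ : Crystal L B₁)
    (C₂ : Crystal L B₂) (ψ : Option B₁ → Option B₂) : Prop where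
  map_none : ψ none = none
  wt_eq : ∀ x y, ψ (some x) = some y → C₂.wt y = C₁.wt x
  ε_eq : ∀ i x y, ψ (some x) = some y → C₂.ε i y = C₁.ε i x
  φ_eq : ∀ i x y, ψ (some x) = some y → C₂.φ i y = C₁.φ i x
  map_e : ∀ i z, ψ (z.bind (C₁.e i)) = (ψ z).bind (C₂.e i)
  map_f : ∀ i z, ψ (z.bind (C₁.f i)) = (ψ z).bind (C₂.f i)

/-- The crystal `C` on a set `S` of sequences is the one given by operators `opE`, `opF` and an
endpoint map `endpt`: its operators `e_i`, `f_i` are the restrictions to `S` of the given ones, the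
weight is the endpoint, `ε_i(x) = max {n ≥ 0 | e_i^n x ≠ 𝟎}` and
`φ_i(x) = max {n ≥ 0 | f_i^n x ≠ 𝟎}`. -/
structure IsCrystalOf {L : WeightLattice b θ} {X : Type*} {S : Set X} (C : Crystal L S)
    (opE opF : Option b.support → X → Option X) (endpt : X → AffDual M) : Prop where
  wt_eq : ∀ x : S, (C.wt x : AffDual M) = endpt x
  e_eq : ∀ i (x : S), (C.e i x).map Subtype.val = opE i x
  f_eq : ∀ i (x : S), (C.f i x).map Subtype.val = opF i x
  ε_eq : ∀ i (x : S), ∃ n : ℕ, C.ε i x = ((n : ℤ) : WithBot ℤ) ∧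
    IsGreatest {k : ℕ | (fun z : Option X => z.bind (opE i))^[k] (some (x : X)) ≠ none} n
  φ_eq : ∀ i (x : S), ∃ n : ℕ, C.φ i x = ((n : ℤ) : WithBot ℤ) ∧
    IsGreatest {k : ℕ | (fun z : Option X => z.bind (opF i))^[k] (some (x : X)) ≠ none} n

end RootData

end

end SiLS

namespace SiLS

noncomputable section

set_option linter.unusedSectionVars false

section RealRoots

variable {ι M N : Type*} [Fintype ι] [AddCommGroup M] [Module ℂ M] [AddCommGroup N] [Module ℂ N]

/-! ## Reflections in real roots -/

/-! Root operators reflect a piece of a path, so two things have to be understood: how the graph on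
Peterson representatives reacts to a simple reflection, and how the height function H of a path
behaves on the piece.

For the graph, attach to x the integer `relLength`: for each finite root α with ⟨α^∨, λ⟩ > 0 take
the least k such that xα + kδ is positive, and add these up. Left multiplication by r_i permutes the
positive real roots other than α_i (`reflIdx_simpleRoot_pos`), so it changes `relLength` by the sign
of ⟨α_i^∨, xλ⟩ (`relLength_simpleRefl_mul`). On Peterson representatives `relLength` is the
semi-infinite length (`hasSiLength_iff`, `shiftSum_posRoots_eq_relLength`). An edge x → r_β x
therefore means ⟨β^∨, xλ⟩ > 0 together with growth of `relLength` by one (`siEdge_iff`). By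
induction on β this growth by one is equivalent to r_β xλ covering xλ in the orbit
(`relLength_eq_iff_covers`). So x ↦ xλ preserves labelled edges, and every edge of the orbit lifts
from any representative of its start (`wtEdge_iff_siEdge`). This gives the projection to LS paths,
and its surjectivity by lifting directed paths (`exists_lift`).

Along an edge not labelled α_i the sign of ⟨α_i^∨, ·⟩ cannot drop, and if it is nonzero and
unchanged the whole edge may be reflected by r_i (`SiStep.simpleRefl_cases`). Along the a-subgraph,
a⟨α_i^∨, ·⟩ is moreover constant modulo ℤ. A path from a nonnegative to a nonpositive value thus
forces integrality (`SiPath.ev_mem`), which makes all local minima of H integral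
(`IsIntegralPath.isHeightFn`). Consequently H is strictly monotone on the interval of a root
operator and takes values strictly between consecutive integers inside it (`IsHeightFn.eInterval`,
`IsHeightFn.fInterval`). That is what is needed to reflect or adjust each directed path of η
(`mem_siLSPaths_of_eInterval`, `mem_siLSPaths_of_fInterval`).

For the crystal axioms, a sequence is handled through its step function: the result of a root
operator is the unique reduced list whose step function is reflected on (t₀, t₁] (`IsReflection`).
The heights of the reflected path are explicit, so the interval of f_i after e_i is the old one and
the operators are mutually inverse; ε_i = -m and φ_i = H(1) - m follow. Uniqueness shows that the
operators commute with the projection, and the crystal structure on LS paths is then transported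
along the surjection. -/

theorem pair_apply (P : RootPairing ι ℂ M N) (h : AffCartan N) (μ : AffDual M) :
    pair P h μ = P.toLinearMap μ.1 h.1 + h.2.1 * μ.2.1 + h.2.2 * μ.2.2 := by
  simp [pair]

theorem realRefl_apply (P : RootPairing ι ℂ M N) (θ : ι) (β : ι × ℤ) (μ : AffDual M) :
    realRefl P θ β μ = μ - pair P (realCoroot P θ β) μ • realRoot P β := by
  simp [realRefl, Module.reflection_apply]

theorem realRefl_realRefl (P : RootPairing ι ℂ M N) (θ : ι) (β : ι × ℤ) (μ : AffDual M) :
    realRefl P θ β (realRefl P θ β μ) = μ :=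
  Module.involutive_reflection (pair_realCoroot_realRoot P θ β) μ

theorem realRefl_mul_self (P : RootPairing ι ℂ M N) (θ : ι) (β : ι × ℤ) :
    realRefl P θ β * realRefl P θ β = 1 := by
  ext1 μ
  simpa using realRefl_realRefl P θ β μ

theorem pair_realCoroot_realRefl_self (P : RootPairing ι ℂ M N) (θ : ι) (β : ι × ℤ)
    (μ : AffDual M) :
    pair P (realCoroot P θ β) (realRefl P θ β μ) = - pair P (realCoroot P θ β) μ := by
  rw [realRefl_apply, map_sub, map_smul, pair_realCoroot_realRoot, smul_eq_mul]
  ring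

theorem realRoot_injective (P : RootPairing ι ℂ M N) : Function.Injective (realRoot P) := by
  rintro ⟨a, m⟩ ⟨c, n⟩ h
  simpa [realRoot] using h

/-- At level zero the central component of a real coroot is invisible, so only its finite part
matters for λ. -/
theorem pair_realCoroot_of_level_zero (P : RootPairing ι ℂ M N) (θ : ι) (β : ι × ℤ)
    {μ : AffDual M} (hμ : μ.2.1 = 0) :
    pair P (realCoroot P θ β) μ = P.coroot' β.1 μ.1 := by
  simp [pair_apply, realCoroot, hμ]

variable {P : RootPairing ι ℂ M N} [P.IsCrystallographic]

/-- The action of the reflection in a real root on the indices of the real roots. -/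
def reflIdx (P : RootPairing ι ℂ M N) [P.IsCrystallographic] (β γ : ι × ℤ) : ι × ℤ :=
  (P.reflectionPerm β.1 γ.1, γ.2 - P.pairingIn ℤ γ.1 β.1 * β.2)

theorem pairing_eq_cast (i j : ι) : P.pairing i j = (P.pairingIn ℤ i j : ℂ) := by
  rw [← P.algebraMap_pairingIn ℤ]; rfl

theorem pair_realCoroot_realRoot' (θ : ι) (β γ : ι × ℤ) :
    pair P (realCoroot P θ β) (realRoot P γ) = (P.pairingIn ℤ γ.1 β.1 : ℂ) := by
  rw [pair_realCoroot_of_level_zero _ _ _ rfl, ← pairing_eq_cast]; rfl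

theorem realRefl_realRoot (θ : ι) (β γ : ι × ℤ) :
    realRefl P θ β (realRoot P γ) = realRoot P (reflIdx P β γ) := by
  rw [realRefl_apply, pair_realCoroot_realRoot']
  ext <;> simp [realRoot, reflIdx, RootPairing.reflection_apply_root, pairing_eq_cast]

@[simp] theorem reflIdx_reflIdx (β γ : ι × ℤ) : reflIdx P β (reflIdx P β γ) = γ := by
  -- `realRefl` needs a normalizing index that does not occur in the statement. Any index will do,
  -- and `β.1` shows that one exists.
  by_cases θ : Nonempty ι
  · obtain ⟨θ⟩ := θ
    exact realRoot_injective P (by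
      rw [← realRefl_realRoot θ, ← realRefl_realRoot θ, realRefl_realRefl])
  · exact (θ ⟨β.1⟩).elim

theorem reflIdx_shift (β γ : ι × ℤ) (k : ℤ) :
    reflIdx P β (γ.1, γ.2 + k) = ((reflIdx P β γ).1, (reflIdx P β γ).2 + k) := by
  simp [reflIdx]; ring

/-- Both sides equal twice the normalized form of the two coroots, by invariance of the coroot form.
This is what makes the central coefficients of affine coroots transform correctly. -/
theorem pairing_mul_normForm_eq (θ i j : ι) :
    P.pairing i j * normForm P θ (P.coroot i) (P.coroot i) =
      P.pairing j i * normForm P θ (P.coroot j) (P.coroot j) := by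
  have h : P.pairing i j * P.CorootForm (P.coroot i) (P.coroot i) =
      P.pairing j i * P.CorootForm (P.coroot j) (P.coroot j) :=
    P.flip.toInvariantForm.pairing_mul_eq_pairing_mul_swap i j
  simp only [normForm]
  linear_combination normFactor P θ * h

theorem normForm_reflectionPerm (θ i j : ι) :
    normForm P θ (P.coroot (P.reflectionPerm i j)) (P.coroot (P.reflectionPerm i j)) =
      normForm P θ (P.coroot j) (P.coroot j) := by
  have := P.flip.rootForm_reflection_reflection_apply i (P.coroot j) (P.coroot j)
  rw [normForm, normForm, P.coroot_reflectionPerm]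
  exact congrArg _ this

/-- The normalization that gives α_0^∨ the central coefficient 1. -/
theorem normForm_coroot_self (θ : ι) : normForm P θ (P.coroot θ) (P.coroot θ) = 2 := by
  rw [normForm, normFactor, div_mul_cancel₀]
  exact RootPairing.IsAnisotropic.corootForm_coroot_ne_zero θ

theorem normIso_coroot_self (θ : ι) : normIso P θ (P.coroot θ) = P.root θ := by
  have h := P.corootForm_self_smul_root θ
  have h0 : P.CorootForm (P.coroot θ) (P.coroot θ) ≠ 0 :=
    RootPairing.IsAnisotropic.corootForm_coroot_ne_zero θ
  rw [normIso, normFactor, div_eq_inv_mul, mul_smul,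
    inv_smul_eq_iff₀ h0, h, ofNat_smul_eq_nsmul]

/-- Passing to the coroot commutes with reflections: on finite parts this is the reflection of
coroots, and the central coefficients agree by `pairing_mul_normForm_eq`. -/
theorem pair_realCoroot_reflIdx (θ : ι) (β γ : ι × ℤ) (μ : AffDual M) :
    pair P (realCoroot P θ (reflIdx P β γ)) μ =
      pair P (realCoroot P θ γ) (realRefl P θ β μ) := by
  rw [realRefl_apply, map_sub, map_smul, pair_realCoroot_realRoot', ← pairing_eq_cast]
  simp only [pair_apply, realCoroot, reflIdx, normForm_reflectionPerm]
  simp only [RootPairing.coroot_reflectionPerm, RootPairing.coreflection_apply_coroot, map_sub, map_smul,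
    smul_eq_mul]
  have h := pairing_mul_normForm_eq (P := P) θ γ.1 β.1
  push_cast
  rw [← pairing_eq_cast]
  linear_combination (-β.2 * μ.2.1 / 2) * h

theorem realRefl_reflIdx (θ : ι) (β γ : ι × ℤ) :
    realRefl P θ (reflIdx P β γ) = realRefl P θ β * realRefl P θ γ * realRefl P θ β := by
  ext1 μ
  simp only [LinearEquiv.mul_apply]
  rw [realRefl_apply P θ (reflIdx P β γ), realRefl_apply P θ γ, map_sub, map_smul,
    realRefl_realRefl, realRefl_realRoot, pair_realCoroot_reflIdx]

end RealRoots

section Positivity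

variable {ι M N : Type*} [Fintype ι] [AddCommGroup M] [Module ℂ M] [AddCommGroup N] [Module ℂ N]
variable {P : RootPairing ι ℂ M N} [P.IsRootSystem] [P.IsCrystallographic] [P.IsReduced]
variable {b : P.Base} {θ : ι}

/-! ## Heights and positivity of real roots -/

theorem height_reflectionPerm (i j : ι) :
    b.height (P.reflectionPerm j i) = b.height i - P.pairingIn ℤ i j * b.height j := by
  have : P.root (P.reflectionPerm j i) = P.root i + (-P.pairingIn ℤ i j) • P.root j := by
    rw [RootPairing.root_reflectionPerm, neg_smul, RootPairing.reflection_apply_root' ℤ,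
      sub_eq_add_neg]
  rw [b.height_add_zsmul this]
  simp [sub_eq_add_neg]

theorem height_neg (i : ι) : b.height (P.reflectionPerm i i) = - b.height i :=
  b.height_reflectionPerm_self i

theorem root_neg (i : ι) : P.root (P.reflectionPerm i i) = - P.root i := by simp

theorem neg_neg_idx (i : ι) :
    P.reflectionPerm (P.reflectionPerm i i) (P.reflectionPerm i i) = i :=
  P.root.injective (by rw [root_neg, root_neg, neg_neg])

theorem reflectionPerm_neg (i j : ι) :
    P.reflectionPerm (P.reflectionPerm i i) j = P.reflectionPerm i j := by
  apply P.root.injective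
  have h : P.coroot' (P.reflectionPerm i i) (P.root j) = - P.coroot' i (P.root j) := by
    rw [RootPairing.root_coroot'_eq_pairing, RootPairing.root_coroot'_eq_pairing,
      RootPairing.pairing_reflectionPerm_self_right]
  rw [RootPairing.root_reflectionPerm, RootPairing.root_reflectionPerm,
    RootPairing.reflection_apply, RootPairing.reflection_apply, root_neg, h]
  module

/-- The linear functional on the dual of the finite Cartan subalgebra that takes the value `1` at
all simple roots. -/
def finHeight (b : P.Base) : M →ₗ[ℂ] ℂ := b.toWeightBasis.constr ℂ fun _ => 1

theorem finHeight_root (i : ι) : finHeight b (P.root i) = b.height i := by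
  obtain ⟨f, -, -, hf⟩ := b.exists_root_eq_sum_int i
  rw [RootPairing.Base.height_eq_sum hf, hf, map_sum]
  push_cast
  refine Finset.sum_congr rfl fun j hj => ?_
  have h : finHeight b (P.root j) = 1 := by
    have := b.toWeightBasis.constr_basis ℂ (fun _ => (1 : ℂ)) ⟨j, hj⟩
    simpa [finHeight] using this
  rw [map_zsmul, h]
  simp

/-- Every simple root has height 1, so the height counts summands. Applied to differences from `θ`,
it shows that the highest root is the unique root of maximal height. -/
theorem finHeight_of_mem_closure {x : M} (hx : x ∈ AddSubmonoid.closure (P.root '' b.support)) :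
    ∃ n : ℕ, finHeight b x = n ∧ (n = 0 → x = 0) := by
  induction hx using AddSubmonoid.closure_induction with
  | mem x hx =>
    obtain ⟨j, hj, rfl⟩ := hx
    exact ⟨1, by rw [finHeight_root, RootPairing.Base.height_one_of_mem_support hj]; simp, by simp⟩
  | zero => exact ⟨0, by simp, by simp⟩
  | add x y _ _ hx hy =>
    obtain ⟨m, hm, hm0⟩ := hx
    obtain ⟨n, hn, hn0⟩ := hy
    refine ⟨m + n, by rw [map_add, hm, hn]; simp, fun h => ?_⟩
    rw [hm0 (by lia), hn0 (by lia), add_zero]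

theorem IsHighestRoot.height_le (hθ : IsHighestRoot b θ) (k : ι) : b.height k ≤ b.height θ := by
  obtain ⟨n, hn, -⟩ := finHeight_of_mem_closure (hθ k)
  rw [map_sub, finHeight_root, finHeight_root] at hn
  have : b.height θ - b.height k = n := by exact_mod_cast hn
  lia

theorem IsHighestRoot.eq_of_height_le (hθ : IsHighestRoot b θ) {k : ι}
    (hk : b.height θ ≤ b.height k) : k = θ := by
  obtain ⟨n, hn, hn0⟩ := finHeight_of_mem_closure (hθ k)
  rw [map_sub, finHeight_root, finHeight_root] at hn
  have h1 : b.height θ - b.height k = n := by exact_mod_cast hn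
  have := hn0 (by lia)
  exact (P.root.injective (sub_eq_zero.mp this)).symm

theorem IsHighestRoot.neg_le_height (hθ : IsHighestRoot b θ) (k : ι) :
    - b.height θ ≤ b.height k := by
  have := hθ.height_le (P.reflectionPerm k k)
  rw [height_neg] at this
  lia

theorem IsHighestRoot.height_pos (hθ : IsHighestRoot b θ) : 0 < b.height θ := by
  have h1 := hθ.neg_le_height θ
  have := b.height_ne_zero θ
  lia

/-- The height of a real root with respect to the affine simple roots. -/
def affHeight (b : P.Base) (θ : ι) (β : ι × ℤ) : ℤ := b.height β.1 + β.2 * (b.height θ + 1)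

/-- The linear extension of `affHeight`. -/
def affHeightLin (b : P.Base) (θ : ι) : AffDual M →ₗ[ℂ] ℂ :=
  (finHeight b).comp (LinearMap.fst ℂ M (ℂ × ℂ)) +
    ((b.height θ : ℂ) + 1) • (LinearMap.snd ℂ ℂ ℂ).comp (LinearMap.snd ℂ M (ℂ × ℂ))

theorem affHeightLin_realRoot (β : ι × ℤ) :
    affHeightLin b θ (realRoot P β) = affHeight b θ β := by
  simp [affHeightLin, affHeight, realRoot, finHeight_root, mul_comm]

theorem affHeight_simpleRoot (i : Option b.support) : affHeight b θ (simpleRoot b θ i) = 1 := by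
  cases i with
  | none => simp only [affHeight, simpleRoot, height_neg]; ring
  | some i => simp [affHeight, simpleRoot, RootPairing.Base.height_one_of_mem_support i.2]

/-- Finite roots have height at least -ht θ, so a single δ, of affine height ht θ + 1, outweighs any
finite part. -/
theorem affHeight_pos (hθ : IsHighestRoot b θ) {β : ι × ℤ} (hβ : β ∈ posRealRoots b) :
    0 < affHeight b θ β := by
  have h1 := hθ.neg_le_height β.1
  have h2 := hθ.height_pos
  rcases hβ with ⟨h, h0⟩ | h
  · rw [affHeight, h0]
    simpa using (RootPairing.Base.isPos_iff b).mp h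
  · rw [affHeight]
    nlinarith

theorem affHeight_reflIdx (β γ : ι × ℤ) :
    affHeight b θ (reflIdx P β γ) =
      affHeight b θ γ - P.pairingIn ℤ γ.1 β.1 * affHeight b θ β := by
  simp only [affHeight, reflIdx, height_reflectionPerm]
  ring

theorem simpleRoot_pos (i : Option b.support) :
    simpleRoot b θ i ∈ posRealRoots b := by
  cases i with
  | none => right; simp [simpleRoot]
  | some i => left; exact ⟨RootPairing.Base.isPos_of_mem_support i.2, rfl⟩

/-- For i ∈ I the δ-coefficient is unchanged and the finite statement applies. For α_0 the
coefficient changes by ⟨α, θ^∨⟩, and the bounds -ht θ ≤ ht ≤ ht θ before and after reflecting leave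
-θ as the only root that loses more than one δ. -/
theorem reflIdx_simpleRoot_pos (hθ : IsHighestRoot b θ) (i : Option b.support) {β : ι × ℤ}
    (hβ : β ∈ posRealRoots b) (hne : β ≠ simpleRoot b θ i) :
    reflIdx P (simpleRoot b θ i) β ∈ posRealRoots b := by
  obtain ⟨a, n⟩ := β
  cases i with
  | some i =>
    rcases hβ with ⟨h, h0⟩ | h
    · left
      simp only at h h0
      subst h0
      refine ⟨h.reflectionPerm i.2 fun h' => hne ?_, by simp [reflIdx, simpleRoot]⟩
      simp [simpleRoot, h']
    · right
      simpa [reflIdx, simpleRoot] using h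
  | none =>
    have hrefl : P.reflectionPerm (P.reflectionPerm θ θ) a = P.reflectionPerm θ a := reflectionPerm_neg θ a
    have hh : reflIdx P (simpleRoot b θ none) (a, n) =
        (P.reflectionPerm θ a, n + P.pairingIn ℤ a θ) := by
      simp [reflIdx, simpleRoot, hrefl]
    rw [hh]
    have hht := height_reflectionPerm (b := b) a θ
    set c := P.pairingIn ℤ a θ with hc
    have h1 := hθ.height_le (P.reflectionPerm θ a)
    have h2 := hθ.neg_le_height (P.reflectionPerm θ a)
    have h3 := hθ.height_le a
    have h4 := hθ.neg_le_height a
    have h5 := hθ.height_pos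
    simp only [posRealRoots, Set.mem_ofPred_eq, RootPairing.Base.isPos_iff'] at hβ ⊢
    -- The reflected root has height ht a - c · ht θ ≤ ht θ, so c ≤ -2 forces ht a ≤ -ht θ, which
    -- only -θ attains.
    have hcn : c ≤ -2 → a = P.reflectionPerm θ θ := by
      intro hc2
      have : b.height θ ≤ b.height (P.reflectionPerm a a) := by
        rw [height_neg]; nlinarith
      have := hθ.eq_of_height_le this
      rw [← this, neg_neg_idx]
    have hθ2 : P.pairingIn ℤ (P.reflectionPerm θ θ) θ = -2 := by simp
    rcases hβ with ⟨h, h0⟩ | h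
    · have hc0 : 0 ≤ c := by
        by_contra hlt
        have : c ≤ -1 := by lia
        have h6 : 0 < b.height a := lt_of_le_of_ne h (b.height_ne_zero a).symm
        nlinarith
      rcases hc0.eq_or_lt with h6 | h6
      · left; constructor
        · rw [hht, ← h6]; simpa using h
        · lia
      · right; lia
    -- The new coefficient is n + c with n ≥ 1. If c ≤ -2 the root is -θ + nδ, and n = 1 would be
    -- α_0, so n ≥ 2. Whenever the new coefficient vanishes, the finite part has to be checked to be
    -- positive.
    · by_cases hc2 : c ≤ -2
      · have ha := hcn hc2
        have hcc : c = -2 := by rw [hc, ha, hθ2]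
        have hn : n ≠ 1 := by
          rintro rfl
          exact hne (by rw [ha]; rfl)
        rcases (show 2 ≤ n by lia).eq_or_lt with h7 | h7
        · left; constructor
          · rw [hht, hcc, ha, height_neg]; lia
          · lia
        · right; lia
      · rcases (show 0 ≤ n + c by lia).eq_or_lt with h7 | h7
        · left; constructor
          · rw [hht, show c = -1 by lia]; lia
          · exact h7.symm
        · right; exact h7

/-- For a positive finite part this is classical. Otherwise suppose that no simple root pairs
positively with β^∨. As θ + β is a sum of simple roots, ⟨θ, β^∨⟩ + 2 ≤ 0, whereas the node 0 gives
⟨θ, β^∨⟩ ≥ 0. -/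
theorem exists_simpleRoot_pairing_pos (hθ : IsHighestRoot b θ) (β : ι × ℤ) :
    ∃ i : Option b.support, 0 < P.pairingIn ℤ (simpleRoot b θ i).1 β.1 := by
  by_cases hp : b.IsPos β.1
  · obtain ⟨j, hj, h⟩ := hp.exists_mem_support_pos_pairingIn
    exact ⟨some ⟨j, hj⟩, h⟩
  · by_contra! hcon
    have hcl : ∀ x ∈ AddSubmonoid.closure (P.root '' b.support),
        ∃ n : ℕ, P.coroot' β.1 x = -(n : ℂ) := by
      intro x hx
      induction hx using AddSubmonoid.closure_induction with
      | mem x hx =>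
        obtain ⟨j, hj, rfl⟩ := hx
        have h := hcon (some ⟨j, hj⟩)
        simp only [simpleRoot] at h
        refine ⟨(-P.pairingIn ℤ j β.1).toNat, ?_⟩
        rw [RootPairing.root_coroot'_eq_pairing, pairing_eq_cast]
        have : ((-P.pairingIn ℤ j β.1).toNat : ℤ) = -P.pairingIn ℤ j β.1 :=
          Int.toNat_of_nonneg (by lia)
        rw [← Int.cast_natCast, this]
        simp
      | zero => exact ⟨0, by simp⟩
      | add x y _ _ hx hy =>
        obtain ⟨m, hm⟩ := hx
        obtain ⟨n, hn⟩ := hy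
        exact ⟨m + n, by rw [map_add, hm, hn]; push_cast; ring⟩
    obtain ⟨n, hn⟩ := hcl _ (hθ (P.reflectionPerm β.1 β.1))
    rw [map_sub, RootPairing.root_coroot'_eq_pairing, RootPairing.root_coroot'_eq_pairing,
      pairing_eq_cast, pairing_eq_cast, RootPairing.pairingIn_reflectionPerm_self_left,
      RootPairing.pairingIn_same] at hn
    have hn' : P.pairingIn ℤ θ β.1 - -2 = -n := by exact_mod_cast hn
    have h := hcon none
    simp only [simpleRoot, RootPairing.pairingIn_reflectionPerm_self_left] at h
    lia

/-- Induction on the affine height, which drops when β is reflected in a simple root pairing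
positively with it. Statements about r_β are thereby reduced to simple reflections and conjugation,
and the sign of the pairing is handed to the induction step. -/
theorem posRealRoots_induction (hθ : IsHighestRoot b θ) {p : ∀ β, β ∈ posRealRoots b → Prop}
    (simple : ∀ i, p (simpleRoot b θ i) (simpleRoot_pos i))
    (step : ∀ β i, ∀ hβ : β ∈ posRealRoots b, β ≠ simpleRoot b θ i →
      0 < P.pairingIn ℤ (simpleRoot b θ i).1 β.1 →
      ∀ hβ' : reflIdx P (simpleRoot b θ i) β ∈ posRealRoots b,
      p (reflIdx P (simpleRoot b θ i) β) hβ' → p β hβ)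
    {β : ι × ℤ} (hβ : β ∈ posRealRoots b) : p β hβ := by
  induction hN : (affHeight b θ β).toNat using Nat.strong_induction_on generalizing β with
  | _ m ih =>
    obtain ⟨i, hi⟩ := exists_simpleRoot_pairing_pos hθ β
    by_cases hne : β = simpleRoot b θ i
    · subst hne; exact simple i
    have hpos := reflIdx_simpleRoot_pos hθ i hβ hne
    refine step β i hβ hne hi hpos (ih _ ?_ hpos rfl)
    have h1 := affHeight_reflIdx (θ := θ) (b := b) (simpleRoot b θ i) β
    rw [affHeight_simpleRoot] at h1
    have h2 := affHeight_pos hθ hβ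
    have h3 : 0 < P.pairingIn ℤ β.1 (simpleRoot b θ i).1 := (P.zero_lt_pairingIn_iff' ℤ).mp hi
    lia

/-- The least `k` such that `β + k δ` is positive. -/
def posShift (b : P.Base) (β : ι × ℤ) : ℤ :=
  open scoped Classical in -β.2 + if b.IsPos β.1 then 0 else 1

theorem posShift_le_iff (β : ι × ℤ) (k : ℤ) :
    posShift b β ≤ k ↔ (β.1, β.2 + k) ∈ posRealRoots b := by
  simp only [posShift, posRealRoots, Set.mem_ofPred_eq]
  split_ifs with h <;> simp [h] <;> lia

theorem posShift_nonpos_iff (β : ι × ℤ) : posShift b β ≤ 0 ↔ β ∈ posRealRoots b := by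
  simpa using posShift_le_iff (b := b) β 0

theorem posShift_shift (a : ι) (n k : ℤ) : posShift b (a, n + k) = posShift b (a, n) - k := by
  simp only [posShift]; ring

theorem isPos_neg_iff (i : ι) : b.IsPos (P.reflectionPerm i i) ↔ ¬ b.IsPos i :=
  RootPairing.Base.IsPos.neg_iff_not b i

theorem posShift_neg (β : ι × ℤ) :
    posShift b (P.reflectionPerm β.1 β.1, -β.2) = 1 - posShift b β := by
  by_cases h : b.IsPos β.1
  · simp only [posShift, isPos_neg_iff, h, not_true, if_false, if_true]; ring
  · simp only [posShift, isPos_neg_iff, h, not_false_iff, if_false, if_true]; ring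

theorem neg_pos_iff (β : ι × ℤ) :
    (P.reflectionPerm β.1 β.1, -β.2) ∈ posRealRoots b ↔ β ∉ posRealRoots b := by
  rw [← posShift_nonpos_iff, ← posShift_nonpos_iff, posShift_neg]
  lia

/-- If the finite part is not that of ±α_i, then no β + kδ is ±α_i, so r_i preserves positivity for
every k at once. -/
theorem posShift_reflIdx_of_ne (hθ : IsHighestRoot b θ) (i : Option b.support) {β : ι × ℤ}
    (h1 : β.1 ≠ (simpleRoot b θ i).1)
    (h2 : β.1 ≠ P.reflectionPerm (simpleRoot b θ i).1 (simpleRoot b θ i).1) :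
    posShift b (reflIdx P (simpleRoot b θ i) β) = posShift b β := by
  have key : ∀ β : ι × ℤ, β.1 ≠ (simpleRoot b θ i).1 → ∀ k,
      posShift b β ≤ k → posShift b (reflIdx P (simpleRoot b θ i) β) ≤ k := by
    intro β hβ k hk
    rw [posShift_le_iff] at hk ⊢
    rw [← reflIdx_shift]
    exact reflIdx_simpleRoot_pos hθ i hk fun h => hβ (by rw [← h])
  refine le_antisymm (key β h1 _ le_rfl) ?_
  have := key (reflIdx P (simpleRoot b θ i) β) (fun h => h2 ?_) _ le_rfl
  · rwa [reflIdx_reflIdx] at this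
  · simp only [reflIdx] at h
    rw [← P.reflectionPerm_self (simpleRoot b θ i).1 β.1, h]

theorem posShift_simpleRoot_shift (hθ : IsHighestRoot b θ) (i : Option b.support) (k : ℤ) :
    posShift b ((simpleRoot b θ i).1, k) = (simpleRoot b θ i).2 - k := by
  cases i with
  | none =>
    have : ¬ b.IsPos (P.reflectionPerm θ θ) := by
      rw [isPos_neg_iff, not_not]; exact hθ.height_pos
    simp [posShift, simpleRoot, this]; ring
  | some i => simp [posShift, simpleRoot, RootPairing.Base.isPos_of_mem_support i.2]

theorem posShift_reflIdx_of_eq (hθ : IsHighestRoot b θ) (i : Option b.support) {β : ι × ℤ}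
    (h1 : β.1 = (simpleRoot b θ i).1) :
    posShift b (reflIdx P (simpleRoot b θ i) β) = posShift b β + 1 := by
  obtain ⟨a, k⟩ := β
  simp only at h1
  subst h1
  -- With n_i the δ-coefficient of α_i, the reflected root is the negative of the root with the same
  -- finite part and δ-coefficient 2n_i - k; so `posShift_neg` and the explicit shift in the
  -- direction of α_i decide.
  have h := posShift_neg (b := b) ((simpleRoot b θ i).1, 2 * (simpleRoot b θ i).2 - k)
  simp only [reflIdx, RootPairing.pairingIn_same] at h ⊢
  rw [posShift_simpleRoot_shift hθ] at h ⊢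
  rw [show k - 2 * (simpleRoot b θ i).2 = -(2 * (simpleRoot b θ i).2 - k) by ring, h]
  ring

theorem reflectionPerm_neg_self (i : ι) :
    P.reflectionPerm i (P.reflectionPerm i i) = i := P.reflectionPerm_self i i

theorem posShift_reflIdx_of_eq_neg (hθ : IsHighestRoot b θ) (i : Option b.support) {β : ι × ℤ}
    (h1 : β.1 = P.reflectionPerm (simpleRoot b θ i).1 (simpleRoot b θ i).1) :
    posShift b (reflIdx P (simpleRoot b θ i) β) = posShift b β - 1 := by
  have h := posShift_reflIdx_of_eq hθ i (β := reflIdx P (simpleRoot b θ i) β)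
    (by simp only [reflIdx]; rw [h1, reflectionPerm_neg_self])
  rw [reflIdx_reflIdx] at h
  lia

end Positivity

section WeylGroups

variable {ι M N : Type*} [Fintype ι] [AddCommGroup M] [Module ℂ M] [AddCommGroup N] [Module ℂ N]
variable {P : RootPairing ι ℂ M N} {b : P.Base} {θ : ι}

/-! ## The affine and the finite Weyl group -/

theorem simpleRefl_mul_self (i : Option b.support) : simpleRefl b θ i * simpleRefl b θ i = 1 :=
  realRefl_mul_self P θ _

theorem simpleRefl_inv (i : Option b.support) : (simpleRefl b θ i)⁻¹ = simpleRefl b θ i :=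
  inv_eq_of_mul_eq_one_left (simpleRefl_mul_self i)

theorem simpleRefl_mul_cancel (i : Option b.support) (x : AffDual M ≃ₗ[ℂ] AffDual M) :
    simpleRefl b θ i * (simpleRefl b θ i * x) = x := by
  rw [← mul_assoc, simpleRefl_mul_self, one_mul]

theorem simpleRefl_mem (i : Option b.support) : simpleRefl b θ i ∈ affineWeyl b θ :=
  Subgroup.subset_closure ⟨i, rfl⟩

theorem simpleRefl_some_mem (i : b.support) : simpleRefl b θ (some i) ∈ finiteWeyl b θ :=
  Subgroup.subset_closure ⟨i, rfl⟩

theorem affineWeyl_induction {p : ∀ x, x ∈ affineWeyl b θ → Prop} (one : p 1 (one_mem _))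
    (mul : ∀ i x hx, p x hx → p (simpleRefl b θ i * x) (mul_mem (simpleRefl_mem i) hx))
    {x : AffDual M ≃ₗ[ℂ] AffDual M} (hx : x ∈ affineWeyl b θ) : p x hx := by
  induction hx using Subgroup.closure_induction_left with
  | one => exact one
  | mul_left x hx y hy h => obtain ⟨i, rfl⟩ := hx; exact mul i y hy h
  | inv_mul_cancel x hx y hy h =>
    obtain ⟨i, rfl⟩ := hx
    simp only [simpleRefl_inv]
    exact mul i y hy h

theorem affineWeyl_induction_right {p : ∀ x, x ∈ affineWeyl b θ → Prop} (one : p 1 (one_mem _))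
    (mul : ∀ i x hx, p x hx → p (x * simpleRefl b θ i) (mul_mem hx (simpleRefl_mem i)))
    {x : AffDual M ≃ₗ[ℂ] AffDual M} (hx : x ∈ affineWeyl b θ) : p x hx := by
  induction hx using Subgroup.closure_induction_right with
  | one => exact one
  | mul_right x hx y hy h => obtain ⟨i, rfl⟩ := hy; exact mul i x hx h
  | mul_inv_cancel x hx y hy h =>
    obtain ⟨i, rfl⟩ := hy
    simp only [simpleRefl_inv]
    exact mul i x hx h

variable [P.IsCrystallographic]

/-- `x` sends the real root `α + k δ` to `σ α + (k + n_α) δ`, and acts on coroots accordingly. -/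
structure ActsBy (θ : ι) (x : AffDual M ≃ₗ[ℂ] AffDual M) (P : RootPairing ι ℂ M N)
    (σ : Equiv.Perm ι) (n : ι → ℤ) : Prop where
  map_realRoot : ∀ a k, x (realRoot P (a, k)) = realRoot P (σ a, k + n a)
  pair_map : ∀ a k μ, pair P (realCoroot P θ (σ a, k + n a)) (x μ) = pair P (realCoroot P θ (a, k)) μ

theorem ActsBy.refl_mul {x : AffDual M ≃ₗ[ℂ] AffDual M} {σ : Equiv.Perm ι} {n : ι → ℤ}
    (h : ActsBy θ x P σ n) (β : ι × ℤ) :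
    ActsBy θ (realRefl P θ β * x) P (σ.trans (P.reflectionPerm β.1))
      fun a => n a - P.pairingIn ℤ (σ a) β.1 * β.2 where
  map_realRoot a k := by
    rw [LinearEquiv.mul_apply, h.map_realRoot, realRefl_realRoot]
    simp [reflIdx, add_sub_assoc]
  pair_map a k μ := by
    rw [LinearEquiv.mul_apply, ← h.pair_map a k μ]
    conv_rhs => rw [← realRefl_realRefl P θ β (x μ), ← pair_realCoroot_reflIdx]
    simp only [reflIdx, Equiv.trans_apply, add_sub_assoc]

theorem exists_actsBy {x : AffDual M ≃ₗ[ℂ] AffDual M} (hx : x ∈ affineWeyl b θ) :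
    ∃ σ n, ActsBy θ x P σ n := by
  induction hx using affineWeyl_induction with
  | one => exact ⟨1, 0, by simp, by simp⟩
  | mul i x hx h =>
    obtain ⟨σ, n, h⟩ := h
    exact ⟨_, _, h.refl_mul _⟩

theorem exists_actsBy_of_mem_finiteWeyl {x : AffDual M ≃ₗ[ℂ] AffDual M}
    (hx : x ∈ finiteWeyl b θ) : ∃ σ, ActsBy θ x P σ 0 := by
  have key : ∀ (i : b.support) (y : AffDual M ≃ₗ[ℂ] AffDual M), (∃ σ, ActsBy θ y P σ 0) →
      ∃ σ, ActsBy θ (simpleRefl b θ (some i) * y) P σ 0 := by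
    rintro i y ⟨σ, h⟩
    refine ⟨σ.trans (P.reflectionPerm i), ?_⟩
    have h1 := h.refl_mul ((i : ι), 0)
    have h2 : (fun a => (0 : ι → ℤ) a - P.pairingIn ℤ (σ a) i * 0) = 0 := by ext; simp
    rw [h2] at h1
    exact h1
  induction hx using Subgroup.closure_induction_left with
  | one => exact ⟨1, by simp, by simp⟩
  | mul_left x hx y hy h => obtain ⟨i, rfl⟩ := hx; exact key i y h
  | inv_mul_cancel x hx y hy h =>
    obtain ⟨i, rfl⟩ := hx
    rw [simpleRefl_inv]
    exact key i y h

/-! ## Sums of shifts over sets of finite roots -/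

open scoped Classical in
/-- The least `k` such that `v + k δ` is positive, for a real root `v`. -/
def rootShift (b : P.Base) (v : AffDual M) : ℤ :=
  if h : ∃ β, realRoot P β = v then posShift b h.choose else 0

theorem rootShift_realRoot (β : ι × ℤ) : rootShift b (realRoot P β) = posShift b β := by
  have h : ∃ β', realRoot P β' = realRoot P β := ⟨β, rfl⟩
  rw [rootShift, dif_pos h]
  exact congrArg _ (realRoot_injective P h.choose_spec)

/-- The sum of the shifts of the real roots `x α`, for `α` in a set of finite roots. -/
def shiftSum (b : P.Base) (S : Finset ι) (x : AffDual M ≃ₗ[ℂ] AffDual M) : ℤ :=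
  ∑ a ∈ S, rootShift b (x (realRoot P (a, 0)))

theorem ActsBy.shiftSum_eq {x : AffDual M ≃ₗ[ℂ] AffDual M} {σ : Equiv.Perm ι} {n : ι → ℤ}
    (h : ActsBy θ x P σ n) (S : Finset ι) : shiftSum b S x = ∑ a ∈ S, posShift b (σ a, n a) := by
  refine Finset.sum_congr rfl fun a _ => ?_
  rw [h.map_realRoot, rootShift_realRoot, zero_add]

variable [P.IsRootSystem] [P.IsReduced]

theorem ActsBy.map_neg {x : AffDual M ≃ₗ[ℂ] AffDual M} {σ : Equiv.Perm ι} {n : ι → ℤ}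
    (h : ActsBy θ x P σ n) (a : ι) :
    σ (P.reflectionPerm a a) = P.reflectionPerm (σ a) (σ a) ∧ n (P.reflectionPerm a a) = - n a := by
  have h1 := h.map_realRoot (P.reflectionPerm a a) 0
  have h2 : realRoot P (P.reflectionPerm a a, 0) = - realRoot P (a, 0) := by
    ext <;> simp [realRoot]
  rw [h2, _root_.map_neg, h.map_realRoot] at h1
  have h3 : - realRoot P (σ a, 0 + n a) = realRoot P (P.reflectionPerm (σ a) (σ a), - n a) := by
    ext <;> simp [realRoot]
  rw [h3] at h1
  have := realRoot_injective P h1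
  simp only [Prod.mk.injEq, zero_add] at this
  exact ⟨this.1.symm, this.2.symm⟩

-- Only the two roots a and -a, which x sends into the directions of α_i and -α_i, change their
-- shift under r_i: one by +1 and the other by -1. Both length formulas, for the finite Weyl group
-- and relative to λ, come from this count.
open scoped Classical in
theorem shiftSum_simpleRefl_mul (hθ : IsHighestRoot b θ) {x : AffDual M ≃ₗ[ℂ] AffDual M}
    {σ : Equiv.Perm ι} {n : ι → ℤ} (h : ActsBy θ x P σ n) (S : Finset ι) (i : Option b.support)
    {a : ι} (ha : σ a = (simpleRoot b θ i).1) :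
    shiftSum b S (simpleRefl b θ i * x) =
      shiftSum b S x + (if a ∈ S then 1 else 0) - (if P.reflectionPerm a a ∈ S then 1 else 0) := by
  have hne : ∀ c, P.reflectionPerm c c ≠ c := fun c hc => by
    have := height_neg (b := b) c
    rw [hc] at this
    have := b.height_ne_zero c
    lia
  rw [simpleRefl, (h.refl_mul _).shiftSum_eq, h.shiftSum_eq]
  have h1 : ∀ c, posShift b (reflIdx P (simpleRoot b θ i) (σ c, n c)) = posShift b (σ c, n c) +
      (if c = a then 1 else 0) - (if c = P.reflectionPerm a a then 1 else 0) := by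
    intro c
    by_cases hc : c = a
    · rw [posShift_reflIdx_of_eq hθ i (by simp [hc, ha]), if_pos hc, if_neg, sub_zero]
      rw [hc]; exact (hne a).symm
    · by_cases hc' : c = P.reflectionPerm a a
      · rw [posShift_reflIdx_of_eq_neg hθ i (by simp [hc', (h.map_neg a).1, ha]), if_neg hc,
          if_pos hc', add_zero]
      · rw [posShift_reflIdx_of_ne hθ, if_neg hc, if_neg hc', add_zero, sub_zero]
        · simpa [← ha] using hc
        · simpa [← ha, ← (h.map_neg a).1] using hc'
  calc _ = ∑ c ∈ S, posShift b (reflIdx P (simpleRoot b θ i) (σ c, n c)) := rfl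
    _ = _ := by
      simp only [h1, Finset.sum_add_distrib, Finset.sum_sub_distrib, Finset.sum_ite_eq']

/-! ## The length function of the finite Weyl group -/

open scoped Classical in
/-- The set of positive roots. -/
def posRoots (b : P.Base) : Finset ι := {j | b.IsPos j}

theorem mem_posRoots {j : ι} : j ∈ posRoots b ↔ b.IsPos j := by simp [posRoots]

/-- The product of a word in the finite simple reflections. -/
def wordProd (b : P.Base) (θ : ι) (w : List b.support) : AffDual M ≃ₗ[ℂ] AffDual M :=
  (w.map fun i => simpleRefl b θ (some i)).prod

theorem wordProd_cons (i : b.support) (w : List b.support) :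
    wordProd b θ (i :: w) = simpleRefl b θ (some i) * wordProd b θ w := by simp [wordProd]

theorem wordProd_mem (w : List b.support) : wordProd b θ w ∈ finiteWeyl b θ := by
  refine Subgroup.list_prod_mem _ fun x hx => ?_
  obtain ⟨i, -, rfl⟩ := List.mem_map.mp hx
  exact simpleRefl_some_mem i

theorem exists_wordProd {v : AffDual M ≃ₗ[ℂ] AffDual M} (hv : v ∈ finiteWeyl b θ) :
    ∃ w, wordProd b θ w = v := by
  induction hv using Subgroup.closure_induction_left with
  | one => exact ⟨[], rfl⟩
  | mul_left x hx y hy h =>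
    obtain ⟨i, rfl⟩ := hx
    obtain ⟨w, rfl⟩ := h
    exact ⟨i :: w, wordProd_cons i w⟩
  | inv_mul_cancel x hx y hy h =>
    obtain ⟨i, rfl⟩ := hx
    obtain ⟨w, rfl⟩ := h
    rw [simpleRefl_inv]
    exact ⟨i :: w, wordProd_cons i w⟩

/-- The exchange condition: β becomes negative when the letters are stripped from the left, and the
letter at which this happens is the one to delete. -/
theorem exists_shorter_word (w : List b.support) {β γ : ι} (hβ : b.IsPos β) (hγ : ¬ b.IsPos γ)
    (h : wordProd b θ w (realRoot P (γ, 0)) = realRoot P (β, 0)) :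
    ∃ w' : List b.support, w'.length + 1 = w.length ∧
      wordProd b θ w' = realRefl P θ (β, 0) * wordProd b θ w := by
  induction w generalizing β with
  | nil =>
    have := realRoot_injective P (h : realRoot P (γ, 0) = _)
    simp only [Prod.mk.injEq, and_true] at this
    exact (hγ (this ▸ hβ)).elim
  | cons j w ih =>
    by_cases hj : β = j
    · refine ⟨w, by simp, ?_⟩
      rw [wordProd_cons, hj]
      exact (simpleRefl_mul_cancel (some j) _).symm
    · have h1 : reflIdx P (simpleRoot b θ (some j)) (β, 0) = (P.reflectionPerm j β, 0) := by
        simp [reflIdx, simpleRoot]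
      have h2 : wordProd b θ w (realRoot P (γ, 0)) = realRoot P (P.reflectionPerm j β, 0) := by
        rw [wordProd_cons, LinearEquiv.mul_apply] at h
        have := congrArg (simpleRefl b θ (some j)) h
        rw [← LinearEquiv.mul_apply, simpleRefl_mul_self, simpleRefl, realRefl_realRoot, h1] at this
        exact this
      obtain ⟨w', hw', hp⟩ := ih (hβ.reflectionPerm j.2 hj) h2
      refine ⟨j :: w', by simp [hw'], ?_⟩
      rw [wordProd_cons, hp, ← h1, realRefl_reflIdx, wordProd_cons]
      change simpleRefl b θ (some j) *
        (simpleRefl b θ (some j) * _ * simpleRefl b θ (some j) * _) = _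
      simp only [mul_assoc, simpleRefl_mul_cancel]

/-- For a finite element the shift of wα is 0 or 1, so the sum counts inversions. Each letter of a
reduced word adds one: if the preimage of α_i were negative, `exists_shorter_word` would shorten the
word. -/
theorem length_eq_shiftSum (hθ : IsHighestRoot b θ) (w : List b.support)
    (hw : ∀ w' : List b.support, wordProd b θ w' = wordProd b θ w → w.length ≤ w'.length) :
    (w.length : ℤ) = shiftSum b (posRoots b) (wordProd b θ w) := by
  induction w with
  | nil =>
    have h : ActsBy θ (1 : AffDual M ≃ₗ[ℂ] AffDual M) P 1 0 := ⟨by simp, by simp⟩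
    change 0 = shiftSum b (posRoots b) 1
    rw [h.shiftSum_eq]
    refine (Finset.sum_eq_zero fun a ha => ?_).symm
    simp [posShift, mem_posRoots.mp ha]
  | cons i w ih =>
    have hw1 : ∀ w' : List b.support, wordProd b θ w' = wordProd b θ w → w.length ≤ w'.length := by
      intro w' h
      have := hw (i :: w') (by rw [wordProd_cons, wordProd_cons, h])
      simpa using this
    obtain ⟨σ, hσ⟩ := exists_actsBy_of_mem_finiteWeyl (wordProd_mem (θ := θ) w)
    obtain ⟨a, ha⟩ := σ.surjective (simpleRoot b θ (some i)).1
    have hpos : b.IsPos a := by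
      by_contra hneg
      obtain ⟨w', hw', hp⟩ := exists_shorter_word (θ := θ) w
        (RootPairing.Base.isPos_of_mem_support i.2) hneg (by rw [hσ.map_realRoot, ha]; rfl)
      have := hw w' (by rw [hp, wordProd_cons]; rfl)
      simp only [List.length_cons] at this
      lia
    rw [wordProd_cons, shiftSum_simpleRefl_mul hθ hσ _ _ ha, ← ih hw1, if_pos (mem_posRoots.mpr hpos),
      if_neg]
    · simp
    · rw [mem_posRoots, isPos_neg_iff, not_not]; exact hpos

theorem finiteLength_eq_shiftSum (hθ : IsHighestRoot b θ) {v : AffDual M ≃ₗ[ℂ] AffDual M}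
    (hv : v ∈ finiteWeyl b θ) : (finiteLength b θ v : ℤ) = shiftSum b (posRoots b) v := by
  have hne : {n | ∃ w : List b.support, w.length = n ∧ wordProd b θ w = v}.Nonempty := by
    obtain ⟨w, hw⟩ := exists_wordProd hv
    exact ⟨_, w, rfl, hw⟩
  obtain ⟨w, hw, hwv⟩ := Nat.sInf_mem hne
  have h1 : w.length = finiteLength b θ v := hw
  rw [← h1, ← hwv]
  refine length_eq_shiftSum hθ w fun w' hw' => ?_
  rw [hw]
  exact Nat.sInf_le ⟨w', rfl, hw'.trans hwv⟩

/-! ## Translations and the semi-infinite length -/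

theorem coroot_mem_corootLattice (j : ι) : P.coroot j ∈ corootLattice b := by
  have := b.coroot_mem_span_int j
  rwa [← Submodule.mem_toAddSubgroup, Submodule.span_int_eq_addSubgroupClosure] at this

theorem root'_int_of_mem_corootLattice {ζ : N} (hζ : ζ ∈ corootLattice b) (j : ι) :
    ∃ k : ℤ, P.root' j ζ = k := by
  induction hζ using AddSubgroup.closure_induction with
  | mem x hx =>
    obtain ⟨i, -, rfl⟩ := hx
    exact ⟨P.pairingIn ℤ j i, by rw [RootPairing.root'_coroot_eq_pairing, pairing_eq_cast]⟩
  | zero => exact ⟨0, by simp⟩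
  | add x y _ _ hx hy =>
    obtain ⟨m, hm⟩ := hx
    obtain ⟨n, hn⟩ := hy
    exact ⟨m + n, by rw [map_add, hm, hn]; simp⟩
  | neg x _ hx =>
    obtain ⟨m, hm⟩ := hx
    exact ⟨-m, by rw [map_neg, hm]; simp⟩

theorem coreflection_mem_corootLattice {ζ : N} (hζ : ζ ∈ corootLattice b) (j : ι) :
    P.coreflection j ζ ∈ corootLattice b := by
  obtain ⟨k, hk⟩ := root'_int_of_mem_corootLattice hζ j
  rw [RootPairing.coreflection_apply, hk, Int.cast_smul_eq_zsmul]
  exact sub_mem hζ (zsmul_mem (coroot_mem_corootLattice j) k)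

theorem toLinearMap_normIso (ξ ζ : N) : P.toLinearMap (normIso P θ ξ) ζ = normForm P θ ξ ζ := by
  rw [normIso, normForm, map_smul, RootPairing.toLinearMap_apply_CoPolarization]
  rfl

theorem normForm_comm (ξ ζ : N) : normForm P θ ξ ζ = normForm P θ ζ ξ := by
  simp only [normForm, RootPairing.corootForm_apply_apply, mul_comm]

theorem normForm_coreflection (j : ι) (ξ ζ : N) :
    normForm P θ (P.coreflection j ξ) (P.coreflection j ζ) = normForm P θ ξ ζ := by
  rw [normForm, normForm]
  exact congrArg _ (P.flip.rootForm_reflection_reflection_apply j ξ ζ)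

theorem normIso_coreflection (j : ι) (ξ : N) :
    normIso P θ (P.coreflection j ξ) = P.reflection j (normIso P θ ξ) := by
  apply P.toPerfPair.injective
  ext ζ
  change P.toLinearMap _ ζ = P.toLinearMap _ ζ
  rw [toLinearMap_normIso, RootPairing.reflection_apply, map_sub, map_smul, LinearMap.sub_apply,
    LinearMap.smul_apply, toLinearMap_normIso]
  have h1 : P.coroot' j (normIso P θ ξ) = normForm P θ ξ (P.coroot j) := toLinearMap_normIso _ _
  have h2 := normForm_coreflection (P := P) (θ := θ) j ξ (P.coreflection j ζ)
  rw [RootPairing.coreflection_same] at h2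
  rw [h1, h2, RootPairing.coreflection_apply]
  simp only [normForm, map_sub, map_smul, smul_eq_mul]
  ring

theorem normIso_add (ξ ζ : N) : normIso P θ (ξ + ζ) = normIso P θ ξ + normIso P θ ζ := by
  simp only [normIso, map_add, smul_add]

theorem translation_apply (ξ : N) (μ : AffDual M) :
    translation P θ ξ μ = (μ.1 + μ.2.1 • normIso P θ ξ, μ.2.1,
      μ.2.2 - (P.toLinearMap μ.1 ξ + normForm P θ ξ ξ / 2 * μ.2.1)) := by
  ext <;> simp [translation, pair_apply, central, nullRoot]

theorem translation_translation (ξ ζ : N) (μ : AffDual M) :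
    translation P θ ξ (translation P θ ζ μ) = translation P θ (ξ + ζ) μ := by
  have h := normForm_comm (P := P) (θ := θ) ξ ζ
  ext
  · simp [translation_apply, normIso_add]; abel
  · simp [translation_apply]
  · simp only [translation_apply, map_add, map_smul, LinearMap.add_apply, LinearMap.smul_apply,
      toLinearMap_normIso, smul_eq_mul]
    have h2 : normForm P θ (ξ + ζ) (ξ + ζ) =
        normForm P θ ξ ξ + normForm P θ ξ ζ + normForm P θ ζ ξ + normForm P θ ζ ζ := by
      simp only [normForm, map_add, LinearMap.add_apply]; ring
    rw [h2, h]
    ring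

theorem realRefl_finite_apply (a : ι) (μ : AffDual M) :
    realRefl P θ (a, 0) μ = (P.reflection a μ.1, μ.2) := by
  rw [realRefl_apply]
  ext <;> simp [pair_apply, realCoroot, realRoot, RootPairing.reflection_apply]

/-- Conjugation by a finite reflection moves the translation vector; this is the semidirect product
relation, written so as to push reflections to the left. -/
theorem translation_realRefl (a : ι) (ξ : N) (μ : AffDual M) :
    translation P θ ξ (realRefl P θ (a, 0) μ) =
      realRefl P θ (a, 0) (translation P θ (P.coreflection a ξ) μ) := by
  rw [realRefl_finite_apply, realRefl_finite_apply, translation_apply, translation_apply]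
  have h : P.toLinearMap (P.reflection a μ.1) ξ = P.toLinearMap μ.1 (P.coreflection a ξ) := by
    rw [RootPairing.reflection_apply, RootPairing.coreflection_apply]
    simp [mul_comm]
  simp [normIso_coreflection, normForm_coreflection, h]

/-- The relation r_0 = t_{θ^∨} r_θ, where the normalized form identifies θ^∨ with θ. -/
theorem simpleRefl_none_apply (μ : AffDual M) :
    simpleRefl b θ none μ = translation P θ (P.coroot θ) (realRefl P θ (θ, 0) μ) := by
  have h2 : P.coroot (P.reflectionPerm θ θ) = - P.coroot θ := by
    rw [RootPairing.coroot_reflectionPerm, RootPairing.coreflection_apply_self]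
  have h3 : normForm P θ (- P.coroot θ) (- P.coroot θ) = 2 := by
    rw [← normForm_coroot_self (P := P) θ]; simp [normForm]
  rw [realRefl_finite_apply, translation_apply, simpleRefl, realRefl_apply, normIso_coroot_self,
    normForm_coroot_self]
  ext
  · simp only [simpleRoot, realCoroot, pair_apply, h2, h3, realRoot, root_neg, Prod.fst_sub,
      Prod.smul_fst, RootPairing.reflection_apply, map_neg]
    rw [show P.coroot' θ μ.1 = P.toLinearMap μ.1 (P.coroot θ) from rfl]
    push_cast
    module
  · simp [realRoot]
  · simp only [simpleRoot, realCoroot, pair_apply, h2, h3, realRoot, Prod.snd_sub,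
      Prod.smul_snd, RootPairing.reflection_apply, map_neg, map_sub, map_smul,
      LinearMap.sub_apply, LinearMap.smul_apply, P.root_coroot_two, smul_eq_mul]
    rw [show P.coroot' θ μ.1 = P.toLinearMap μ.1 (P.coroot θ) from rfl]
    push_cast
    ring

theorem realRefl_finite_mem (a : ι) : realRefl P θ (a, 0) ∈ finiteWeyl b θ := by
  induction a using b.induction_reflect with
  | h₀ a h =>
    have : ((P.reflectionPerm a a, 0) : ι × ℤ) = reflIdx P (a, 0) (a, 0) := by simp [reflIdx]
    rw [this, realRefl_reflIdx]
    exact mul_mem (mul_mem h h) h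
  | h₁ a ha => exact simpleRefl_some_mem ⟨a, ha⟩
  | h₂ a j h hj =>
    have : ((P.reflectionPerm j a, 0) : ι × ℤ) = reflIdx P (j, 0) (a, 0) := by simp [reflIdx]
    rw [this, realRefl_reflIdx]
    exact mul_mem (mul_mem (simpleRefl_some_mem ⟨j, hj⟩) h) (simpleRefl_some_mem ⟨j, hj⟩)

/-- Generators are appended on the right, where they meet the translation factor and can be moved
past it by `translation_realRefl`. -/
theorem exists_eq_mul_translation {x : AffDual M ≃ₗ[ℂ] AffDual M} (hx : x ∈ affineWeyl b θ) :
    ∃ v ∈ finiteWeyl b θ, ∃ ζ ∈ corootLattice b, ∀ μ, x μ = v (translation P θ ζ μ) := by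
  induction hx using affineWeyl_induction_right with
  | one =>
    refine ⟨1, one_mem _, 0, zero_mem _, fun μ => ?_⟩
    rw [translation_apply]
    simp [normIso, normForm]
  | mul i x hx h =>
    obtain ⟨v, hv, ζ, hζ, h⟩ := h
    cases i with
    | some i =>
      refine ⟨v * simpleRefl b θ (some i), mul_mem hv (simpleRefl_some_mem i), _,
        coreflection_mem_corootLattice hζ i, fun μ => ?_⟩
      rw [LinearEquiv.mul_apply, h, LinearEquiv.mul_apply]
      exact congrArg v (translation_realRefl _ _ _)
    | none =>
      refine ⟨v * realRefl P θ (θ, 0), mul_mem hv (realRefl_finite_mem θ), _,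
        coreflection_mem_corootLattice (add_mem hζ (coroot_mem_corootLattice θ)) θ, fun μ => ?_⟩
      rw [LinearEquiv.mul_apply, h, LinearEquiv.mul_apply, simpleRefl_none_apply,
        translation_translation, translation_realRefl]

/-- The translation t_ζ subtracts ⟨ζ, α⟩δ from α, hence adds ⟨ζ, α⟩ to the shift; over the positive
roots this gives 2⟨ζ, ρ⟩, and the remainder is the inversion count of v. The right side depends on x
alone. -/
theorem siLength_eq_of_eq_mul_translation (hθ : IsHighestRoot b θ)
    {x v : AffDual M ≃ₗ[ℂ] AffDual M} {ζ : N} (hv : v ∈ finiteWeyl b θ) (hζ : ζ ∈ corootLattice b)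
    (h : ∀ μ, x μ = v (translation P θ ζ μ)) :
    (finiteLength b θ v : ℂ) + twoRho b ζ = (shiftSum b (posRoots b) x : ℤ) := by
  obtain ⟨σ, hσ⟩ := exists_actsBy_of_mem_finiteWeyl hv
  choose k hk using root'_int_of_mem_corootLattice hζ
  have h1 : ∀ a, rootShift b (x (realRoot P (a, 0))) = posShift b (σ a, 0) + k a := by
    intro a
    have : translation P θ ζ (realRoot P (a, 0)) = realRoot P (a, - k a) := by
      rw [translation_apply]
      have := hk a
      ext <;> simp_all [realRoot]
    rw [h, this, hσ.map_realRoot, rootShift_realRoot]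
    simp [posShift]
    ring
  have h2 := finiteLength_eq_shiftSum hθ hv
  rw [hσ.shiftSum_eq] at h2
  have h3 : ((finiteLength b θ v : ℤ) : ℂ) = finiteLength b θ v := by simp
  have h4 : twoRho b ζ = ((∑ a ∈ posRoots b, k a : ℤ) : ℂ) := by
    rw [twoRho]
    push_cast
    exact Finset.sum_congr rfl fun a _ => hk a
  rw [← h3, h2, h4, ← Int.cast_add]
  simp only [shiftSum, h1, Finset.sum_add_distrib]
  rfl

/-- Replaces the choice of a factorization v t_ζ by an intrinsic sum; in particular the
semi-infinite length is single-valued on W_af. -/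
theorem hasSiLength_iff (hθ : IsHighestRoot b θ) {x : AffDual M ≃ₗ[ℂ] AffDual M}
    (hx : x ∈ affineWeyl b θ) (n : ℤ) :
    HasSiLength b θ x n ↔ n = shiftSum b (posRoots b) x := by
  constructor
  · rintro ⟨v, hv, ζ, hζ, h, hn⟩
    rw [siLength_eq_of_eq_mul_translation hθ hv hζ h] at hn
    exact_mod_cast hn
  · rintro rfl
    obtain ⟨v, hv, ζ, hζ, h⟩ := exists_eq_mul_translation hx
    exact ⟨v, hv, ζ, hζ, h, (siLength_eq_of_eq_mul_translation hθ hv hζ h).symm⟩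

end WeylGroups

section Orbit

variable {ι M N : Type*} [Fintype ι] [AddCommGroup M] [Module ℂ M] [AddCommGroup N] [Module ℂ N]
variable {P : RootPairing ι ℂ M N} {b : P.Base} {θ : ι} {lam : AffDual M}

/-! ## Level-zero dominant integral weights -/

/-- A weight of level zero that takes nonnegative integral values at the finite simple coroots. -/
structure IsLevelZeroDominant (b : P.Base) (θ : ι) (lam : AffDual M) : Prop where
  level : lam.2.1 = 0
  nonneg : ∀ i : b.support, ∃ n : ℕ, pair P (realCoroot P θ (simpleRoot b θ (some i))) lam = n

/-- The integer `⟨β^∨, μ⟩`. -/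
def evInt (P : RootPairing ι ℂ M N) (θ : ι) (β : ι × ℤ) (μ : AffDual M) : ℤ :=
  ⌊(pair P (realCoroot P θ β) μ).re⌋

theorem evInt_eq {β : ι × ℤ} {μ : AffDual M} {n : ℤ} (h : pair P (realCoroot P θ β) μ = n) :
    evInt P θ β μ = n := by
  simp [evInt, h]

variable [P.IsCrystallographic]

theorem evInt_reflIdx (β γ : ι × ℤ) (μ : AffDual M) :
    evInt P θ (reflIdx P β γ) μ = evInt P θ γ (realRefl P θ β μ) := by
  rw [evInt, evInt, pair_realCoroot_reflIdx]

variable [P.IsRootSystem] [P.IsReduced]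

/-- Induction on the height. With α_j a simple root pairing positively with a, the value at a^∨ is
the value at (r_j a)^∨ plus a positive multiple of the value at α_j^∨; both are nonnegative, so the
sum vanishes only if both do, and then a lies in the span of J. -/
theorem dominant_coroot_aux (hlam : IsLevelZeroDominant b θ lam) {a : ι} (ha : b.IsPos a) :
    ∃ n : ℕ, pair P (realCoroot P θ (a, 0)) lam = n ∧ (n = 0 → P.root a ∈
      AddSubgroup.closure ((fun i : b.support => P.root i) '' stabIndex b θ lam)) := by
  induction hN : (b.height a).toNat using Nat.strong_induction_on generalizing a with
  | _ m ih =>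
    obtain ⟨j, hj, hj0⟩ := ha.exists_mem_support_pos_pairingIn
    obtain ⟨k, hk⟩ := hlam.nonneg ⟨j, hj⟩
    have hmem : k = 0 → P.root j ∈
        AddSubgroup.closure ((fun i : b.support => P.root i) '' stabIndex b θ lam) := by
      rintro rfl
      exact AddSubgroup.subset_closure ⟨⟨j, hj⟩, by simpa [stabIndex] using hk, rfl⟩
    by_cases hja : a = j
    · subst hja
      exact ⟨k, hk, hmem⟩
    have hpos := ha.reflectionPerm hj hja
    have hj1 : 0 < P.pairingIn ℤ a j := (P.zero_lt_pairingIn_iff' ℤ).mp hj0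
    have hht := height_reflectionPerm (b := b) a j
    rw [RootPairing.Base.height_one_of_mem_support hj, mul_one] at hht
    have h0 : 0 < b.height a := ha
    obtain ⟨n, hn, hn0⟩ := ih _ (by lia) hpos rfl
    -- Evaluating at (r_j(r_j a))^∨ moves one reflection onto λ; the sign comes from ⟨α_j, (r_j
    -- a)^∨⟩ = -⟨α_j, a^∨⟩.
    have hpair : pair P (realCoroot P θ (a, 0)) lam =
        n + (P.pairingIn ℤ j a : ℂ) * k := by
      have h1 : reflIdx P (j, 0) (P.reflectionPerm j a, 0) = ((a, 0) : ι × ℤ) := by simp [reflIdx]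
      have h2 := pair_realCoroot_reflIdx (P := P) θ (j, 0) (P.reflectionPerm j a, 0) lam
      rw [h1, realRefl_apply, map_sub, map_smul, hn, pair_realCoroot_realRoot'] at h2
      have h3 : pair P (realCoroot P θ (j, 0)) lam = k := hk
      rw [h2, h3, P.pairingIn_reflectionPerm, P.pairingIn_reflectionPerm_self_left]
      push_cast
      rw [smul_eq_mul]
      ring
    refine ⟨n + (P.pairingIn ℤ j a).toNat * k, ?_, fun h => ?_⟩
    · have h1 : ((P.pairingIn ℤ j a).toNat : ℤ) = P.pairingIn ℤ j a := Int.toNat_of_nonneg hj0.le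
      have h2 : ((P.pairingIn ℤ j a).toNat : ℂ) = (P.pairingIn ℤ j a : ℂ) := by exact_mod_cast h1
      rw [hpair, Nat.cast_add, Nat.cast_mul, h2]
    · have hk0 : k = 0 := by
        have := Nat.eq_zero_of_add_eq_zero_left h
        rcases Nat.mul_eq_zero.mp this with h' | h'
        · lia
        · exact h'
      have hr : P.root a = P.root (P.reflectionPerm j a) + P.pairingIn ℤ a j • P.root j := by
        rw [RootPairing.root_reflectionPerm, RootPairing.reflection_apply_root' ℤ]
        abel
      rw [hr]
      exact add_mem (hn0 (by lia)) (zsmul_mem (hmem hk0) _)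

theorem evInt_dominant_nonneg (hlam : IsLevelZeroDominant b θ lam) {a : ι} (ha : b.IsPos a) :
    0 ≤ evInt P θ (a, 0) lam := by
  obtain ⟨n, hn, -⟩ := dominant_coroot_aux hlam ha
  rw [evInt_eq (n := n) (by simpa using hn)]
  lia

theorem pair_neg (hl : lam.2.1 = 0) (a : ι) (k l : ℤ) :
    pair P (realCoroot P θ (P.reflectionPerm a a, k)) lam =
      - pair P (realCoroot P θ (a, l)) lam := by
  rw [pair_realCoroot_of_level_zero _ _ _ hl, pair_realCoroot_of_level_zero _ _ _ hl]
  simp only [RootPairing.coroot', RootPairing.coroot_reflectionPerm,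
    RootPairing.coreflection_apply_self, map_neg, LinearMap.neg_apply]

theorem pair_dominant (hlam : IsLevelZeroDominant b θ lam) (a : ι) (k : ℤ) :
    pair P (realCoroot P θ (a, k)) lam = evInt P θ (a, 0) lam := by
  rw [pair_realCoroot_of_level_zero _ _ (a, k) hlam.level,
    ← pair_realCoroot_of_level_zero P θ (a, 0) hlam.level]
  by_cases ha : b.IsPos a
  · obtain ⟨n, hn, -⟩ := dominant_coroot_aux hlam ha
    rw [evInt_eq (n := n) (by simpa using hn), hn]; simp
  · obtain ⟨n, hn, -⟩ := dominant_coroot_aux hlam ((isPos_neg_iff a).mpr ha)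
    rw [pair_neg hlam.level a 0 0] at hn
    have : pair P (realCoroot P θ (a, 0)) lam = (-n : ℤ) := by
      push_cast; linear_combination -hn
    rw [evInt_eq this, this]

theorem evInt_dominant_neg (hlam : IsLevelZeroDominant b θ lam) (a : ι) :
    evInt P θ (P.reflectionPerm a a, 0) lam = - evInt P θ (a, 0) lam := by
  apply evInt_eq
  rw [pair_neg hlam.level a 0 0, pair_dominant hlam]
  simp

/-- The roots in the span of J are exactly those orthogonal to λ, so the condition on coset
representatives can be tested by pairing with λ. -/
theorem mem_posRealRootsJ_iff (hlam : IsLevelZeroDominant b θ lam) (β : ι × ℤ) :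
    β ∈ posRealRootsJ b (stabIndex b θ lam) ↔
      β ∈ posRealRoots b ∧ evInt P θ (β.1, 0) lam = 0 := by
  refine and_congr_right fun _ => ⟨fun h => ?_, fun h => ?_⟩
  -- Taking coroots is not additive, so orthogonality is propagated through the span with the root
  -- form, which is linear in the root, and turned back into a coroot pairing at the end.
  · have hform : P.RootForm (P.root β.1) lam.1 = 0 := by
      generalize P.root β.1 = r at h
      induction h using AddSubgroup.closure_induction with
      | mem x hx =>
        obtain ⟨j, hj, rfl⟩ := hx
        have h1 := P.rootForm_self_smul_coroot j
        have h2 := congrArg (P.toLinearMap lam.1) h1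
        rw [map_smul, map_nsmul, RootPairing.toLinearMap_apply_apply_Polarization] at h2
        have h3 : P.toLinearMap lam.1 (P.coroot j) = 0 := by
          have : pair P (realCoroot P θ ((j : ι), 0)) lam = 0 := hj
          rwa [pair_realCoroot_of_level_zero _ _ _ hlam.level] at this
        rw [h3, smul_zero] at h2
        simpa using h2.symm
      | zero => simp
      | add x y _ _ hx hy => rw [map_add, LinearMap.add_apply, hx, hy, add_zero]
      | neg x _ hx => rw [map_neg, LinearMap.neg_apply, hx, neg_zero]
    have h1 := congrArg (P.toLinearMap lam.1) (P.rootForm_self_smul_coroot β.1)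
    rw [map_smul, map_nsmul, RootPairing.toLinearMap_apply_apply_Polarization, hform, smul_zero,
      smul_eq_mul, mul_eq_zero] at h1
    have h2 : P.toLinearMap lam.1 (P.coroot β.1) = 0 :=
      h1.resolve_left (RootPairing.IsAnisotropic.rootForm_root_ne_zero β.1)
    apply evInt_eq
    rw [pair_realCoroot_of_level_zero _ _ _ hlam.level]
    simpa using h2
  · by_cases ha : b.IsPos β.1
    · obtain ⟨n, hn, hn0⟩ := dominant_coroot_aux hlam ha
      rw [evInt_eq (n := n) (by simpa using hn)] at h
      exact hn0 (by simpa using h)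
    · obtain ⟨n, hn, hn0⟩ := dominant_coroot_aux hlam ((isPos_neg_iff β.1).mpr ha)
      have h1 := evInt_eq (n := n) (by simpa using hn)
      rw [evInt_dominant_neg hlam, h] at h1
      have := hn0 (by lia)
      rwa [root_neg, neg_mem_iff] at this

/-! ## Values of coroots on the orbit -/

theorem ActsBy.evInt_map {x : AffDual M ≃ₗ[ℂ] AffDual M} {σ : Equiv.Perm ι}
    {n : ι → ℤ} (h : ActsBy θ x P σ n) (hlam : IsLevelZeroDominant b θ lam) (a : ι) (k : ℤ) :
    pair P (realCoroot P θ (σ a, k)) (x lam) = evInt P θ (a, 0) lam := by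
  have := h.pair_map a (k - n a) lam
  rwa [sub_add_cancel, pair_dominant hlam] at this

theorem mem_orbit {x : AffDual M ≃ₗ[ℂ] AffDual M} (hx : x ∈ affineWeyl b θ) :
    x lam ∈ orbit b θ lam := ⟨x, hx, rfl⟩

/-- On the orbit all coroot pairings are integers, so the floor and the real part in `evInt` lose
nothing there. -/
theorem pair_orbit (hlam : IsLevelZeroDominant b θ lam) {μ : AffDual M} (hμ : μ ∈ orbit b θ lam)
    (β : ι × ℤ) : pair P (realCoroot P θ β) μ = evInt P θ β μ := by
  obtain ⟨x, hx, rfl⟩ := hμ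
  obtain ⟨σ, n, h⟩ := exists_actsBy hx
  have h1 := h.evInt_map hlam (σ.symm β.1) β.2
  rw [Equiv.apply_symm_apply] at h1
  rw [evInt_eq (β := β) h1, ← h1]

theorem ActsBy.evInt_map' {x : AffDual M ≃ₗ[ℂ] AffDual M} {σ : Equiv.Perm ι}
    {n : ι → ℤ} (h : ActsBy θ x P σ n) (hlam : IsLevelZeroDominant b θ lam) (a : ι) (k : ℤ) :
    evInt P θ (σ a, k) (x lam) = evInt P θ (a, 0) lam := evInt_eq (h.evInt_map hlam a k)

theorem realRefl_mem (hθ : IsHighestRoot b θ) {β : ι × ℤ} (hβ : β ∈ posRealRoots b) :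
    realRefl P θ β ∈ affineWeyl b θ := by
  induction hβ using posRealRoots_induction hθ with
  | simple i => exact simpleRefl_mem i
  | step β i hβ hne hi hpos ih =>
    rw [realRefl_reflIdx] at ih
    have h1 := mul_mem (mul_mem (simpleRefl_mem i) ih) (simpleRefl_mem i)
    change simpleRefl b θ i * (simpleRefl b θ i * _ * simpleRefl b θ i) * simpleRefl b θ i ∈ _ at h1
    simpa only [mul_assoc, simpleRefl_mul_cancel, simpleRefl_mul_self, mul_one] using h1

theorem orbit_map {x : AffDual M ≃ₗ[ℂ] AffDual M} (hx : x ∈ affineWeyl b θ) {μ : AffDual M}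
    (hμ : μ ∈ orbit b θ lam) : x μ ∈ orbit b θ lam := by
  obtain ⟨y, hy, rfl⟩ := hμ
  exact ⟨x * y, mul_mem hx hy, rfl⟩

theorem evInt_realRefl_self (hlam : IsLevelZeroDominant b θ lam) {μ : AffDual M}
    (hμ : μ ∈ orbit b θ lam) (β : ι × ℤ) :
    evInt P θ β (realRefl P θ β μ) = - evInt P θ β μ := by
  apply evInt_eq
  rw [pair_realCoroot_realRefl_self, pair_orbit hlam hμ]
  simp

theorem evInt_simpleRefl (hlam : IsLevelZeroDominant b θ lam) {μ : AffDual M}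
    (hμ : μ ∈ orbit b θ lam) (i : Option b.support) :
    evInt P θ (simpleRoot b θ i) (simpleRefl b θ i μ) = - evInt P θ (simpleRoot b θ i) μ :=
  evInt_realRefl_self hlam hμ _

theorem evInt_realRefl (hlam : IsLevelZeroDominant b θ lam) {μ : AffDual M}
    (hμ : μ ∈ orbit b θ lam) (β γ : ι × ℤ) :
    evInt P θ γ (realRefl P θ β μ) =
      evInt P θ γ μ - evInt P θ β μ * P.pairingIn ℤ β.1 γ.1 := by
  apply evInt_eq
  rw [realRefl_apply, map_sub, map_smul, pair_orbit hlam hμ, pair_orbit hlam hμ,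
    pair_realCoroot_realRoot']
  simp

theorem realRefl_of_evInt_eq_zero (hlam : IsLevelZeroDominant b θ lam) {μ : AffDual M}
    (hμ : μ ∈ orbit b θ lam) {β : ι × ℤ} (h : evInt P θ β μ = 0) : realRefl P θ β μ = μ := by
  rw [realRefl_apply, pair_orbit hlam hμ, h]
  simp

theorem simpleRefl_simpleRefl (i : Option b.support) (μ : AffDual M) :
    simpleRefl b θ i (simpleRefl b θ i μ) = μ := realRefl_realRefl P θ _ μ

/-- Reflecting a reflection: `r_{r_i β} r_i = r_i r_β`. -/
theorem realRefl_reflIdx_simpleRefl (i : Option b.support) (β : ι × ℤ) (μ : AffDual M) :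
    realRefl P θ (reflIdx P (simpleRoot b θ i) β) (simpleRefl b θ i μ) =
      simpleRefl b θ i (realRefl P θ β μ) := by
  rw [realRefl_reflIdx]
  simp only [LinearEquiv.mul_apply]
  exact congrArg (fun z => simpleRefl b θ i (realRefl P θ β z)) (simpleRefl_simpleRefl i μ)

theorem realRefl_reflIdx_mul (i : Option b.support) (β : ι × ℤ)
    (x : AffDual M ≃ₗ[ℂ] AffDual M) :
    realRefl P θ (reflIdx P (simpleRoot b θ i) β) * (simpleRefl b θ i * x) =
      simpleRefl b θ i * (realRefl P θ β * x) := by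
  ext1 μ
  exact realRefl_reflIdx_simpleRefl i β (x μ)

theorem evInt_reflIdx_simpleRefl (i : Option b.support) (β : ι × ℤ) (μ : AffDual M) :
    evInt P θ (reflIdx P (simpleRoot b θ i) β) (simpleRefl b θ i μ) = evInt P θ β μ := by
  rw [evInt_reflIdx]
  exact congrArg _ (simpleRefl_simpleRefl i μ)

/-! ## The length of an element of the affine Weyl group relative to a weight -/

open scoped Classical in
/-- The sum of the shifts of the real roots `x α`, for the finite roots `α` with
`⟨α^∨, λ⟩ > 0`. -/
def relLength (b : P.Base) (θ : ι) (lam : AffDual M) (x : AffDual M ≃ₗ[ℂ] AffDual M) : ℤ :=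
  shiftSum b {a | 0 < evInt P θ (a, 0) lam} x

/-- If xa has the finite part of α_i, then ⟨a^∨, λ⟩ = ⟨α_i^∨, xλ⟩. This sign decides whether a, -a
or neither belongs to the roots that are summed over. -/
theorem relLength_simpleRefl_mul (hθ : IsHighestRoot b θ) (hlam : IsLevelZeroDominant b θ lam)
    {x : AffDual M ≃ₗ[ℂ] AffDual M} (hx : x ∈ affineWeyl b θ) (i : Option b.support) :
    relLength b θ lam (simpleRefl b θ i * x) =
      relLength b θ lam x + (evInt P θ (simpleRoot b θ i) (x lam)).sign := by
  obtain ⟨σ, n, h⟩ := exists_actsBy hx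
  obtain ⟨a, ha⟩ := σ.surjective (simpleRoot b θ i).1
  have h1 := h.evInt_map' hlam a (simpleRoot b θ i).2
  rw [ha] at h1
  change evInt P θ (simpleRoot b θ i) (x lam) = _ at h1
  rw [relLength, shiftSum_simpleRefl_mul hθ h _ i ha, h1, ← relLength]
  simp only [Finset.mem_filter, Finset.mem_univ, true_and, evInt_dominant_neg hlam]
  rcases lt_trichotomy (evInt P θ (a, 0) lam) 0 with h2 | h2 | h2
  · rw [if_neg (by lia), if_pos (by lia), Int.sign_eq_neg_one_of_neg h2]; ring
  · rw [if_neg (by lia), if_neg (by lia), h2]; simp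
  · rw [if_pos h2, if_neg (by lia), Int.sign_eq_one_of_pos h2]; ring

/-- The two sums differ by the positive roots orthogonal to λ, and Peterson's condition makes their
shifts vanish. -/
theorem shiftSum_posRoots_eq_relLength (hlam : IsLevelZeroDominant b θ lam)
    {x : AffDual M ≃ₗ[ℂ] AffDual M} (hx : x ∈ cosetReps b θ (stabIndex b θ lam)) :
    shiftSum b (posRoots b) x = relLength b θ lam x := by
  classical
  obtain ⟨σ, n, h⟩ := exists_actsBy hx.1
  rw [relLength, h.shiftSum_eq, h.shiftSum_eq]
  refine (Finset.sum_subset (fun a ha => ?_) fun a ha ha' => ?_).symm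
  · rw [mem_posRoots]
    by_contra hneg
    have h1 := evInt_dominant_nonneg hlam ((isPos_neg_iff a).mpr hneg)
    rw [evInt_dominant_neg hlam] at h1
    simp only [Finset.mem_filter] at ha
    lia
  · rw [mem_posRoots] at ha
    have h0 : evInt P θ (a, 0) lam = 0 := by
      have := evInt_dominant_nonneg hlam ha
      simp only [Finset.mem_filter, Finset.mem_univ, true_and] at ha'
      lia
    have key : ∀ c k, (c, k) ∈ posRealRoots b → evInt P θ (c, 0) lam = 0 →
        posShift b (σ c, k + n c) ≤ 0 := by
      intro c k h1 h2
      obtain ⟨γ, hγ, hγ'⟩ := hx.2 (c, k) ((mem_posRealRootsJ_iff hlam _).mpr ⟨h1, h2⟩)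
      rw [h.map_realRoot] at hγ'
      rw [posShift_nonpos_iff, ← realRoot_injective P hγ']
      exact hγ
    have h1 := key a 0 (Or.inl ⟨ha, rfl⟩) h0
    -- The root a gives shift at most 0; the root -a + δ, also positive and orthogonal to λ, gives
    -- shift at least 0.
    have h2 := key (P.reflectionPerm a a) 1 (Or.inr one_pos) (by rw [evInt_dominant_neg hlam, h0]; rfl)
    rw [(h.map_neg a).1, (h.map_neg a).2, add_comm, posShift_shift, posShift_neg (σ a, n a)] at h2
    rw [zero_add] at h1
    lia

/-- The only positive root that r_i makes negative is α_i. If α_i were xβ for β orthogonal to λ,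
then ⟨α_i^∨, xλ⟩ would be 0. -/
theorem simpleRefl_mul_mem_cosetReps (hθ : IsHighestRoot b θ)
    (hlam : IsLevelZeroDominant b θ lam) {x : AffDual M ≃ₗ[ℂ] AffDual M}
    (hx : x ∈ cosetReps b θ (stabIndex b θ lam)) {i : Option b.support}
    (hi : evInt P θ (simpleRoot b θ i) (x lam) ≠ 0) :
    simpleRefl b θ i * x ∈ cosetReps b θ (stabIndex b θ lam) := by
  refine ⟨mul_mem (simpleRefl_mem i) hx.1, fun β hβ => ?_⟩
  obtain ⟨γ, hγ, hγ'⟩ := hx.2 β hβ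
  refine ⟨reflIdx P (simpleRoot b θ i) γ, reflIdx_simpleRoot_pos hθ i hγ fun h => hi ?_, ?_⟩
  · obtain ⟨σ, n, hσ⟩ := exists_actsBy hx.1
    have h1 := hσ.map_realRoot β.1 β.2
    rw [show ((β.1, β.2) : ι × ℤ) = β from rfl, ← hγ'] at h1
    rw [← h, realRoot_injective P h1, hσ.evInt_map' hlam]
    exact ((mem_posRealRootsJ_iff hlam β).mp hβ).2
  · rw [LinearEquiv.mul_apply, ← hγ', simpleRefl, realRefl_realRoot]

/-- If the value were 0, then β = xγ with γ orthogonal to λ. Either γ is positive and r_β x sends it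
to -β, or -γ is positive and x sends it to -β; both contradict Peterson's condition. -/
theorem evInt_ne_zero_of_mem_cosetReps (hlam : IsLevelZeroDominant b θ lam)
    {x : AffDual M ≃ₗ[ℂ] AffDual M} (hx : x ∈ cosetReps b θ (stabIndex b θ lam)) {β : ι × ℤ}
    (hβ : β ∈ posRealRoots b) (hy : realRefl P θ β * x ∈ cosetReps b θ (stabIndex b θ lam)) :
    evInt P θ β (x lam) ≠ 0 := by
  intro h0
  obtain ⟨σ, n, h⟩ := exists_actsBy hx.1
  obtain ⟨a, ha⟩ := σ.surjective β.1
  have ha0 : evInt P θ (a, 0) lam = 0 := by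
    rw [← h.evInt_map' hlam a β.2, ha]; exact h0
  set k := β.2 - n a with hk
  have hβeq : (σ a, k + n a) = β := by rw [ha, hk, sub_add_cancel]
  have hxa := h.map_realRoot a k
  rw [hβeq] at hxa
  have hneg : realRefl P θ β (realRoot P β) = - realRoot P β := by
    rw [realRefl_apply, pair_realCoroot_realRoot]; module
  have hnp : ∀ γ ∈ posRealRoots b, realRoot P γ ≠ - realRoot P β := by
    intro γ hγ h1
    have : - realRoot P β = realRoot P (P.reflectionPerm β.1 β.1, -β.2) := by
      ext <;> simp [realRoot]
    rw [this] at h1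
    rw [realRoot_injective P h1, neg_pos_iff] at hγ
    exact hγ hβ
  by_cases hpos : (a, k) ∈ posRealRoots b
  · obtain ⟨γ, hγ, hγ'⟩ := hy.2 _ ((mem_posRealRootsJ_iff hlam (a, k)).mpr ⟨hpos, ha0⟩)
    rw [LinearEquiv.mul_apply, hxa, hneg] at hγ'
    exact hnp γ hγ hγ'
  · rw [← neg_pos_iff] at hpos
    obtain ⟨γ, hγ, hγ'⟩ := hx.2 _ ((mem_posRealRootsJ_iff hlam _).mpr
      ⟨hpos, by rw [evInt_dominant_neg hlam, ha0]; rfl⟩)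
    have : realRoot P (P.reflectionPerm a a, -k) = - realRoot P (a, k) := by
      ext <;> simp [realRoot]
    rw [this, map_neg, hxa] at hγ'
    exact hnp γ hγ hγ'

theorem evInt_realRefl_lt (hlam : IsLevelZeroDominant b θ lam) {μ : AffDual M}
    (hμ : μ ∈ orbit b θ lam) {β : ι × ℤ} (hβ : 0 < evInt P θ β μ) {i : Option b.support}
    (hi : 0 < P.pairingIn ℤ (simpleRoot b θ i).1 β.1) :
    evInt P θ (simpleRoot b θ i) (realRefl P θ β μ) < evInt P θ (simpleRoot b θ i) μ := by
  rw [evInt_realRefl hlam hμ]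
  have : 0 < P.pairingIn ℤ β.1 (simpleRoot b θ i).1 := (P.zero_lt_pairingIn_iff' ℤ).mp hi
  nlinarith

theorem sign_mono {m n : ℤ} (h : m ≤ n) : m.sign ≤ n.sign := by
  rcases lt_trichotomy m 0 with hm | rfl | hm
  · rw [Int.sign_eq_neg_one_of_neg hm]
    rcases lt_trichotomy n 0 with hn | rfl | hn
    · rw [Int.sign_eq_neg_one_of_neg hn]
    · simp
    · rw [Int.sign_eq_one_of_pos hn]; simp
  · simpa using h
  · rw [Int.sign_eq_one_of_pos hm, Int.sign_eq_one_of_pos (by lia)]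

/-- Conjugating β by r_i with ⟨α_i, β^∨⟩ > 0 corrects the two lengths by the signs of ⟨α_i^∨, ·⟩ at
xλ and at r_β xλ. The value decreases from the first weight to the second, so the correction only
helps. -/
theorem relLength_lt (hθ : IsHighestRoot b θ) (hlam : IsLevelZeroDominant b θ lam)
    {β : ι × ℤ} (hβ : β ∈ posRealRoots b) {x : AffDual M ≃ₗ[ℂ] AffDual M}
    (hx : x ∈ affineWeyl b θ) (hpos : 0 < evInt P θ β (x lam)) :
    relLength b θ lam x + 1 ≤ relLength b θ lam (realRefl P θ β * x) := by
  induction hβ using posRealRoots_induction hθ generalizing x with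
  | simple i =>
    have h := relLength_simpleRefl_mul hθ hlam hx i
    rw [Int.sign_eq_one_of_pos hpos] at h
    exact h.ge
  | step β i hβ hne hi hγ ih =>
    have h1 := ih (mul_mem (simpleRefl_mem i) hx)
      (by rw [LinearEquiv.mul_apply, evInt_reflIdx_simpleRefl]; exact hpos)
    rw [realRefl_reflIdx_mul, relLength_simpleRefl_mul hθ hlam hx,
      relLength_simpleRefl_mul hθ hlam (mul_mem (realRefl_mem hθ hβ) hx)] at h1
    have h2 := sign_mono (evInt_realRefl_lt hlam (mem_orbit hx) hpos hi).le
    rw [LinearEquiv.mul_apply] at h1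
    lia

end Orbit

section Edges

variable {ι M N : Type*} [Fintype ι] [AddCommGroup M] [Module ℂ M] [AddCommGroup N] [Module ℂ N]
variable {P : RootPairing ι ℂ M N} {b : P.Base} {θ : ι} {lam : AffDual M}
variable [P.IsCrystallographic] [P.IsRootSystem] [P.IsReduced]

/-! ## The order on the orbit of a level-zero weight -/

theorem WtLE.mem_left {μ ν : AffDual M} (h : WtLE b θ lam μ ν) : μ ∈ orbit b θ lam := h.1

theorem WtLE.refl {μ : AffDual M} (hμ : μ ∈ orbit b θ lam) : WtLE b θ lam μ μ :=
  ⟨hμ, Relation.ReflTransGen.refl⟩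

theorem WtLE.trans {μ ν κ : AffDual M} (h : WtLE b θ lam μ ν) (h' : WtLE b θ lam ν κ) :
    WtLE b θ lam μ κ :=
  ⟨h.1, h.2.trans h'.2⟩

theorem wtLE_realRefl (hlam : IsLevelZeroDominant b θ lam) {μ : AffDual M}
    (hμ : μ ∈ orbit b θ lam) {β : ι × ℤ} (hβ : β ∈ posRealRoots b) (h : 0 ≤ evInt P θ β μ) :
    WtLE b θ lam μ (realRefl P θ β μ) := by
  rcases h.eq_or_lt with h | h
  · rw [realRefl_of_evInt_eq_zero hlam hμ h.symm]; exact .refl hμ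
  · exact ⟨hμ, .single ⟨β, hβ, rfl, _, h, pair_orbit hlam hμ β⟩⟩

/-- Each generating step subtracts a positive multiple of a positive real root and so lowers the
linear affine height by a positive integer. Antisymmetry of the order rests on this. -/
theorem WtLE.affHeightLin (hθ : IsHighestRoot b θ) {μ ν : AffDual M} (h : WtLE b θ lam μ ν) :
    ∃ k : ℕ, affHeightLin b θ ν = affHeightLin b θ μ - k ∧ (k = 0 → μ = ν) := by
  obtain ⟨-, h⟩ := h
  induction h with
  | refl => exact ⟨0, by simp, fun _ => rfl⟩
  | tail _ hstep ih =>
    obtain ⟨k, hk, hk0⟩ := ih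
    obtain ⟨β, hβ, rfl, n, hn, hpair⟩ := hstep
    have hpos := affHeight_pos hθ hβ
    have hnk : 0 < n * affHeight b θ β := mul_pos hn hpos
    refine ⟨k + (n * affHeight b θ β).toNat, ?_, fun h => by lia⟩
    have h1 : ((n * affHeight b θ β).toNat : ℤ) = n * affHeight b θ β := Int.toNat_of_nonneg hnk.le
    have h2 : ((n * affHeight b θ β).toNat : ℂ) = n * affHeight b θ β := by exact_mod_cast h1
    rw [realRefl_apply, map_sub, map_smul, hpair, hk, affHeightLin_realRoot, Nat.cast_add, h2,
      smul_eq_mul]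
    ring

theorem WtLE.antisymm (hθ : IsHighestRoot b θ) {μ ν : AffDual M} (h : WtLE b θ lam μ ν)
    (h' : WtLE b θ lam ν μ) : μ = ν := by
  obtain ⟨k, hk, hk0⟩ := h.affHeightLin hθ
  obtain ⟨l, hl, -⟩ := h'.affHeightLin hθ
  have h1 : (k : ℂ) + l = 0 := by linear_combination hk + hl
  have h2 : k + l = 0 := by exact_mod_cast h1
  exact hk0 (by lia)

theorem WtLE.mem_right (hθ : IsHighestRoot b θ) {μ ν : AffDual M} (h : WtLE b θ lam μ ν) :
    ν ∈ orbit b θ lam := by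
  obtain ⟨hμ, h⟩ := h
  induction h with
  | refl => exact hμ
  | tail _ hstep ih =>
    obtain ⟨β, hβ, rfl, -⟩ := hstep
    exact orbit_map (realRefl_mem hθ hβ) ih

theorem WtLE.induction (hθ : IsHighestRoot b θ)
    {p : AffDual M → AffDual M → Prop} {μ ν : AffDual M} (h : WtLE b θ lam μ ν)
    (refl : ∀ κ ∈ orbit b θ lam, p κ κ)
    (trans : ∀ κ κ' κ'', p κ κ' → p κ' κ'' → p κ κ'')
    (step : ∀ κ ∈ orbit b θ lam, ∀ β ∈ posRealRoots b, 0 < evInt P θ β κ →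
      p κ (realRefl P θ β κ)) : p μ ν := by
  obtain ⟨hμ, h⟩ := h
  induction h with
  | refl => exact refl μ hμ
  | tail h hstep ih =>
    refine trans _ _ _ ih ?_
    obtain ⟨β, hβ, rfl, n, hn, hpair⟩ := hstep
    exact step _ (WtLE.mem_right hθ ⟨hμ, h⟩) β hβ (by rw [evInt_eq hpair]; exact hn)

theorem WtLT.trans_le (hθ : IsHighestRoot b θ) {μ ν κ : AffDual M} (h : WtLT b θ lam μ ν)
    (h' : WtLE b θ lam ν κ) : WtLT b θ lam μ κ :=
  ⟨h.1.trans h', fun e => h.2 (h.1.antisymm hθ (e ▸ h'))⟩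

theorem WtLT.not_le (hθ : IsHighestRoot b θ) {μ ν : AffDual M} (h : WtLT b θ lam μ ν)
    (h' : WtLE b θ lam ν μ) : False := h.2 (h.1.antisymm hθ h')

theorem wtLT_realRefl (hlam : IsLevelZeroDominant b θ lam) {μ : AffDual M}
    (hμ : μ ∈ orbit b θ lam) {β : ι × ℤ} (hβ : β ∈ posRealRoots b) (h : 0 < evInt P θ β μ) :
    WtLT b θ lam μ (realRefl P θ β μ) := by
  refine ⟨wtLE_realRefl hlam hμ hβ h.le, fun e => ?_⟩
  have := evInt_realRefl_self hlam hμ β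
  rw [← e] at this
  lia

/-- The larger one of `μ` and `r_i μ`. -/
def maxRefl (b : P.Base) (θ : ι) (i : Option b.support) (μ : AffDual M) : AffDual M :=
  if 0 < evInt P θ (simpleRoot b θ i) μ then simpleRefl b θ i μ else μ

/-- The smaller one of `μ` and `r_i μ`. -/
def minRefl (b : P.Base) (θ : ι) (i : Option b.support) (μ : AffDual M) : AffDual M :=
  if evInt P θ (simpleRoot b θ i) μ < 0 then simpleRefl b θ i μ else μ

theorem simpleRefl_le (hlam : IsLevelZeroDominant b θ lam) {μ : AffDual M}
    (hμ : μ ∈ orbit b θ lam) {i : Option b.support} (h : evInt P θ (simpleRoot b θ i) μ ≤ 0) :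
    WtLE b θ lam (simpleRefl b θ i μ) μ := by
  have := wtLE_realRefl hlam (orbit_map (simpleRefl_mem i) hμ) (simpleRoot_pos i)
    (by rw [evInt_simpleRefl hlam hμ]; lia)
  rwa [show realRefl P θ (simpleRoot b θ i) (simpleRefl b θ i μ) = μ from
    simpleRefl_simpleRefl i μ] at this

theorem maxRefl_spec (hlam : IsLevelZeroDominant b θ lam) {μ : AffDual M}
    (hμ : μ ∈ orbit b θ lam) (i : Option b.support) :
    WtLE b θ lam μ (maxRefl b θ i μ) ∧ WtLE b θ lam (simpleRefl b θ i μ) (maxRefl b θ i μ) ∧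
      (maxRefl b θ i μ = μ ∨ maxRefl b θ i μ = simpleRefl b θ i μ) := by
  rw [maxRefl]
  split_ifs with h
  · exact ⟨wtLE_realRefl hlam hμ (simpleRoot_pos i) h.le, .refl (orbit_map (simpleRefl_mem i) hμ),
      .inr rfl⟩
  · exact ⟨.refl hμ, simpleRefl_le hlam hμ (by lia), .inl rfl⟩

theorem minRefl_spec (hlam : IsLevelZeroDominant b θ lam) {μ : AffDual M}
    (hμ : μ ∈ orbit b θ lam) (i : Option b.support) :
    WtLE b θ lam (minRefl b θ i μ) μ ∧ WtLE b θ lam (minRefl b θ i μ) (simpleRefl b θ i μ) ∧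
      (minRefl b θ i μ = μ ∨ minRefl b θ i μ = simpleRefl b θ i μ) := by
  rw [minRefl]
  split_ifs with h
  · exact ⟨simpleRefl_le hlam hμ h.le, .refl (orbit_map (simpleRefl_mem i) hμ), .inr rfl⟩
  · exact ⟨.refl hμ, wtLE_realRefl hlam hμ (simpleRoot_pos i) (by lia), .inl rfl⟩

/-- The lifting property of Bruhat orders. A generating step with label β ≠ α_i has a mirror image
with the positive label r_i β, so r_i μ and r_i ν are comparable as well; if β = α_i, the pairs {μ,
r_i μ} and {ν, r_i ν} coincide. -/
theorem WtLE.maxRefl_minRefl (hθ : IsHighestRoot b θ) (hlam : IsLevelZeroDominant b θ lam)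
    (i : Option b.support) {μ ν : AffDual M} (h : WtLE b θ lam μ ν) :
    WtLE b θ lam (maxRefl b θ i μ) (maxRefl b θ i ν) ∧
      WtLE b θ lam (minRefl b θ i μ) (minRefl b θ i ν) := by
  refine h.induction hθ (p := fun μ ν => WtLE b θ lam (maxRefl b θ i μ) (maxRefl b θ i ν) ∧
      WtLE b θ lam (minRefl b θ i μ) (minRefl b θ i ν)) (fun κ hκ => ?_)
    (fun κ κ' κ'' h h' => ⟨h.1.trans h'.1, h.2.trans h'.2⟩) fun κ hκ β hβ hpos => ?_
  · exact ⟨.refl ((maxRefl_spec hlam hκ i).1.mem_right hθ), .refl (minRefl_spec hlam hκ i).1.mem_left⟩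
  · have hκ' := orbit_map (realRefl_mem hθ hβ) hκ
    obtain ⟨ha, hb, hc⟩ := maxRefl_spec hlam hκ i
    obtain ⟨ha', hb', hc'⟩ := maxRefl_spec hlam hκ' i
    obtain ⟨hd, he, hf⟩ := minRefl_spec hlam hκ i
    obtain ⟨hd', he', hf'⟩ := minRefl_spec hlam hκ' i
    have h1 := wtLE_realRefl hlam hκ hβ hpos.le
    by_cases hne : β = simpleRoot b θ i
    · subst hne
      have h2 := evInt_simpleRefl hlam hκ i
      have e1 : maxRefl b θ i κ = simpleRefl b θ i κ := if_pos hpos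
      have e2 : maxRefl b θ i (simpleRefl b θ i κ) = simpleRefl b θ i κ := if_neg (by lia)
      have e3 : minRefl b θ i κ = κ := if_neg (by lia)
      have e4 : minRefl b θ i (simpleRefl b θ i κ) = κ := by
        rw [minRefl, if_pos (by lia), simpleRefl_simpleRefl]
      change WtLE b θ lam _ (maxRefl b θ i (simpleRefl b θ i κ)) ∧
        WtLE b θ lam _ (minRefl b θ i (simpleRefl b θ i κ))
      rw [e1, e2, e3, e4]
      exact ⟨.refl hκ', .refl hκ⟩
    · have h2 := wtLE_realRefl hlam (orbit_map (simpleRefl_mem i) hκ)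
        (reflIdx_simpleRoot_pos hθ i hβ hne) (by rw [evInt_reflIdx_simpleRefl]; exact hpos.le)
      rw [realRefl_reflIdx_simpleRefl] at h2
      constructor
      · rcases hc with hc | hc <;> rw [hc]
        exacts [h1.trans ha', h2.trans hb']
      · rcases hf' with hf' | hf' <;> rw [hf']
        exacts [hd.trans h1, he.trans h2]

/-- `ν` covers `μ` in the order on the orbit. -/
def WtCovers (b : P.Base) (θ : ι) (lam μ ν : AffDual M) : Prop :=
  WtLT b θ lam μ ν ∧ ¬ ∃ κ, WtLT b θ lam μ κ ∧ WtLT b θ lam κ ν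

/-- For κ between μ and r_i μ, the lifting property pushes κ down to μ or up to r_i μ, according to
the sign of ⟨α_i^∨, κ⟩. -/
theorem wtCovers_simpleRefl (hθ : IsHighestRoot b θ) (hlam : IsLevelZeroDominant b θ lam)
    {μ : AffDual M} (hμ : μ ∈ orbit b θ lam) {i : Option b.support}
    (h : 0 < evInt P θ (simpleRoot b θ i) μ) : WtCovers b θ lam μ (simpleRefl b θ i μ) := by
  refine ⟨wtLT_realRefl hlam hμ (simpleRoot_pos i) h, ?_⟩
  rintro ⟨κ, h1, h2⟩
  have h3 := evInt_simpleRefl hlam hμ i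
  have e1 : maxRefl b θ i μ = simpleRefl b θ i μ := if_pos h
  have e2 : minRefl b θ i (simpleRefl b θ i μ) = μ := by
    rw [minRefl, if_pos (by lia), simpleRefl_simpleRefl]
  by_cases hκ : 0 < evInt P θ (simpleRoot b θ i) κ
  · have h4 := (h2.1.maxRefl_minRefl hθ hlam i).2
    rw [e2, minRefl, if_neg (by lia)] at h4
    exact h1.not_le hθ h4
  · have h4 := (h1.1.maxRefl_minRefl hθ hlam i).1
    rw [e1, maxRefl, if_neg hκ] at h4
    exact h2.not_le hθ h4

/-- An element κ strictly between μ and ν is moved by `minRefl` or `maxRefl` between r_i μ and r_i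
ν. As there is nothing strictly between these, κ itself is one of them; one choice contradicts the
order, and the other places μ or ν strictly between r_i μ and r_i ν. -/
theorem WtCovers.of_simpleRefl (hθ : IsHighestRoot b θ) (hlam : IsLevelZeroDominant b θ lam)
    {μ ν : AffDual M} {i : Option b.support} (h : WtLT b θ lam μ ν)
    (hc : WtCovers b θ lam (simpleRefl b θ i μ) (simpleRefl b θ i ν))
    (hs : (evInt P θ (simpleRoot b θ i) μ).sign = (evInt P θ (simpleRoot b θ i) ν).sign)
    (h0 : evInt P θ (simpleRoot b θ i) μ ≠ 0) : WtCovers b θ lam μ ν := by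
  refine ⟨h, ?_⟩
  rintro ⟨κ, h1, h2⟩
  have hμ := h.1.mem_left
  have hν := h.1.mem_right hθ
  have hκ := h2.1.mem_left
  have hinj := (simpleRefl b θ i).injective
  have hcase : ∀ κ', (κ' = κ ∨ κ' = simpleRefl b θ i κ) →
      WtLE b θ lam (simpleRefl b θ i μ) κ' → WtLE b θ lam κ' (simpleRefl b θ i ν) →
      κ = simpleRefl b θ i μ ∨ κ = simpleRefl b θ i ν := by
    intro κ' hκ' ha hb
    by_cases e1 : κ' = simpleRefl b θ i μ
    · rcases hκ' with rfl | rfl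
      · exact .inl e1
      · exact (h1.2 (hinj e1).symm).elim
    by_cases e2 : κ' = simpleRefl b θ i ν
    · rcases hκ' with rfl | rfl
      · exact .inr e2
      · exact (h2.2 (hinj e2)).elim
    exact (hc.2 ⟨κ', ⟨ha, Ne.symm e1⟩, ⟨hb, e2⟩⟩).elim
  rcases lt_or_gt_of_ne h0 with hneg | hpos
  · have hνneg : evInt P θ (simpleRoot b θ i) ν < 0 := by
      rw [Int.sign_eq_neg_one_of_neg hneg] at hs
      exact Int.sign_eq_neg_one_iff_neg.mp hs.symm
    have e1 : minRefl b θ i μ = simpleRefl b θ i μ := if_pos hneg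
    have e2 : minRefl b θ i ν = simpleRefl b θ i ν := if_pos hνneg
    have h3 := (h1.1.maxRefl_minRefl hθ hlam i).2
    have h4 := (h2.1.maxRefl_minRefl hθ hlam i).2
    have h5 : WtLT b θ lam (simpleRefl b θ i μ) μ := by
      refine ⟨simpleRefl_le hlam hμ hneg.le, fun e => ?_⟩
      have := evInt_simpleRefl hlam hμ i
      rw [e] at this; lia
    rw [e1] at h3
    rw [e2] at h4
    rcases hcase _ (minRefl_spec hlam hκ i).2.2 h3 h4 with e | e
    · rw [e] at h1
      exact h1.not_le hθ h5.1
    · rw [e] at h1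
      exact hc.2 ⟨μ, h5, h1⟩
  · have hνpos : 0 < evInt P θ (simpleRoot b θ i) ν := by
      rw [Int.sign_eq_one_of_pos hpos] at hs
      exact Int.sign_eq_one_iff_pos.mp hs.symm
    have e1 : maxRefl b θ i μ = simpleRefl b θ i μ := if_pos hpos
    have e2 : maxRefl b θ i ν = simpleRefl b θ i ν := if_pos hνpos
    have h3 := (h1.1.maxRefl_minRefl hθ hlam i).1
    have h4 := (h2.1.maxRefl_minRefl hθ hlam i).1
    have h5 : WtLT b θ lam ν (simpleRefl b θ i ν) :=
      wtLT_realRefl hlam hν (simpleRoot_pos i) hνpos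
    rw [e1] at h3
    rw [e2] at h4
    rcases hcase _ (maxRefl_spec hlam hκ i).2.2 h3 h4 with e | e
    · rw [e] at h2
      exact hc.2 ⟨ν, h2, h5⟩
    · rw [e] at h2
      exact h2.not_le hθ h5.1

/-! ## Edges of the two graphs -/

/-- Induction on β through its conjugate by r_i. If ⟨α_i^∨, ·⟩ has the same sign at both weights,
this sign is nonzero, the length corrections cancel, and covering is preserved by the reflection in
both directions. If the signs differ, both sides of the equivalence fail. -/
theorem relLength_eq_iff_covers (hθ : IsHighestRoot b θ) (hlam : IsLevelZeroDominant b θ lam)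
    {β : ι × ℤ} (hβ : β ∈ posRealRoots b) {x : AffDual M ≃ₗ[ℂ] AffDual M}
    (hx : x ∈ affineWeyl b θ) (hpos : 0 < evInt P θ β (x lam)) :
    relLength b θ lam (realRefl P θ β * x) = relLength b θ lam x + 1 ↔
      WtCovers b θ lam (x lam) (realRefl P θ β (x lam)) := by
  induction hβ using posRealRoots_induction hθ generalizing x with
  | simple i =>
    have h := relLength_simpleRefl_mul hθ hlam hx i
    rw [Int.sign_eq_one_of_pos hpos] at h
    exact iff_of_true h (wtCovers_simpleRefl hθ hlam (mem_orbit hx) hpos)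
  | step β i hβ hne hi hγ ih =>
    have hix := mul_mem (simpleRefl_mem i) hx
    have hμ : x lam ∈ orbit b θ lam := mem_orbit hx
    have hy := mul_mem (realRefl_mem hθ hβ) hx
    have hν : realRefl P θ β (x lam) ∈ orbit b θ lam := mem_orbit hy
    have hγpos : 0 < evInt P θ (reflIdx P (simpleRoot b θ i) β) ((simpleRefl b θ i * x) lam) := by
      rw [LinearEquiv.mul_apply, evInt_reflIdx_simpleRefl]; exact hpos
    have h1 := ih hix hγpos
    have h2 := relLength_lt hθ hlam hγ hix hγpos
    rw [realRefl_reflIdx_mul, relLength_simpleRefl_mul hθ hlam hx,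
      relLength_simpleRefl_mul hθ hlam hy] at h1 h2
    rw [LinearEquiv.mul_apply, LinearEquiv.mul_apply, realRefl_reflIdx_simpleRefl] at h1
    rw [LinearEquiv.mul_apply] at h2
    have hlt := evInt_realRefl_lt hlam hμ hpos hi
    have h3 := wtLT_realRefl hlam hμ hβ hpos
    have h4 := wtLT_realRefl hlam (orbit_map (simpleRefl_mem i) hμ) hγ hγpos
    rw [realRefl_reflIdx_simpleRefl] at h4
    set μ := x lam with hμdef
    set ν := realRefl P θ β μ with hνdef
    set A := evInt P θ (simpleRoot b θ i) μ with hA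
    set A' := evInt P θ (simpleRoot b θ i) ν with hA'
    by_cases hs : A.sign = A'.sign
    · have h0 : A ≠ 0 := by
        rintro h0
        rw [h0, Int.sign_zero] at hs
        have := Int.sign_eq_zero_iff_zero.mp hs.symm
        lia
      rw [hs] at h1
      have e : relLength b θ lam (realRefl P θ β * x) + A'.sign =
          relLength b θ lam x + A'.sign + 1 ↔
          relLength b θ lam (realRefl P θ β * x) = relLength b θ lam x + 1 := by
        constructor <;> intro h <;> lia
      rw [← e, h1]
      refine ⟨fun hc => hc.of_simpleRefl hθ hlam h3 hs h0, fun hc => ?_⟩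
      have e1 := evInt_simpleRefl hlam hμ i
      have e2 := evInt_simpleRefl hlam hν i
      refine WtCovers.of_simpleRefl (i := i) hθ hlam h4 ?_ ?_ ?_
      · rw [simpleRefl_simpleRefl, simpleRefl_simpleRefl]; exact hc
      · rw [e1, e2, Int.sign_neg, Int.sign_neg, ← hA, ← hA', hs]
      · rw [e1]; lia
    -- The sign drops from μ to ν, so the length grows by at least 2. An intermediate weight is r_i
    -- ν if ⟨α_i^∨, μ⟩ = 0, since then r_i μ = μ, and r_i μ if the value is positive; a negative
    -- value would leave the sign unchanged.
    · have h5 := lt_of_le_of_ne (sign_mono hlt.le) (Ne.symm hs)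
      refine iff_of_false (by lia) fun hc => ?_
      rcases lt_trichotomy A 0 with hA0 | hA0 | hA0
      · rw [Int.sign_eq_neg_one_of_neg hA0, Int.sign_eq_neg_one_of_neg (by lia)] at hs
        exact hs rfl
      · have e1 : simpleRefl b θ i μ = μ := realRefl_of_evInt_eq_zero hlam hμ hA0
        rw [e1] at h4
        refine hc.2 ⟨simpleRefl b θ i ν, h4, simpleRefl_le hlam hν (by lia), fun e => ?_⟩
        have := evInt_simpleRefl hlam hν i
        rw [e] at this; lia
      · have hA'0 : A' ≤ 0 := by
          by_contra hcon
          rw [Int.sign_eq_one_of_pos hA0, Int.sign_eq_one_of_pos (by lia)] at hs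
          exact hs rfl
        exact hc.2 ⟨simpleRefl b θ i μ, wtLT_realRefl hlam hμ (simpleRoot_pos i) hA0,
          h4.trans_le hθ (simpleRefl_le hlam hν hA'0)⟩

/-- Growth by exactly one leaves no room for a drop of sign, so at every conjugation the values of
α_i^∨ at both weights are nonzero and r_i preserves coset representatives. Covers in the orbit thus
lift to edges. -/
theorem realRefl_mul_mem_cosetReps (hθ : IsHighestRoot b θ) (hlam : IsLevelZeroDominant b θ lam)
    {β : ι × ℤ} (hβ : β ∈ posRealRoots b) {x : AffDual M ≃ₗ[ℂ] AffDual M}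
    (hx : x ∈ cosetReps b θ (stabIndex b θ lam)) (hpos : 0 < evInt P θ β (x lam))
    (hL : relLength b θ lam (realRefl P θ β * x) = relLength b θ lam x + 1) :
    realRefl P θ β * x ∈ cosetReps b θ (stabIndex b θ lam) := by
  induction hβ using posRealRoots_induction hθ generalizing x with
  | simple i => exact simpleRefl_mul_mem_cosetReps hθ hlam hx hpos.ne'
  | step β i hβ hne hi hγ ih =>
    have hix := mul_mem (simpleRefl_mem i) hx.1
    have hμ : x lam ∈ orbit b θ lam := mem_orbit hx.1
    have hy := mul_mem (realRefl_mem hθ hβ) hx.1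
    have hγpos : 0 < evInt P θ (reflIdx P (simpleRoot b θ i) β) ((simpleRefl b θ i * x) lam) := by
      rw [LinearEquiv.mul_apply, evInt_reflIdx_simpleRefl]; exact hpos
    have h2 := relLength_lt hθ hlam hγ hix hγpos
    have h1 := ih (x := simpleRefl b θ i * x)
    rw [realRefl_reflIdx_mul, relLength_simpleRefl_mul hθ hlam hx.1,
      relLength_simpleRefl_mul hθ hlam hy] at h1 h2
    have hlt := evInt_realRefl_lt hlam hμ hpos hi
    have hsgn := sign_mono hlt.le
    simp only [LinearEquiv.mul_apply] at h1 h2 hγpos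
    have hs : (evInt P θ (simpleRoot b θ i) (realRefl P θ β (x lam))).sign =
      (evInt P θ (simpleRoot b θ i) (x lam)).sign := by lia
    have h0 : evInt P θ (simpleRoot b θ i) (x lam) ≠ 0 := by
      rintro h0
      rw [h0, Int.sign_zero] at hs
      have := Int.sign_eq_zero_iff_zero.mp hs
      lia
    have h3 := h1 (simpleRefl_mul_mem_cosetReps hθ hlam hx h0) hγpos (by lia)
    have h4 := simpleRefl_mul_mem_cosetReps (i := i) hθ hlam h3 ?_
    · rwa [simpleRefl_mul_cancel] at h4
    · rw [LinearEquiv.mul_apply, LinearEquiv.mul_apply, evInt_simpleRefl hlam (show realRefl P θ β (x lam) ∈ orbit b θ lam from mem_orbit hy)]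
      intro h5
      have h6 : evInt P θ (simpleRoot b θ i) (realRefl P θ β (x lam)) = 0 := by
        rw [← neg_eq_zero]; exact h5
      rw [h6, Int.sign_zero] at hs
      exact h0 (Int.sign_eq_zero_iff_zero.mp hs.symm)

/-- The endpoint need not be assumed a coset representative, and the direction of the edge is
encoded in the sign of ⟨β^∨, xλ⟩. Were that value negative, `relLength_lt` at the endpoint would
make the length decrease. -/
theorem siEdge_iff (hθ : IsHighestRoot b θ) (hlam : IsLevelZeroDominant b θ lam)
    {β : ι × ℤ} {x y : AffDual M ≃ₗ[ℂ] AffDual M} :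
    SiEdge b θ (stabIndex b θ lam) β x y ↔ β ∈ posRealRoots b ∧
      x ∈ cosetReps b θ (stabIndex b θ lam) ∧ y = realRefl P θ β * x ∧
      0 < evInt P θ β (x lam) ∧ relLength b θ lam y = relLength b θ lam x + 1 := by
  constructor
  · rintro ⟨hβ, hx, hy, rfl, n, hn, hn'⟩
    rw [hasSiLength_iff hθ hx.1, shiftSum_posRoots_eq_relLength hlam hx] at hn
    rw [hasSiLength_iff hθ hy.1, shiftSum_posRoots_eq_relLength hlam hy] at hn'
    refine ⟨hβ, hx, rfl, ?_, by lia⟩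
    by_contra hneg
    have h0 := evInt_ne_zero_of_mem_cosetReps hlam hx hβ hy
    have h1 := relLength_lt hθ hlam hβ hy.1 (by
      rw [LinearEquiv.mul_apply, evInt_realRefl_self hlam (mem_orbit hx.1)]; lia)
    rw [← mul_assoc, realRefl_mul_self, one_mul] at h1
    lia
  · rintro ⟨hβ, hx, rfl, hpos, hL⟩
    have hy := realRefl_mul_mem_cosetReps hθ hlam hβ hx hpos hL
    refine ⟨hβ, hx, hy, rfl, relLength b θ lam x, ?_, ?_⟩
    · rw [hasSiLength_iff hθ hx.1, shiftSum_posRoots_eq_relLength hlam hx]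
    · rw [hasSiLength_iff hθ hy.1, shiftSum_posRoots_eq_relLength hlam hy, hL]

/-- The projection `x ↦ x λ` maps edges to edges with the same label, and edges lift. -/
theorem wtEdge_iff_siEdge (hθ : IsHighestRoot b θ) (hlam : IsLevelZeroDominant b θ lam)
    {β : ι × ℤ} {x : AffDual M ≃ₗ[ℂ] AffDual M} (hx : x ∈ cosetReps b θ (stabIndex b θ lam))
    {ν : AffDual M} :
    WtEdge b θ lam β (x lam) ν ↔ ν = realRefl P θ β (x lam) ∧
      SiEdge b θ (stabIndex b θ lam) β x (realRefl P θ β * x) := by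
  rw [siEdge_iff hθ hlam]
  constructor
  · rintro ⟨hc, hβ, rfl, n, hn, hpair⟩
    have hpos : 0 < evInt P θ β (x lam) := by rw [evInt_eq hpair]; exact hn
    exact ⟨rfl, hβ, hx, rfl, hpos, (relLength_eq_iff_covers hθ hlam hβ hx.1 hpos).mpr hc⟩
  · rintro ⟨rfl, hβ, -, -, hpos, hL⟩
    exact ⟨(relLength_eq_iff_covers hθ hlam hβ hx.1 hpos).mp hL, hβ, rfl, _, hpos,
      pair_orbit hlam (mem_orbit hx.1) β⟩

end Edges

section DirectedPaths

variable {ι M N : Type*} [Fintype ι] [AddCommGroup M] [Module ℂ M] [AddCommGroup N] [Module ℂ N]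
variable {P : RootPairing ι ℂ M N} {b : P.Base} {θ : ι} {lam : AffDual M}
variable [P.IsCrystallographic] [P.IsRootSystem] [P.IsReduced]

/-! ## Directed paths in the subgraphs -/

/-- The subgroup `ℤ` of `ℝ`. -/
abbrev intReal : AddSubgroup ℝ := (Int.castAddHom ℝ).range

theorem intCast_mem_intReal (n : ℤ) : (n : ℝ) ∈ intReal := ⟨n, rfl⟩

/-- The integer `⟨α_i^∨, μ⟩`. -/
abbrev simpleEv (b : P.Base) (θ : ι) (i : Option b.support) (μ : AffDual M) : ℤ :=
  evInt P θ (simpleRoot b θ i) μ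

/-- The edges of the subgraph of the semi-infinite Bruhat graph for `a`. -/
def SiStep (b : P.Base) (θ : ι) (lam : AffDual M) (a : ℝ) (u v : AffDual M ≃ₗ[ℂ] AffDual M) :
    Prop :=
  ∃ β, SiEdge b θ (stabIndex b θ lam) β u v ∧
    ∃ n : ℤ, (a : ℂ) * pair P (realCoroot P θ β) (u lam) = n

theorem ofReal_mul_intCast_iff {a : ℝ} {k : ℤ} :
    (∃ n : ℤ, (a : ℂ) * (k : ℂ) = n) ↔ a * k ∈ intReal := by
  constructor
  · rintro ⟨n, hn⟩
    exact ⟨n, by simp only [Int.coe_castAddHom]; exact_mod_cast hn.symm⟩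
  · rintro ⟨n, hn⟩
    exact ⟨n, by simp only [Int.coe_castAddHom] at hn; exact_mod_cast hn.symm⟩

theorem siStep_iff (hθ : IsHighestRoot b θ) (hlam : IsLevelZeroDominant b θ lam) {a : ℝ}
    {u v : AffDual M ≃ₗ[ℂ] AffDual M} : SiStep b θ lam a u v ↔
      ∃ β ∈ posRealRoots b, u ∈ cosetReps b θ (stabIndex b θ lam) ∧ v = realRefl P θ β * u ∧
        0 < evInt P θ β (u lam) ∧ relLength b θ lam v = relLength b θ lam u + 1 ∧
        a * evInt P θ β (u lam) ∈ intReal := by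
  constructor
  · rintro ⟨β, hedge, hn⟩
    obtain ⟨hβ, hu, hv, hpos, hL⟩ := (siEdge_iff hθ hlam).mp hedge
    rw [pair_orbit hlam (mem_orbit hu.1), ofReal_mul_intCast_iff] at hn
    exact ⟨β, hβ, hu, hv, hpos, hL, hn⟩
  · rintro ⟨β, hβ, hu, hv, hpos, hL, hn⟩
    refine ⟨β, (siEdge_iff hθ hlam).mpr ⟨hβ, hu, hv, hpos, hL⟩, ?_⟩
    rwa [pair_orbit hlam (mem_orbit hu.1), ofReal_mul_intCast_iff]

theorem SiStep.mem_left {a : ℝ} {u v : AffDual M ≃ₗ[ℂ] AffDual M} (h : SiStep b θ lam a u v) :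
    u ∈ cosetReps b θ (stabIndex b θ lam) := by
  obtain ⟨β, h, -⟩ := h; exact h.2.1

theorem SiStep.mem_right {a : ℝ} {u v : AffDual M ≃ₗ[ℂ] AffDual M} (h : SiStep b θ lam a u v) :
    v ∈ cosetReps b θ (stabIndex b θ lam) := by
  obtain ⟨β, h, -⟩ := h; exact h.2.2.1

theorem siStep_simpleRefl (hθ : IsHighestRoot b θ) (hlam : IsLevelZeroDominant b θ lam) {a : ℝ}
    {u : AffDual M ≃ₗ[ℂ] AffDual M} (hu : u ∈ cosetReps b θ (stabIndex b θ lam))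
    {i : Option b.support} (hpos : 0 < simpleEv b θ i (u lam))
    (ha : a * simpleEv b θ i (u lam) ∈ intReal) :
    SiStep b θ lam a u (simpleRefl b θ i * u) := by
  refine (siStep_iff hθ hlam).mpr ⟨_, simpleRoot_pos i, hu, rfl, hpos, ?_, ha⟩
  rw [relLength_simpleRefl_mul hθ hlam hu.1, Int.sign_eq_one_of_pos hpos]

theorem siStep_simpleRefl' (hθ : IsHighestRoot b θ) (hlam : IsLevelZeroDominant b θ lam) {a : ℝ}
    {u : AffDual M ≃ₗ[ℂ] AffDual M} (hu : u ∈ cosetReps b θ (stabIndex b θ lam))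
    {i : Option b.support} (hneg : simpleEv b θ i (u lam) < 0)
    (ha : a * simpleEv b θ i (u lam) ∈ intReal) :
    SiStep b θ lam a (simpleRefl b θ i * u) u := by
  have h := evInt_simpleRefl hlam (mem_orbit hu.1) i
  have h1 := siStep_simpleRefl (a := a) (i := i) hθ hlam
    (simpleRefl_mul_mem_cosetReps hθ hlam hu hneg.ne) (by
      rw [LinearEquiv.mul_apply, simpleEv, h]; lia) (by
      rw [LinearEquiv.mul_apply, simpleEv, h]; push_cast; rw [mul_neg]; exact neg_mem ha)
  rwa [simpleRefl_mul_cancel] at h1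

/-- An edge which is not the one labelled by `α_i` is compatible with the action of `r_i`. -/
theorem SiStep.simpleRefl_cases (hθ : IsHighestRoot b θ) (hlam : IsLevelZeroDominant b θ lam)
    {a : ℝ} {u v : AffDual M ≃ₗ[ℂ] AffDual M} (h : SiStep b θ lam a u v) (i : Option b.support) :
    (v = simpleRefl b θ i * u ∧ 0 < simpleEv b θ i (u lam) ∧
        a * simpleEv b θ i (u lam) ∈ intReal) ∨
      ((simpleEv b θ i (u lam)).sign ≤ (simpleEv b θ i (v lam)).sign ∧
        ((simpleEv b θ i (u lam)).sign = (simpleEv b θ i (v lam)).sign →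
          simpleEv b θ i (u lam) ≠ 0 →
          SiStep b θ lam a (simpleRefl b θ i * u) (simpleRefl b θ i * v))) := by
  have hvm := h.mem_right
  obtain ⟨β, hβ, hu, rfl, hpos, hL, ha⟩ := (siStep_iff hθ hlam).mp h
  by_cases hne : β = simpleRoot b θ i
  · subst hne
    exact .inl ⟨rfl, hpos, ha⟩
  right
  have hγ := reflIdx_simpleRoot_pos hθ i hβ hne
  have hev : evInt P θ (reflIdx P (simpleRoot b θ i) β) ((simpleRefl b θ i * u) lam) =
      evInt P θ β (u lam) := by
    rw [LinearEquiv.mul_apply, evInt_reflIdx_simpleRefl]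
  have h2 := relLength_lt hθ hlam hγ (mul_mem (simpleRefl_mem i) hu.1) (hev ▸ hpos)
  rw [realRefl_reflIdx_mul, relLength_simpleRefl_mul hθ hlam hu.1,
    relLength_simpleRefl_mul hθ hlam hvm.1] at h2
  refine ⟨by rw [simpleEv, simpleEv]; lia, fun hs h0 => ?_⟩
  refine (siStep_iff hθ hlam).mpr ⟨_, hγ, simpleRefl_mul_mem_cosetReps hθ hlam hu h0,
    (realRefl_reflIdx_mul i β u).symm, hev ▸ hpos, ?_, hev ▸ ha⟩
  rw [relLength_simpleRefl_mul hθ hlam hu.1, relLength_simpleRefl_mul hθ hlam hvm.1]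
  rw [simpleEv, simpleEv] at hs
  lia

/-- The root lattice of the affine root system. -/
def affRootLattice (P : RootPairing ι ℂ M N) : AddSubgroup (AffDual M) :=
  AddSubgroup.closure (Set.range (realRoot P))

theorem realRoot_mem_affRootLattice (β : ι × ℤ) : realRoot P β ∈ affRootLattice P :=
  AddSubgroup.subset_closure ⟨β, rfl⟩

theorem pair_affRootLattice (β : ι × ℤ) {μ : AffDual M} (hμ : μ ∈ affRootLattice P) :
    ∃ n : ℤ, pair P (realCoroot P θ β) μ = n := by
  induction hμ using AddSubgroup.closure_induction with
  | mem x hx =>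
    obtain ⟨γ, rfl⟩ := hx
    exact ⟨_, pair_realCoroot_realRoot' θ β γ⟩
  | zero => exact ⟨0, by simp⟩
  | add x y _ _ hx hy =>
    obtain ⟨m, hm⟩ := hx
    obtain ⟨n, hn⟩ := hy
    exact ⟨m + n, by rw [map_add, hm, hn]; push_cast; rfl⟩
  | neg x _ hx =>
    obtain ⟨m, hm⟩ := hx
    exact ⟨-m, by rw [map_neg, hm]; push_cast; rfl⟩

/-- The difference is -a⟨β^∨, uλ⟩β, and the coefficient is an integer by the condition on edges of
the a-subgraph. Hence a⟨α_i^∨, ·⟩ is constant modulo ℤ along such paths. -/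
theorem SiStep.smul_sub_mem (hθ : IsHighestRoot b θ) (hlam : IsLevelZeroDominant b θ lam)
    {a : ℝ} {u v : AffDual M ≃ₗ[ℂ] AffDual M} (h : SiStep b θ lam a u v) :
    (a : ℂ) • (v lam - u lam) ∈ affRootLattice P := by
  obtain ⟨β, hβ, hu, rfl, hpos, hL, n, hn⟩ := (siStep_iff hθ hlam).mp h
  simp only [Int.coe_castAddHom] at hn
  have hn' : (a : ℂ) * (evInt P θ β (u lam) : ℂ) = n := by exact_mod_cast hn.symm
  rw [LinearEquiv.mul_apply, realRefl_apply, pair_orbit hlam (mem_orbit hu.1),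
    sub_sub_cancel_left, smul_neg, smul_smul, hn', Int.cast_smul_eq_zsmul]
  exact neg_mem (zsmul_mem (realRoot_mem_affRootLattice β) n)

theorem SiPath.smul_sub_mem (hθ : IsHighestRoot b θ) (hlam : IsLevelZeroDominant b θ lam)
    {a : ℝ} {u v : AffDual M ≃ₗ[ℂ] AffDual M} (h : SiPath b θ lam a u v) :
    (a : ℂ) • (v lam - u lam) ∈ affRootLattice P := by
  induction h with
  | refl => simp [zero_mem]
  | tail _ hstep ih =>
    have := add_mem ih (SiStep.smul_sub_mem hθ hlam hstep)
    rwa [← smul_add, add_comm, sub_add_sub_cancel] at this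

theorem sub_mem_intReal (hlam : IsLevelZeroDominant b θ lam)
    {a : ℝ} {μ ν : AffDual M} (hμ : μ ∈ orbit b θ lam) (hν : ν ∈ orbit b θ lam)
    (h : (a : ℂ) • (ν - μ) ∈ affRootLattice P) (i : Option b.support) :
    a * simpleEv b θ i ν - a * simpleEv b θ i μ ∈ intReal := by
  obtain ⟨n, hn⟩ := pair_affRootLattice (θ := θ) (simpleRoot b θ i) h
  rw [map_smul, map_sub, pair_orbit hlam hμ, pair_orbit hlam hν, smul_eq_mul, mul_sub] at hn
  exact ⟨n, by simp only [Int.coe_castAddHom]; exact_mod_cast hn.symm⟩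

theorem SiStep.ev_mem_iff (hθ : IsHighestRoot b θ) (hlam : IsLevelZeroDominant b θ lam)
    {a : ℝ} {u v : AffDual M ≃ₗ[ℂ] AffDual M} (h : SiStep b θ lam a u v) (i : Option b.support) :
    a * simpleEv b θ i (v lam) ∈ intReal ↔ a * simpleEv b θ i (u lam) ∈ intReal := by
  have h1 := sub_mem_intReal hlam (mem_orbit h.mem_left.1) (mem_orbit h.mem_right.1)
    (h.smul_sub_mem hθ hlam) i
  refine ⟨fun h2 => ?_, fun h2 => ?_⟩
  · have := sub_mem h2 h1; rwa [sub_sub_cancel] at this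
  · have := add_mem h1 h2; rwa [sub_add_cancel] at this

theorem neg_of_sign_le_of_neg {m n : ℤ} (h : m.sign ≤ n.sign) (hn : n < 0) : m < 0 := by
  rw [Int.sign_eq_neg_one_of_neg hn] at h
  by_contra hm
  rcases (not_lt.mp hm).eq_or_lt with hm | hm
  · rw [← hm] at h; simp at h
  · rw [Int.sign_eq_one_of_pos hm] at h; lia

theorem pos_of_sign_le_of_pos {m n : ℤ} (h : m.sign ≤ n.sign) (hm : 0 < m) : 0 < n := by
  have := neg_of_sign_le_of_neg (m := -n) (n := -m)
    (by rw [Int.sign_neg, Int.sign_neg]; lia) (by lia)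
  lia

theorem nonneg_of_sign_le {m n : ℤ} (h : m.sign ≤ n.sign) (hm : 0 ≤ m) : 0 ≤ n := by
  by_contra hn
  exact absurd (neg_of_sign_le_of_neg h (by lia)) (by lia)

/-- Without an edge labelled α_i the sign cannot drop, so the value at the end would be 0; with such
an edge, a times the value there is an integer. In both cases constancy modulo ℤ carries integrality
back to the start. -/
theorem SiPath.ev_mem (hθ : IsHighestRoot b θ) (hlam : IsLevelZeroDominant b θ lam)
    {a : ℝ} {u v : AffDual M ≃ₗ[ℂ] AffDual M} (h : SiPath b θ lam a u v) {i : Option b.support}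
    (hu : 0 ≤ simpleEv b θ i (u lam)) (hv : simpleEv b θ i (v lam) ≤ 0) :
    a * simpleEv b θ i (u lam) ∈ intReal := by
  induction h using Relation.ReflTransGen.head_induction_on with
  | refl =>
    rw [show simpleEv b θ i (v lam) = 0 by lia]
    simp [zero_mem]
  | @head u w hstep _ ih =>
    have hstep : SiStep b θ lam a u w := hstep
    rcases hstep.simpleRefl_cases hθ hlam i with ⟨-, -, h⟩ | ⟨hs, -⟩
    · exact h
    · exact (hstep.ev_mem_iff hθ hlam i).mp (ih (nonneg_of_sign_le hs hu))

/-- By `SiPath.ev_mem`, nonintegrality forbids returning from a nonnegative to a negative value, so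
all values stay negative. Edges labelled α_i start at positive values, so none occurs and every edge
can be reflected. -/
theorem SiPath.simpleRefl_of_neg (hθ : IsHighestRoot b θ) (hlam : IsLevelZeroDominant b θ lam)
    {a : ℝ} {u v : AffDual M ≃ₗ[ℂ] AffDual M} (h : SiPath b θ lam a u v) {i : Option b.support}
    (hu : simpleEv b θ i (u lam) < 0) (hv : simpleEv b θ i (v lam) < 0)
    (ha : a * simpleEv b θ i (u lam) ∉ intReal) :
    SiPath b θ lam a (simpleRefl b θ i * u) (simpleRefl b θ i * v) := by
  induction h using Relation.ReflTransGen.head_induction_on with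
  | refl => exact .refl
  | @head u w hstep hpath ih =>
    have hstep : SiStep b θ lam a u w := hstep
    have ha' := (hstep.ev_mem_iff hθ hlam i).not.mpr ha
    rcases hstep.simpleRefl_cases hθ hlam i with ⟨-, h, -⟩ | ⟨hs, h⟩
    · lia
    · have hw : simpleEv b θ i (w lam) < 0 := by
        by_contra hw
        exact ha' (SiPath.ev_mem hθ hlam hpath (by lia) hv.le)
      exact .head (h (by rw [Int.sign_eq_neg_one_of_neg hu, Int.sign_eq_neg_one_of_neg hw]) hu.ne)
        (ih hw ha')

/-- Nonintegrality excludes edges labelled α_i; the sign then stays positive, so nothing need be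
assumed at the far end. -/
theorem SiPath.simpleRefl_of_pos (hθ : IsHighestRoot b θ) (hlam : IsLevelZeroDominant b θ lam)
    {a : ℝ} {u v : AffDual M ≃ₗ[ℂ] AffDual M} (h : SiPath b θ lam a u v) {i : Option b.support}
    (hu : 0 < simpleEv b θ i (u lam))
    (ha : a * simpleEv b θ i (u lam) ∉ intReal) :
    SiPath b θ lam a (simpleRefl b θ i * u) (simpleRefl b θ i * v) := by
  induction h using Relation.ReflTransGen.head_induction_on with
  | refl => exact .refl
  | @head u w hstep hpath ih =>
    have hstep : SiStep b θ lam a u w := hstep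
    have ha' := (hstep.ev_mem_iff hθ hlam i).not.mpr ha
    rcases hstep.simpleRefl_cases hθ hlam i with ⟨-, -, h⟩ | ⟨hs, h⟩
    · exact (ha h).elim
    · have hw := pos_of_sign_le_of_pos hs hu
      exact .head (h (by rw [Int.sign_eq_one_of_pos hu, Int.sign_eq_one_of_pos hw]) hu.ne')
        (ih hw ha')

/-- Read backwards from `v`, the values stay negative until an edge labelled α_i is met. Everything
after that edge is reflected, and the edge itself is dropped. -/
theorem SiPath.simpleRefl_right (hθ : IsHighestRoot b θ) (hlam : IsLevelZeroDominant b θ lam)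
    {a : ℝ} {u v : AffDual M ≃ₗ[ℂ] AffDual M} (h : SiPath b θ lam a u v) {i : Option b.support}
    (hu : 0 ≤ simpleEv b θ i (u lam)) (hv : simpleEv b θ i (v lam) < 0) :
    SiPath b θ lam a u (simpleRefl b θ i * v) := by
  induction h with
  | refl => lia
  | @tail w v hpath hstep ih =>
    have hstep : SiStep b θ lam a w v := hstep
    rcases hstep.simpleRefl_cases hθ hlam i with ⟨rfl, -⟩ | ⟨hs, h⟩
    · rw [simpleRefl_mul_cancel]; exact hpath
    · have hw := neg_of_sign_le_of_neg hs hv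
      exact .tail (ih hw)
        (h (by rw [Int.sign_eq_neg_one_of_neg hw, Int.sign_eq_neg_one_of_neg hv]) hw.ne)

/-- The mirror image of `SiPath.simpleRefl_right`: the part before the first edge labelled α_i is
reflected and that edge is dropped. -/
theorem SiPath.simpleRefl_left (hθ : IsHighestRoot b θ) (hlam : IsLevelZeroDominant b θ lam)
    {a : ℝ} {u v : AffDual M ≃ₗ[ℂ] AffDual M} (h : SiPath b θ lam a u v) {i : Option b.support}
    (hu : 0 < simpleEv b θ i (u lam)) (hv : simpleEv b θ i (v lam) ≤ 0) :
    SiPath b θ lam a (simpleRefl b θ i * u) v := by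
  induction h using Relation.ReflTransGen.head_induction_on with
  | refl => lia
  | @head u w hstep hpath ih =>
    have hstep : SiStep b θ lam a u w := hstep
    rcases hstep.simpleRefl_cases hθ hlam i with ⟨rfl, -⟩ | ⟨hs, h⟩
    · exact hpath
    · have hw := pos_of_sign_le_of_pos hs hu
      exact .head (h (by rw [Int.sign_eq_one_of_pos hu, Int.sign_eq_one_of_pos hw]) hu.ne') (ih hw)

/-! ## Projection of directed paths -/

theorem SiEdge.wtLT (hθ : IsHighestRoot b θ) (hlam : IsLevelZeroDominant b θ lam) {β : ι × ℤ}
    {u v : AffDual M ≃ₗ[ℂ] AffDual M} (h : SiEdge b θ (stabIndex b θ lam) β u v) :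
    WtLT b θ lam (u lam) (v lam) := by
  obtain ⟨hβ, hu, rfl, hpos, -⟩ := (siEdge_iff hθ hlam).mp h
  exact wtLT_realRefl hlam (mem_orbit hu.1) hβ hpos

theorem SiLE.wtLT (hθ : IsHighestRoot b θ) (hlam : IsLevelZeroDominant b θ lam)
    {u v : AffDual M ≃ₗ[ℂ] AffDual M} (h : SiLE b θ (stabIndex b θ lam) u v) (hne : u ≠ v) :
    WtLT b θ lam (u lam) (v lam) := by
  obtain ⟨hu, h⟩ := h
  have hle : ∀ u v, Relation.ReflTransGen
      (fun u v => ∃ β, SiEdge b θ (stabIndex b θ lam) β u v) u v →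
      u ∈ cosetReps b θ (stabIndex b θ lam) → WtLE b θ lam (u lam) (v lam) := by
    intro u v h hu
    induction h with
    | refl => exact .refl (mem_orbit hu.1)
    | tail _ hstep ih =>
      obtain ⟨β, hstep⟩ := hstep
      exact ih.trans (hstep.wtLT hθ hlam).1
  -- Strictness comes from the first edge; the rest of the path only has to be weakly increasing.
  rcases h.cases_head with rfl | ⟨w, ⟨β, hw⟩, hwv⟩
  · exact (hne rfl).elim
  · exact (hw.wtLT hθ hlam).trans_le hθ (hle _ _ hwv hw.2.2.1)

theorem SiPath.siLE {a : ℝ} {u v : AffDual M ≃ₗ[ℂ] AffDual M} (h : SiPath b θ lam a u v)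
    (hu : u ∈ cosetReps b θ (stabIndex b θ lam)) : SiLE b θ (stabIndex b θ lam) u v :=
  ⟨hu, Relation.ReflTransGen.mono (fun _ _ ⟨β, h, _⟩ => ⟨β, h⟩) _ _ h⟩

theorem SiPath.wtPath (hθ : IsHighestRoot b θ) (hlam : IsLevelZeroDominant b θ lam) {a : ℝ}
    {u v : AffDual M ≃ₗ[ℂ] AffDual M} (h : SiPath b θ lam a u v) :
    WtPath b θ lam a (u lam) (v lam) := by
  refine Relation.ReflTransGen.lift (fun x : AffDual M ≃ₗ[ℂ] AffDual M => x lam) ?_ _ _ h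
  rintro x y ⟨β, hedge, hn⟩
  have h1 := hedge
  obtain ⟨hβ, hx, hy, rfl, -⟩ := h1
  exact ⟨β, (wtEdge_iff_siEdge hθ hlam hx).mpr ⟨rfl, hedge⟩, hn⟩

/-- Directed paths lift along the projection `x ↦ x λ`. -/
theorem WtPath.lift (hθ : IsHighestRoot b θ) (hlam : IsLevelZeroDominant b θ lam) {a : ℝ}
    {μ ν : AffDual M} (h : WtPath b θ lam a μ ν) {x : AffDual M ≃ₗ[ℂ] AffDual M}
    (hx : x ∈ cosetReps b θ (stabIndex b θ lam)) (hxμ : x lam = μ) :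
    ∃ y ∈ cosetReps b θ (stabIndex b θ lam), y lam = ν ∧ SiPath b θ lam a x y := by
  induction h with
  | refl => exact ⟨x, hx, hxμ, .refl⟩
  | tail _ hstep ih =>
    obtain ⟨y, hy, rfl, hpath⟩ := ih
    obtain ⟨β, hedge, hn⟩ := hstep
    obtain ⟨rfl, hedge'⟩ := (wtEdge_iff_siEdge hθ hlam hy).mp hedge
    exact ⟨_, hedge'.2.2.1, rfl, hpath.tail ⟨β, hedge', hn⟩⟩

/-- If ⟨α_i^∨, xλ⟩ = 0, then r_i fixes xλ and x can be kept; otherwise r_i x is again a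
representative. -/
theorem exists_cosetReps_of_mem_orbit (hθ : IsHighestRoot b θ)
    (hlam : IsLevelZeroDominant b θ lam) {μ : AffDual M} (hμ : μ ∈ orbit b θ lam) :
    ∃ x ∈ cosetReps b θ (stabIndex b θ lam), x lam = μ := by
  obtain ⟨w, hw, rfl⟩ := hμ
  induction hw using affineWeyl_induction with
  | one => exact ⟨1, ⟨one_mem _, fun β hβ => ⟨β, hβ.1, rfl⟩⟩, rfl⟩
  | mul i w hw ih =>
    obtain ⟨x, hx, hxw⟩ := ih
    by_cases h0 : simpleEv b θ i (x lam) = 0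
    · refine ⟨x, hx, ?_⟩
      rw [LinearEquiv.mul_apply, ← hxw]
      exact (realRefl_of_evInt_eq_zero hlam (mem_orbit hx.1) h0).symm
    · refine ⟨_, simpleRefl_mul_mem_cosetReps hθ hlam hx h0, ?_⟩
      rw [LinearEquiv.mul_apply, LinearEquiv.mul_apply, hxw]

end DirectedPaths

section StepLists

/-! ## Step functions given by lists -/

variable {X Y : Type*}

open scoped Classical in
/-- The first entry of a list of pairs `(x, t)` whose time `t` satisfies `q`. -/
def stepAt (q : ℝ → Prop) (l : List (X × ℝ)) : Option X :=
  (l.find? fun p => decide (q p.2)).map Prod.fst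

/-- The entry on the left of the time `t`. -/
abbrev stepL (l : List (X × ℝ)) (t : ℝ) : Option X := stepAt (fun s => t ≤ s) l

/-- The entry on the right of the time `t`. -/
abbrev stepR (l : List (X × ℝ)) (t : ℝ) : Option X := stepAt (fun s => t < s) l

@[simp] theorem stepAt_nil (q : ℝ → Prop) : stepAt q ([] : List (X × ℝ)) = none := rfl

theorem stepAt_cons_of_pos {q : ℝ → Prop} {p : X × ℝ} (h : q p.2) (l : List (X × ℝ)) :
    stepAt q (p :: l) = some p.1 := by
  simp [stepAt, h]

theorem stepAt_cons_of_neg {q : ℝ → Prop} {p : X × ℝ} (h : ¬ q p.2) (l : List (X × ℝ)) :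
    stepAt q (p :: l) = stepAt q l := by
  simp [stepAt, h]

theorem stepAt_append (q : ℝ → Prop) (l l' : List (X × ℝ)) :
    stepAt q (l ++ l') = (stepAt q l).or (stepAt q l') := by
  induction l with
  | nil => simp
  | cons p l ih =>
    by_cases h : q p.2
    · simp [stepAt_cons_of_pos h]
    · rw [List.cons_append, stepAt_cons_of_neg h, stepAt_cons_of_neg h, ih]

theorem stepAt_map (q : ℝ → Prop) (f : X → Y) (l : List (X × ℝ)) :
    stepAt q (l.map fun p => (f p.1, p.2)) = (stepAt q l).map f := by
  induction l with
  | nil => simp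
  | cons p l ih =>
    by_cases h : q p.2
    · rw [List.map_cons, stepAt_cons_of_pos (p := (f p.1, p.2)) h, stepAt_cons_of_pos h,
        Option.map_some]
    · rw [List.map_cons, stepAt_cons_of_neg (p := (f p.1, p.2)) h, stepAt_cons_of_neg h, ih]

theorem stepAt_eq_none {q : ℝ → Prop} {l : List (X × ℝ)} (h : ∀ p ∈ l, ¬ q p.2) :
    stepAt q l = none := by
  induction l with
  | nil => simp
  | cons p l ih =>
    rw [stepAt_cons_of_neg (h p (by simp)), ih fun p hp => h p (by simp [hp])]

theorem stepAt_eq_head {q : ℝ → Prop} {l : List (X × ℝ)} (h : ∀ p ∈ l, q p.2) :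
    stepAt q l = l.head?.map Prod.fst := by
  cases l with
  | nil => simp
  | cons p l => rw [stepAt_cons_of_pos (h p (by simp))]; rfl

theorem exists_of_stepAt {q : ℝ → Prop} {l : List (X × ℝ)} {x : X} (h : x ∈ stepAt q l) :
    ∃ p ∈ l, q p.2 ∧ p.1 = x := by
  induction l with
  | nil => simp at h
  | cons p l ih =>
    by_cases hq : q p.2
    · rw [stepAt_cons_of_pos hq] at h
      exact ⟨p, by simp, hq, by simpa using h⟩
    · rw [stepAt_cons_of_neg hq] at h
      obtain ⟨p', hp', h'⟩ := ih h
      exact ⟨p', by simp [hp'], h'⟩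

theorem stepAt_isSome {q : ℝ → Prop} {l : List (X × ℝ)} {p : X × ℝ} (hp : p ∈ l) (hq : q p.2) :
    ∃ x, stepAt q l = some x := by
  by_contra! h
  induction l with
  | nil => simp at hp
  | cons p' l ih =>
    by_cases hq' : q p'.2
    · exact h _ (stepAt_cons_of_pos hq' l)
    · rw [stepAt_cons_of_neg hq'] at h
      rcases List.mem_cons.mp hp with rfl | hp
      · exact hq' hq
      · exact ih hp h

theorem stepAt_congr {q q' : ℝ → Prop} {l : List (X × ℝ)} (h : ∀ p ∈ l, q p.2 ↔ q' p.2) :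
    stepAt q l = stepAt q' l := by
  induction l with
  | nil => rfl
  | cons p l ih =>
    have h1 := h p (by simp)
    have h2 := ih fun p hp => h p (by simp [hp])
    by_cases hq : q p.2
    · rw [stepAt_cons_of_pos hq, stepAt_cons_of_pos (h1.mp hq)]
    · rw [stepAt_cons_of_neg hq, stepAt_cons_of_neg (h1.not.mp hq), h2]

theorem stepL_eq_of_mem {l : List (X × ℝ)} (hl : l.IsChain fun p p' => p.2 < p'.2) {p : X × ℝ}
    (hp : p ∈ l) : stepL l p.2 = some p.1 := by
  induction l with
  | nil => simp at hp
  | cons p' l ih =>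
    have hs := hl
    rw [List.isChain_cons] at hs
    rcases List.mem_cons.mp hp with rfl | hp'
    · exact stepAt_cons_of_pos le_rfl l
    · have hlt : p'.2 < p.2 := by
        have : IsTrans (X × ℝ) fun p p' => p.2 < p'.2 := ⟨fun _ _ _ => lt_trans⟩
        have h1 := List.isChain_iff_pairwise.mp hl
        exact List.rel_of_pairwise_cons h1 hp'
      rw [stepL, stepAt_cons_of_neg (not_le.mpr hlt)]
      exact ih hs.2 hp'

/-- A condition on consecutive entries, in terms of the step function. -/
theorem isChain_iff_step {S : ℝ → X → X → Prop} (hS : ∀ t x, S t x x) {l : List (X × ℝ)}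
    (hl : l.IsChain fun p p' => p.2 < p'.2) :
    (l.IsChain fun p p' => S p.2 p'.1 p.1) ↔
      ∀ t, ∀ x ∈ stepR l t, ∀ y ∈ stepL l t, S t x y := by
  induction l with
  | nil => simp
  | cons p l ih =>
    rw [List.isChain_cons] at hl ⊢
    rw [ih hl.2]
    constructor
    · rintro ⟨h1, h2⟩ t x hx y hy
      rcases lt_trichotomy t p.2 with ht | rfl | ht
      · rw [stepR, stepAt_cons_of_pos ht, Option.mem_some_iff] at hx
        rw [stepL, stepAt_cons_of_pos ht.le, Option.mem_some_iff] at hy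
        rw [← hx, ← hy]; exact hS _ _
      · rw [stepR, stepAt_cons_of_neg (lt_irrefl _)] at hx
        rw [stepL, stepAt_cons_of_pos le_rfl, Option.mem_some_iff] at hy
        subst hy
        cases l with
        | nil => simp at hx
        | cons p' l =>
          rw [stepAt_cons_of_pos (hl.1 p' (by simp)), Option.mem_some_iff] at hx
          subst hx
          exact h1 p' (by simp)
      · rw [stepR, stepAt_cons_of_neg ht.le.not_gt] at hx
        rw [stepL, stepAt_cons_of_neg (not_le.mpr ht)] at hy
        exact h2 t x hx y hy
    · intro h
      constructor
      · intro p' hp'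
        refine h p.2 p'.1 ?_ p.1 (stepAt_cons_of_pos le_rfl l)
        rw [stepR, stepAt_cons_of_neg (lt_irrefl _)]
        cases l with
        | nil => simp at hp'
        | cons p'' l =>
          have : p'' = p' := by simpa using hp'
          subst this
          exact stepAt_cons_of_pos (hl.1 p'' (by simp)) l
      · intro t x hx y hy
        rcases lt_or_ge p.2 t with ht | ht
        · refine h t x ?_ y ?_
          · rw [stepR, stepAt_cons_of_neg ht.le.not_gt]; exact hx
          · rw [stepL, stepAt_cons_of_neg (not_le.mpr ht)]; exact hy
        · cases l with
          | nil => simp at hx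
          | cons p' l =>
            have hlt := hl.1 p' (by simp)
            rw [stepR, stepAt_cons_of_pos (ht.trans_lt hlt), Option.mem_some_iff] at hx
            rw [stepL, stepAt_cons_of_pos (ht.trans hlt.le), Option.mem_some_iff] at hy
            rw [← hx, ← hy]; exact hS _ _

/-- A list with increasing times and without repetitions is determined by its step function. -/
theorem eq_of_stepL_eq {l l' : List (X × ℝ)} {a : ℝ}
    (hl : l.IsChain fun p p' => p.2 < p'.2 ∧ p'.1 ≠ p.1)
    (hl' : l'.IsChain fun p p' => p.2 < p'.2 ∧ p'.1 ≠ p.1)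
    (ha : ∀ p ∈ l, a < p.2) (ha' : ∀ p ∈ l', a < p.2)
    (h : ∀ t, a < t → stepL l t = stepL l' t) : l = l' := by
  -- If two lists start with the same entry, the first break of one cannot precede that of the
  -- other: just after it the step functions would show different entries, or one of them none.
  have key : ∀ {p p' : X × ℝ} {l l' : List (X × ℝ)} {a : ℝ},
      ((p :: l).IsChain fun p p' => p.2 < p'.2 ∧ p'.1 ≠ p.1) → a < p.2 →
      (∀ t, a < t → stepL (p :: l) t = stepL (p' :: l') t) → p.1 = p'.1 → ¬ p.2 < p'.2 := by
    intro p p' l l' a hl ha h h1 hlt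
    cases l with
    | nil =>
      have := h p'.2 (ha.trans hlt)
      rw [stepL, stepL, stepAt_cons_of_neg (not_le.mpr hlt), stepAt_cons_of_pos le_rfl] at this
      simp at this
    | cons p'' l =>
      have h2 := (List.isChain_cons_cons.mp hl).1
      have := h (min p'.2 p''.2) (ha.trans (lt_min hlt h2.1))
      rw [stepL, stepL, stepAt_cons_of_neg (not_le.mpr (lt_min hlt h2.1)),
        stepAt_cons_of_pos (min_le_right _ _), stepAt_cons_of_pos (min_le_left _ _)] at this
      exact h2.2 (by rw [h1]; simpa using this)
  induction l generalizing a l' with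
  | nil =>
    cases l' with
    | nil => rfl
    | cons p' l' =>
      have := h p'.2 (ha' p' (by simp))
      rw [stepL, stepL, stepAt_cons_of_pos le_rfl] at this
      simp at this
  | cons p l ih =>
    cases l' with
    | nil =>
      have := h p.2 (ha p (by simp))
      rw [stepL, stepL, stepAt_cons_of_pos le_rfl] at this
      simp at this
    | cons p' l' =>
      have hp := ha p (by simp)
      have hp' := ha' p' (by simp)
      have h1 : p.1 = p'.1 := by
        have := h (min p.2 p'.2) (lt_min hp hp')
        rw [stepL, stepL, stepAt_cons_of_pos (min_le_left _ _),
          stepAt_cons_of_pos (min_le_right _ _)] at this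
        simpa using this
      have h2 : p.2 = p'.2 := by
        apply le_antisymm
        · exact not_lt.mp (key hl' hp' (fun t ht => (h t ht).symm) h1.symm)
        · exact not_lt.mp (key hl hp h h1)
      have h3 : p = p' := Prod.ext h1 h2
      subst h3
      rw [List.isChain_cons] at hl hl'
      have hlt : ∀ {l : List (X × ℝ)}, ((p :: l).IsChain fun p p' => p.2 < p'.2 ∧ p'.1 ≠ p.1) →
          ∀ p' ∈ l, p.2 < p'.2 := by
        intro l hl p' hp'
        have : IsTrans (X × ℝ) fun p p' => p.2 < p'.2 := ⟨fun _ _ _ => lt_trans⟩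
        have h1 := List.isChain_iff_pairwise.mp (hl.imp fun _ _ h => h.1)
        exact List.rel_of_pairwise_cons h1 hp'
      rw [ih hl.2 hl'.2 (a := p.2) (hlt (List.isChain_cons.mpr hl))
        (hlt (List.isChain_cons.mpr hl')) fun t ht => ?_]
      have := h t (hp.trans ht)
      rwa [stepL, stepL, stepAt_cons_of_neg (not_le.mpr ht),
        stepAt_cons_of_neg (not_le.mpr ht)] at this

/-- The lists that encode a sequence of pairwise distinct consecutive entries together with times
`0 < a_1 < ⋯ < a_s = 1`. -/
structure IsReducedList (l : List (X × ℝ)) : Prop where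
  chain : l.IsChain fun p p' => p.2 < p'.2 ∧ p'.1 ≠ p.1
  pos : ∀ p ∈ l, 0 < p.2
  last : ∃ p, l.getLast? = some p ∧ p.2 = 1

namespace IsReducedList

variable {l l' : List (X × ℝ)}

theorem chain_lt (h : IsReducedList l) : l.IsChain fun p p' => p.2 < p'.2 :=
  h.chain.imp fun _ _ h => h.1

theorem ext_stepL (h : IsReducedList l) (h' : IsReducedList l')
    (heq : ∀ t, 0 < t → stepL l t = stepL l' t) : l = l' :=
  eq_of_stepL_eq h.chain h'.chain h.pos h'.pos heq

theorem le_one (h : IsReducedList l) {p : X × ℝ} (hp : p ∈ l) : p.2 ≤ 1 := by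
  obtain ⟨p', hp', h1⟩ := h.last
  obtain ⟨ys, rfl⟩ := List.getLast?_eq_some_iff.mp hp'
  have : IsTrans (X × ℝ) fun p p' => p.2 < p'.2 := ⟨fun _ _ _ => lt_trans⟩
  have h2 := List.isChain_iff_pairwise.mp h.chain_lt
  rw [List.pairwise_append] at h2
  rcases List.mem_append.mp hp with hp | hp
  · exact h1 ▸ (h2.2.2 p hp p' (by simp)).le
  · rw [List.mem_singleton.mp hp, h1]

theorem exists_time_one (h : IsReducedList l) : ∃ p ∈ l, p.2 = 1 := by
  obtain ⟨p', hp', h1⟩ := h.last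
  exact ⟨p', List.mem_of_getLast? hp', h1⟩

theorem exists_stepL (h : IsReducedList l) {t : ℝ} (ht : t ≤ 1) : ∃ x, stepL l t = some x := by
  obtain ⟨p, hp, h1⟩ := h.exists_time_one
  exact stepAt_isSome hp (by rw [h1]; exact ht)

theorem exists_stepR (h : IsReducedList l) {t : ℝ} (ht : t < 1) : ∃ x, stepR l t = some x := by
  obtain ⟨p, hp, h1⟩ := h.exists_time_one
  exact stepAt_isSome hp (by rw [h1]; exact ht)

theorem stepL_eq_stepR_of_not_mem (t : ℝ) (h : ∀ p ∈ l, p.2 ≠ t) : stepL l t = stepR l t :=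
  stepAt_congr fun p hp => ⟨fun h1 => lt_of_le_of_ne h1 (Ne.symm (h p hp)), le_of_lt⟩

theorem time_of_stepL_ne_stepR {t : ℝ} (h : stepL l t ≠ stepR l t) : ∃ p ∈ l, p.2 = t := by
  by_contra! h'
  exact h (stepL_eq_stepR_of_not_mem t h')

theorem stepL_zero_eq_stepR_zero (h : IsReducedList l) : stepL l 0 = stepR l 0 :=
  stepL_eq_stepR_of_not_mem 0 fun p hp => (h.pos p hp).ne'

end IsReducedList

/-! ## The rearrangements in the root operators -/

theorem exists_split {l : List (X × ℝ)} (hl : l.IsChain fun p p' => p.2 < p'.2) {q : ℝ → Prop}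
    (hq : ∀ s s', s ≤ s' → q s' → q s) :
    ∃ l₁ l₂, l = l₁ ++ l₂ ∧ (∀ p ∈ l₁, q p.2) ∧ ∀ p ∈ l₂, ¬ q p.2 := by
  induction l with
  | nil => exact ⟨[], [], rfl, by simp, by simp⟩
  | cons p l ih =>
    by_cases h : q p.2
    · obtain ⟨l₁, l₂, rfl, h1, h2⟩ := ih (List.isChain_cons.mp hl).2
      refine ⟨p :: l₁, l₂, rfl, ?_, h2⟩
      intro p' hp'
      rcases List.mem_cons.mp hp' with rfl | hp'
      exacts [h, h1 p' hp']
    · refine ⟨[], p :: l, rfl, by simp, fun p' hp' hq' => ?_⟩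
      have : IsTrans (X × ℝ) fun p p' => p.2 < p'.2 := ⟨fun _ _ _ => lt_trans⟩
      have h1 := List.isChain_iff_pairwise.mp hl
      rcases List.mem_cons.mp hp' with rfl | hp'
      · exact h hq'
      · exact h (hq _ _ (List.rel_of_pairwise_cons h1 hp').le hq')

/-- `(z, c)` is the piece in force on the left of t₁, that is, the first with end time at least t₁.
In the application to e_i its end time is t₁ itself, whereas f_i may have to cut it. -/
theorem exists_decomposition {l : List (X × ℝ)} (hl : IsReducedList l) {t₀ t₁ : ℝ}
    (h01 : t₀ < t₁) (h1 : t₁ ≤ 1) :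
    ∃ B D z c A, l = B ++ (D ++ (z, c) :: A) ∧ (∀ p ∈ B, p.2 ≤ t₀) ∧
      (∀ p ∈ D, t₀ < p.2 ∧ p.2 < t₁) ∧ t₁ ≤ c ∧ ∀ p ∈ A, c < p.2 := by
  obtain ⟨B, l', rfl, hB, hl'⟩ := exists_split hl.chain_lt (q := fun s => s ≤ t₀)
    fun s s' h h' => h.trans h'
  have hc := List.isChain_append.mp hl.chain_lt
  obtain ⟨D, A₀, rfl, hD, hA₀⟩ := exists_split hc.2.1 (q := fun s => s < t₁)
    fun s s' h h' => h.trans_lt h'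
  obtain ⟨p, hp, hp1⟩ := hl.exists_time_one
  cases A₀ with
  | nil =>
    rw [List.append_nil, List.mem_append] at hp
    rcases hp with hp | hp
    · have := hB p hp; linarith
    · have := hD p hp; linarith
  | cons w A =>
    obtain ⟨z, c⟩ := w
    refine ⟨B, D, z, c, A, rfl, hB, fun p hp => ⟨?_, hD p hp⟩, ?_, ?_⟩
    · exact not_le.mp (hl' p (by simp [hp]))
    · exact not_lt.mp (hA₀ (z, c) (by simp))
    · have hc' := (List.isChain_append.mp hc.2.1).2.1
      have : IsTrans (X × ℝ) fun p p' => p.2 < p'.2 := ⟨fun _ _ _ => lt_trans⟩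
      have h1 := List.isChain_iff_pairwise.mp hc'
      exact fun p hp => List.rel_of_pairwise_cons h1 hp

variable {r : X → X} {t₀ t₁ : ℝ}

open scoped Classical in
theorem eReflect_eq {B D A : List (X × ℝ)} {z : X} (h01 : t₀ < t₁) (hB : ∀ p ∈ B, p.2 ≤ t₀)
    (hD : ∀ p ∈ D, t₀ < p.2 ∧ p.2 < t₁) (hA : ∀ p ∈ A, t₁ < p.2) :
    eReflect r t₀ t₁ (B ++ (D ++ (z, t₁) :: A)) =
      B ++ ((if t₀ = (B.getLast?.map Prod.snd).getD 0 then [] else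
        (D ++ [(z, t₁)]).head?.toList.map fun p => (p.1, t₀)) ++
      ((D.map fun p => (r p.1, p.2)) ++
        ((if some (r z) = A.head?.map Prod.fst then [] else [(r z, t₁)]) ++ A))) := by
  have e1 : (B ++ (D ++ (z, t₁) :: A)).filter (fun p => p.2 ≤ t₀) = B := by
    rw [List.filter_append, List.filter_eq_self.mpr (by simpa using hB), List.filter_eq_nil_iff.mpr,
      List.append_nil]
    intro p hp
    simp only [List.mem_append, List.mem_cons] at hp
    rcases hp with hp | rfl | hp
    · simpa using (hD p hp).1
    · simpa using h01
    · simpa using h01.trans (hA p hp)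
  have e2 : (B ++ (D ++ (z, t₁) :: A)).filter (fun p => t₀ < p.2 ∧ p.2 ≤ t₁) =
      D ++ [(z, t₁)] := by
    rw [List.filter_append, List.filter_append, List.filter_eq_nil_iff.mpr, List.nil_append,
      List.filter_eq_self.mpr, List.filter_cons_of_pos, List.filter_eq_nil_iff.mpr]
    · intro p hp; simpa using fun _ => hA p hp
    · simpa using h01
    · intro p hp; simpa using ⟨(hD p hp).1, (hD p hp).2.le⟩
    · intro p hp; simpa using fun h => absurd h (not_lt.mpr (hB p hp))
  have e3 : (B ++ (D ++ (z, t₁) :: A)).filter (fun p => t₁ < p.2) = A := by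
    rw [List.filter_append, List.filter_append, List.filter_eq_nil_iff.mpr, List.nil_append,
      List.filter_eq_nil_iff.mpr, List.nil_append, List.filter_cons_of_neg, List.filter_eq_self.mpr]
    · intro p hp; simpa using hA p hp
    · simp
    · intro p hp; simpa using (hD p hp).2.le
    · intro p hp; simpa using (hB p hp).trans h01.le
  unfold eReflect
  simp only [e1, e2, e3]
  simp only [List.append_assoc, List.map_append, List.map_cons, List.map_nil]
  congr 2
  rw [← List.append_assoc]
  simp only [List.getLast?_append, List.getLast?_singleton, Option.some_or, Option.map_some,
    List.dropLast_concat]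
  split_ifs <;> simp

open scoped Classical in
theorem fReflect_eq {B D A : List (X × ℝ)} {z : X} {c : ℝ} (h01 : t₀ < t₁)
    (hB : ∀ p ∈ B, p.2 ≤ t₀) (hD : ∀ p ∈ D, t₀ < p.2 ∧ p.2 < t₁) (hc : t₁ ≤ c)
    (hA : ∀ p ∈ A, c < p.2) :
    fReflect r t₀ t₁ (B ++ (D ++ (z, c) :: A)) =
      (if B.getLast?.map Prod.fst = ((D.map fun p => (r p.1, p.2)) ++ [(r z, t₁)]).head?.map Prod.fst
        then B.dropLast else B) ++
      (((D.map fun p => (r p.1, p.2)) ++ [(r z, t₁)]) ++ (if c = t₁ then A else (z, c) :: A)) := by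
  have e1 : (B ++ (D ++ (z, c) :: A)).filter (fun p => p.2 ≤ t₀) = B := by
    rw [List.filter_append, List.filter_eq_self.mpr (by simpa using hB), List.filter_eq_nil_iff.mpr,
      List.append_nil]
    intro p hp
    simp only [List.mem_append, List.mem_cons] at hp
    rcases hp with hp | rfl | hp
    · simpa using (hD p hp).1
    · simpa using h01.trans_le hc
    · simpa using h01.trans_le (hc.trans (hA p hp).le)
  have e2 : (B ++ (D ++ (z, c) :: A)).filter (fun p => t₀ < p.2 ∧ p.2 < t₁) = D := by
    rw [List.filter_append, List.filter_append, List.filter_eq_nil_iff.mpr, List.nil_append,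
      List.filter_eq_self.mpr, List.filter_cons_of_neg, List.filter_eq_nil_iff.mpr, List.append_nil]
    · intro p hp; simpa using fun _ => hc.trans (hA p hp).le
    · simpa using fun _ => hc
    · intro p hp; simpa using hD p hp
    · intro p hp; simpa using fun h => absurd h (not_lt.mpr (hB p hp))
  have e3 : (B ++ (D ++ (z, c) :: A)).filter (fun p => t₀ < p.2 ∧ t₁ ≤ p.2) = (z, c) :: A := by
    rw [List.filter_append, List.filter_append, List.filter_eq_nil_iff.mpr, List.nil_append,
      List.filter_eq_nil_iff.mpr, List.nil_append, List.filter_eq_self.mpr]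
    · intro p hp
      rcases List.mem_cons.mp hp with rfl | hp
      · simpa using ⟨h01.trans_le hc, hc⟩
      · have := hA p hp
        simpa using ⟨h01.trans_le (hc.trans this.le), hc.trans this.le⟩
    · intro p hp; simpa using fun _ => (hD p hp).2
    · intro p hp; simpa using fun h => absurd h (not_lt.mpr (hB p hp))
  unfold fReflect
  simp only [e1, e2, e3]
  simp

end StepLists

section Reflect

/-! ## The step functions of the rearranged lists -/

variable {X Y : Type*} {l : List (X × ℝ)} {r : X → X} {t₀ t₁ : ℝ}

/-- The properties that determine the list obtained from `l` by applying `r` to the entries between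
the times `t₀` and `t₁`. -/
structure IsReflection (r : X → X) (t₀ t₁ : ℝ) (l l' : List (X × ℝ)) : Prop where
  reduced : IsReducedList l'
  -- Upward closed predicates treat t ≤ s and t < s, hence left and right limits, together; ¬ q 0
  -- excludes times that precede the path.
  step : ∀ q : ℝ → Prop, (∀ s s', s ≤ s' → q s → q s') → ¬ q 0 →
    (q t₀ → stepAt q l' = stepAt q l) ∧
    (¬ q t₀ → q t₁ → stepAt q l' = (stepAt q l).map r) ∧ (¬ q t₁ → stepAt q l' = stepAt q l)
  time : ∀ p ∈ l', p.2 = t₀ ∨ p.2 = t₁ ∨ ∃ p' ∈ l, p'.2 = p.2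

namespace IsReflection

variable {l' : List (X × ℝ)}

theorem stepL_of_le (h : IsReflection r t₀ t₁ l l') {t : ℝ} (h0 : 0 < t) (ht : t ≤ t₀) :
    stepL l' t = stepL l t :=
  (h.step (fun s => t ≤ s) (fun _ _ h h' => h'.trans h) (not_le.mpr h0)).1 ht

theorem stepL_of_mem (h : IsReflection r t₀ t₁ l l') {t : ℝ} (h0 : 0 < t) (ht : t₀ < t)
    (ht' : t ≤ t₁) : stepL l' t = (stepL l t).map r :=
  (h.step (fun s => t ≤ s) (fun _ _ h h' => h'.trans h) (not_le.mpr h0)).2.1 (not_le.mpr ht) ht'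

theorem stepL_of_lt (h : IsReflection r t₀ t₁ l l') {t : ℝ} (h0 : 0 < t) (ht : t₁ < t) :
    stepL l' t = stepL l t :=
  (h.step (fun s => t ≤ s) (fun _ _ h h' => h'.trans h) (not_le.mpr h0)).2.2 (not_le.mpr ht)

theorem stepR_of_lt (h : IsReflection r t₀ t₁ l l') {t : ℝ} (h0 : 0 ≤ t) (ht : t < t₀) :
    stepR l' t = stepR l t :=
  (h.step (fun s => t < s) (fun _ _ h h' => h'.trans_le h) (not_lt.mpr h0)).1 ht

theorem stepR_of_mem (h : IsReflection r t₀ t₁ l l') {t : ℝ} (h0 : 0 ≤ t) (ht : t₀ ≤ t)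
    (ht' : t < t₁) : stepR l' t = (stepR l t).map r :=
  (h.step (fun s => t < s) (fun _ _ h h' => h'.trans_le h) (not_lt.mpr h0)).2.1 (not_lt.mpr ht) ht'

theorem stepR_of_le (h : IsReflection r t₀ t₁ l l') {t : ℝ} (h0 : 0 ≤ t) (ht : t₁ ≤ t) :
    stepR l' t = stepR l t :=
  (h.step (fun s => t < s) (fun _ _ h h' => h'.trans_le h) (not_lt.mpr h0)).2.2 (not_lt.mpr ht)

theorem unique {l'' : List (X × ℝ)} (h : IsReflection r t₀ t₁ l l')
    (h' : IsReflection r t₀ t₁ l l'') : l' = l'' := by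
  refine h.reduced.ext_stepL h'.reduced fun t ht => ?_
  by_cases h1 : t ≤ t₀
  · rw [h.stepL_of_le ht h1, h'.stepL_of_le ht h1]
  by_cases h2 : t ≤ t₁
  · rw [h.stepL_of_mem ht (not_le.mp h1) h2, h'.stepL_of_mem ht (not_le.mp h1) h2]
  · rw [h.stepL_of_lt ht (not_le.mp h2), h'.stepL_of_lt ht (not_le.mp h2)]

theorem eq_of_involutive (hr : ∀ x, r (r x) = x) (hl : IsReducedList l) {l'' : List (X × ℝ)}
    (h : IsReflection r t₀ t₁ l l') (h' : IsReflection r t₀ t₁ l' l'') : l'' = l := by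
  refine h'.reduced.ext_stepL hl fun t ht => ?_
  by_cases h1 : t ≤ t₀
  · rw [h'.stepL_of_le ht h1, h.stepL_of_le ht h1]
  by_cases h2 : t ≤ t₁
  · rw [h'.stepL_of_mem ht (not_le.mp h1) h2, h.stepL_of_mem ht (not_le.mp h1) h2, Option.map_map]
    have : r ∘ r = id := funext hr
    rw [this, Option.map_id_fun, id_eq]
  · rw [h'.stepL_of_lt ht (not_le.mp h2), h.stepL_of_lt ht (not_le.mp h2)]

theorem map {f : X → Y} {r' : Y → Y} (h : IsReflection r t₀ t₁ l l')
    (hf : ∀ x, f (r x) = r' (f x))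
    (hred : IsReducedList (l'.map fun p => (f p.1, p.2))) :
    IsReflection r' t₀ t₁ (l.map fun p => (f p.1, p.2)) (l'.map fun p => (f p.1, p.2)) := by
  refine ⟨hred, fun q hq h0 => ?_, fun p hp => ?_⟩
  · obtain ⟨h1, h2, h3⟩ := h.step q hq h0
    simp only [stepAt_map]
    refine ⟨fun h => by rw [h1 h], fun h h' => ?_, fun h => by rw [h3 h]⟩
    rw [h2 h h', Option.map_map, Option.map_map]
    congr 1
    exact funext hf
  · obtain ⟨p₁, hp₁, rfl⟩ := List.mem_map.mp hp
    rcases h.time p₁ hp₁ with h | h | ⟨p', hp', h⟩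
    · exact .inl h
    · exact .inr (.inl h)
    · exact .inr (.inr ⟨_, List.mem_map.mpr ⟨p', hp', rfl⟩, h⟩)

end IsReflection

theorem stepAt_decomp {q : ℝ → Prop} (hq : ∀ s s', s ≤ s' → q s → q s') {B D A : List (X × ℝ)}
    {z : X} {c : ℝ} (h01 : t₀ < t₁) (hB : ∀ p ∈ B, p.2 ≤ t₀)
    (hD : ∀ p ∈ D, t₀ < p.2 ∧ p.2 < t₁) (hc : t₁ ≤ c) :
    (q t₀ → stepAt q (B ++ (D ++ (z, c) :: A)) =
      (stepAt q B).or ((D ++ [(z, c)]).head?.map Prod.fst)) ∧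
    (¬ q t₀ → q t₁ → stepAt q (B ++ (D ++ (z, c) :: A)) = (stepAt q D).or (some z)) ∧
    (¬ q t₁ → stepAt q (B ++ (D ++ (z, c) :: A)) = stepAt q ((z, c) :: A)) := by
  refine ⟨fun h => ?_, fun h0 h1 => ?_, fun h1 => ?_⟩
  · rw [stepAt_append]
    congr 1
    have hz : q c := hq _ _ (h01.le.trans hc) h
    cases D with
    | nil => exact stepAt_cons_of_pos (p := (z, c)) hz A
    | cons p D => exact stepAt_cons_of_pos (hq _ _ (hD p (by simp)).1.le h) _
  · rw [stepAt_append, stepAt_append, stepAt_eq_none fun p hp hp' => h0 (hq _ _ (hB p hp) hp'),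
      Option.none_or, stepAt_cons_of_pos (p := (z, c)) (hq _ _ hc h1)]
  · rw [stepAt_append, stepAt_append,
      stepAt_eq_none fun p hp hp' => h1 (hq _ _ ((hB p hp).trans h01.le) hp'), Option.none_or,
      stepAt_eq_none fun p hp hp' => h1 (hq _ _ (hD p hp).2.le hp'), Option.none_or]

theorem isChain_map_reflect (hr : Function.Injective r) {D : List (X × ℝ)}
    (h : D.IsChain fun p p' => p.2 < p'.2 ∧ p'.1 ≠ p.1) :
    (D.map fun p => (r p.1, p.2)).IsChain fun p p' => p.2 < p'.2 ∧ p'.1 ≠ p.1 := by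
  rw [List.isChain_map]
  exact h.imp fun _ _ h => ⟨h.1, hr.ne h.2⟩

/-- `w` is the direction just after t₀. It heads the middle part whether or not `D` is empty, which
saves case distinctions at the junction with `B`. -/
theorem exists_head {D A : List (X × ℝ)} {z : X} {c : ℝ} (r : X → X) (h01 : t₀ < t₁)
    (hD : ∀ p ∈ D, t₀ < p.2 ∧ p.2 < t₁) (hc : t₁ ≤ c) :
    ∃ w s s', (D ++ [(z, c)]).head? = some (w, s) ∧ (D ++ (z, c) :: A).head? = some (w, s) ∧
      t₀ < s ∧ ((D.map fun p => (r p.1, p.2)) ++ [(r z, t₁)]).head? = some (r w, s') ∧ t₀ < s' := by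
  cases D with
  | nil => exact ⟨z, c, t₁, rfl, rfl, h01.trans_le hc, rfl, h01⟩
  | cons p D => exact ⟨p.1, p.2, p.2, rfl, rfl, (hD p (by simp)).1, rfl, (hD p (by simp)).1⟩

theorem stepL_eq_of_getLast {l : List (X × ℝ)} {p : X × ℝ}
    (hl : l.IsChain fun p p' => p.2 < p'.2) (hp : p ∈ l.getLast?) :
    stepL l p.2 = some p.1 :=
  stepL_eq_of_mem hl (List.mem_of_getLast? hp)

theorem times_le_getLast {l : List (X × ℝ)} {p p' : X × ℝ}
    (hl : l.IsChain fun p p' => p.2 < p'.2) (hp : p ∈ l.getLast?) (hp' : p' ∈ l) :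
    p'.2 ≤ p.2 := by
  obtain ⟨ys, rfl⟩ := List.getLast?_eq_some_iff.mp hp
  have : IsTrans (X × ℝ) fun p p' => p.2 < p'.2 := ⟨fun _ _ _ => lt_trans⟩
  have h2 := List.isChain_iff_pairwise.mp hl
  rw [List.pairwise_append] at h2
  rcases List.mem_append.mp hp' with hp' | hp'
  · exact (h2.2.2 p' hp' p (by simp)).le
  · rw [List.mem_singleton.mp hp']

/-- The rearrangement for `e_i` reflects the entries between `t₀` and `t₁`. -/
theorem isReflection_eReflect (hl : IsReducedList l) (hr : Function.Injective r) (h0 : 0 ≤ t₀)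
    (h01 : t₀ < t₁) (h1 : ∃ p ∈ l, p.2 = t₁)
    (hne : ∀ x ∈ stepR l t₀, ∀ y ∈ stepL l t₀, y ≠ r x) :
    IsReflection r t₀ t₁ l (eReflect r t₀ t₁ l) := by
  classical
  have ht1 : t₁ ≤ 1 := by
    obtain ⟨p, hp, rfl⟩ := h1
    exact hl.le_one hp
  obtain ⟨B, D, z, c, A, rfl, hB, hD, hc, hA⟩ := exists_decomposition hl h01 ht1
  have hct : c = t₁ := by
    obtain ⟨p, hp, hpt⟩ := h1
    simp only [List.mem_append, List.mem_cons] at hp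
    rcases hp with hp | hp | rfl | hp
    · have := hB p hp; linarith
    · have := hD p hp; linarith
    · exact hpt
    · have := hA p hp; linarith
  subst hct
  have cl := hl.chain
  rw [List.isChain_append, List.isChain_append] at cl
  obtain ⟨cB, ⟨cD, czA, jD⟩, jB⟩ := cl
  have cB' := cB.imp fun _ _ h => h.1
  obtain ⟨w, s, s', hw, hw', hs, hrw, hs'⟩ := exists_head (A := A) (z := z) r h01 hD le_rfl
  have hdec := fun q hq => stepAt_decomp (z := z) (A := A) (q := q) hq h01 hB hD le_rfl
  rw [hw] at hdec
  rw [hw'] at jB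
  have hjB : ∀ p ∈ B.getLast?, p.2 < s ∧ w ≠ p.1 := fun p hp => jB p hp _ rfl
  have hstepR : stepR (B ++ (D ++ (z, c) :: A)) t₀ = some w := by
    rw [stepR, stepAt_append, stepAt_eq_none fun p hp => not_lt.mpr (hB p hp), Option.none_or]
    cases D with
    | nil =>
      simp only [List.nil_append, List.head?_cons, Option.some.injEq, Prod.mk.injEq] at hw
      rw [List.nil_append, stepAt_cons_of_pos (p := (z, c)) h01, hw.1]
    | cons p D =>
      simp only [List.cons_append, List.head?_cons, Option.some.injEq] at hw
      rw [List.cons_append, stepAt_cons_of_pos (hD p (by simp)).1, hw]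
  have hw_ne : ∀ y ∈ stepL (B ++ (D ++ (z, c) :: A)) t₀, y ≠ r w := hne w hstepR
  have hstepL : stepL (B ++ (D ++ (z, c) :: A)) t₀ =
      (stepL B t₀).or (some w) := by
    rw [stepL, (hdec (fun s => t₀ ≤ s) fun s s' h h' => h'.trans h).1 le_rfl]; rfl
  -- The default 0 is the time a_0, which the encoding omits; it is the previous break if nothing
  -- precedes t₀.
  have hprev : t₀ = (B.getLast?.map Prod.snd).getD 0 → ∀ p ∈ B.getLast?, p.2 = t₀ := by
    intro h p hp
    rw [Option.mem_def.mp hp] at h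
    exact h.symm
  have hprev' : t₀ ≠ (B.getLast?.map Prod.snd).getD 0 → ∀ p ∈ B, p.2 < t₀ := by
    intro h p hp
    have hne : B ≠ [] := List.ne_nil_of_mem hp
    have hlast := List.getLast?_eq_some_getLast hne
    rw [hlast] at h
    have h2 := times_le_getLast cB' hlast hp
    exact h2.trans_lt (lt_of_le_of_ne (hB _ (List.getLast_mem hne)) (Ne.symm h))
  rw [eReflect_eq h01 hB hD hA, hw]
  set rD := D.map fun p => (r p.1, p.2) with hrD
  have crD : rD.IsChain fun p p' => p.2 < p'.2 ∧ p'.1 ≠ p.1 := isChain_map_reflect hr cD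
  have jrD : ∀ p ∈ rD.getLast?, p.2 < c ∧ r z ≠ p.1 := by
    intro p hp
    rw [hrD, List.getLast?_map] at hp
    obtain ⟨d, hd, rfl⟩ := Option.map_eq_some_iff.mp (Option.mem_def.mp hp)
    have := jD d hd (z, c) rfl
    exact ⟨this.1, hr.ne this.2⟩
  have cA := (List.isChain_cons.mp czA).2
  have jA := (List.isChain_cons.mp czA).1
  -- `M` is all that follows the possible cut at t₀. If `D` is empty and r z merges with the next
  -- piece, its head lies in `A`, but its entry is still r w.
  obtain ⟨M, hM⟩ : ∃ M, M = rD ++ ((if some (r z) = A.head?.map Prod.fst then [] else [(r z, c)]) ++ A) :=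
    ⟨_, rfl⟩
  rw [← hM]
  have cM : M.IsChain fun p p' => p.2 < p'.2 ∧ p'.1 ≠ p.1 := by
    rw [hM]
    split_ifs with h
    · rw [List.nil_append, List.isChain_append]
      refine ⟨crD, cA, fun p hp a ha => ?_⟩
      have e : a.1 = r z := by
        rw [Option.mem_def.mp ha] at h; simpa using h.symm
      exact ⟨(jrD p hp).1.trans (jA a ha).1, e ▸ (jrD p hp).2⟩
    · rw [List.singleton_append, List.isChain_append, List.isChain_cons]
      refine ⟨crD, ⟨fun a ha => ⟨(jA a ha).1, fun e => h ?_⟩, cA⟩, fun p hp a ha => ?_⟩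
      · rw [Option.mem_def.mp ha]; simp [e]
      · have : (r z, c) = a := by simpa using ha
        subst this
        exact jrD p hp
  have hMhead : ∀ p ∈ M.head?, p.1 = r w ∧ t₀ < p.2 := by
    intro p hp
    rw [hM] at hp
    cases D with
    | nil =>
      simp only [List.nil_append, List.head?_cons, Option.some.injEq, Prod.mk.injEq] at hw
      rw [hrD, List.map_nil, List.nil_append] at hp
      split_ifs at hp with h
      · rw [List.nil_append] at hp
        rw [Option.mem_def.mp hp] at h
        refine ⟨?_, h01.trans (jA p hp).1⟩
        rw [← hw.1]; simpa using h.symm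
      · have : (r z, c) = p := by simpa using hp
        subst this
        exact ⟨by rw [hw.1], h01⟩
    | cons d D =>
      simp only [List.cons_append, List.head?_cons, Option.some.injEq] at hw
      have : (r d.1, d.2) = p := by simpa [hrD] using hp
      subst this
      exact ⟨by rw [hw], (hD d (by simp)).1⟩
  refine ⟨⟨?_, ?_, ?_⟩, ?_, ?_⟩
  · rw [List.isChain_append]
    split_ifs with h
    · rw [List.nil_append]
      refine ⟨cB, cM, fun p hp p' hp' => ?_⟩
      have h2 := hprev h p hp
      obtain ⟨h3, h4⟩ := hMhead p' hp'
      refine ⟨h2 ▸ h4, h3 ▸ (hw_ne p.1 ?_).symm⟩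
      rw [hstepL, ← h2, stepL_eq_of_getLast cB' hp]; rfl
    · simp only [Option.toList_some, List.map_cons, List.map_nil, List.singleton_append]
      rw [List.isChain_cons]
      refine ⟨cB, ⟨fun p' hp' => ?_, cM⟩, fun p hp p' hp' => ?_⟩
      · obtain ⟨h3, h4⟩ := hMhead p' hp'
        refine ⟨h4, h3 ▸ (hw_ne w ?_).symm⟩
        rw [hstepL, stepL, stepAt_eq_none fun p hp => not_le.mpr (hprev' h p hp)]; rfl
      · have : (w, t₀) = p' := by simpa using hp'
        subst this
        exact ⟨hprev' h p (List.mem_of_getLast? hp), (hjB p hp).2⟩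
  · intro p hp
    rw [List.mem_append, List.mem_append, hM, List.mem_append, List.mem_append] at hp
    rcases hp with hp | hp | hp | hp | hp
    · exact hl.pos p (by simp [hp])
    · split_ifs at hp with h
      · simp at hp
      · have : p = (w, t₀) := by simpa using hp
        subst this
        -- A cut at time 0 would create an empty piece. It does not occur: for t₀ = 0 nothing
        -- precedes, and the default value makes the test for a break at t₀ succeed.
        refine lt_of_le_of_ne h0 fun h0' => ?_
        have hBnil : B = [] := by
          rw [List.eq_nil_iff_forall_not_mem]
          intro p hp
          have := hl.pos p (by simp [hp])
          have h3 := hB p hp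
          change 0 = t₀ at h0'
          linarith
        rw [hBnil] at h
        exact h h0'.symm
    · obtain ⟨d, hd, rfl⟩ := List.mem_map.mp hp
      exact hl.pos d (by simp [hd])
    · split_ifs at hp with h
      · simp at hp
      · have : p = (r z, c) := by simpa using hp
        subst this
        exact h0.trans_lt h01
    · exact hl.pos p (by simp [hp])
  · obtain ⟨p, hp, hp1⟩ := hl.last
    rcases List.eq_nil_or_concat A with rfl | ⟨A', a, rfl⟩
    · have : (z, c) = p := by simpa using hp
      subst this
      refine ⟨(r z, c), ?_, hp1⟩
      rw [hM]
      simp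
    · have : a = p := by
        simpa [List.getLast?_cons] using hp
      subst this
      refine ⟨a, ?_, hp1⟩
      rw [hM]
      simp [List.getLast?_append]
  · intro q hq hq0
    obtain ⟨d1, d2, d3⟩ := hdec q hq
    refine ⟨fun h => ?_, fun h h' => ?_, fun h => ?_⟩
    · rw [d1 h, stepAt_append]
      split_ifs with hcut
      · have hBne : B ≠ [] := by
          rintro rfl
          apply hq0
          have : t₀ = 0 := by simpa using hcut
          rwa [← this]
        obtain ⟨x, hx⟩ := stepAt_isSome (q := q) (List.getLast_mem hBne) (by
          rw [hprev hcut _ (List.getLast?_eq_some_getLast hBne)]; exact h)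
        rw [hx]; rfl
      · simp only [Option.toList_some, List.map_cons, List.map_nil, List.singleton_append]
        rw [stepAt_cons_of_pos (p := (w, t₀)) h]; rfl
    · rw [d2 h h', stepAt_append, stepAt_append, stepAt_eq_none fun p hp hp' => h (hq _ _ (hB p hp) hp'),
        Option.none_or, hM, stepAt_append]
      have e1 : stepAt q ((if t₀ = (B.getLast?.map Prod.snd).getD 0 then [] else
          (some (w, s)).toList.map fun p => (p.1, t₀)) : List (X × ℝ)) = none := by
        split_ifs
        · rfl
        · simp only [Option.toList_some, List.map_cons, List.map_nil]
          rw [stepAt_cons_of_neg (p := (w, t₀)) h]; rfl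
      rw [e1, Option.none_or, hrD, stepAt_map, Option.map_or]
      congr 1
      split_ifs with hz
      · rw [List.nil_append, stepAt_eq_head fun p hp => hq _ _ (hA p hp).le h', ← hz]; rfl
      · rw [List.singleton_append, stepAt_cons_of_pos (p := (r z, c)) h']; rfl
    · have h2 : ¬ q t₀ := fun h' => h (hq _ _ h01.le h')
      rw [d3 h, stepAt_append, stepAt_append, stepAt_eq_none fun p hp hp' => h2 (hq _ _ (hB p hp) hp'),
        Option.none_or, hM, stepAt_append, stepAt_append, stepAt_cons_of_neg (p := (z, c)) h]
      have e1 : stepAt q ((if t₀ = (B.getLast?.map Prod.snd).getD 0 then [] else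
          (some (w, s)).toList.map fun p => (p.1, t₀)) : List (X × ℝ)) = none := by
        split_ifs
        · rfl
        · simp only [Option.toList_some, List.map_cons, List.map_nil]
          rw [stepAt_cons_of_neg (p := (w, t₀)) h2]; rfl
      have e2 : stepAt q rD = none := by
        rw [hrD, stepAt_map, stepAt_eq_none fun p hp hp' => h (hq _ _ (hD p hp).2.le hp')]; rfl
      have e3 : stepAt q ((if some (r z) = A.head?.map Prod.fst then [] else [(r z, c)]) :
          List (X × ℝ)) = none := by
        split_ifs
        · rfl
        · rw [stepAt_cons_of_neg (p := (r z, c)) h]; rfl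
      rw [e1, e2, e3]; rfl
  · intro p hp
    rw [List.mem_append, List.mem_append, hM, List.mem_append, List.mem_append] at hp
    rcases hp with hp | hp | hp | hp | hp
    · exact .inr (.inr ⟨p, by simp [hp], rfl⟩)
    · split_ifs at hp with h
      · simp at hp
      · have : p = (w, t₀) := by simpa using hp
        subst this
        exact .inl rfl
    · obtain ⟨d, hd, rfl⟩ := List.mem_map.mp hp
      exact .inr (.inr ⟨d, by simp [hd], rfl⟩)
    · split_ifs at hp with h
      · simp at hp
      · have : p = (r z, c) := by simpa using hp
        subst this
        exact .inr (.inl rfl)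
    · exact .inr (.inr ⟨p, by simp [hp], rfl⟩)

/-- The rearrangement for `f_i` reflects the entries between `t₀` and `t₁`. -/
theorem isReflection_fReflect (hl : IsReducedList l) (hr : Function.Injective r)
    (h01 : t₀ < t₁) (h1 : t₁ ≤ 1) (ht₀ : t₀ = 0 ∨ ∃ p ∈ l, p.2 = t₀)
    (hne : ∀ x ∈ stepL l t₁, ∀ y ∈ stepR l t₁, y ≠ r x) :
    IsReflection r t₀ t₁ l (fReflect r t₀ t₁ l) := by
  classical
  obtain ⟨B, D, z, c, A, rfl, hB, hD, hc, hA⟩ := exists_decomposition hl h01 h1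
  have cl := hl.chain
  rw [List.isChain_append, List.isChain_append] at cl
  obtain ⟨cB, ⟨cD, czA, jD⟩, jB⟩ := cl
  have cB' := cB.imp fun _ _ h => h.1
  obtain ⟨w, s, s', hw, hw', hs, hrw, hs'⟩ := exists_head (A := A) (z := z) r h01 hD hc
  have hdec := fun q hq => stepAt_decomp (z := z) (A := A) (q := q) hq h01 hB hD hc
  rw [hw] at hdec
  rw [hw'] at jB
  have hjB : ∀ p ∈ B.getLast?, p.2 < s ∧ w ≠ p.1 := fun p hp => jB p hp _ rfl
  have cA := (List.isChain_cons.mp czA).2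
  have jA := (List.isChain_cons.mp czA).1
  -- Since f_i starts at a break point or at 0, no piece is cut at t₀, and merging there removes
  -- exactly the last piece of `B`.
  have hB0 : (B = [] ∧ t₀ = 0) ∨ ∃ B₀ y, B = B₀ ++ [(y, t₀)] := by
    rcases ht₀ with rfl | ⟨p, hp, rfl⟩
    · left
      refine ⟨List.eq_nil_iff_forall_not_mem.mpr fun p hp => ?_, rfl⟩
      have := hl.pos p (by simp [hp])
      have := hB p hp
      linarith
    · right
      have hpB : p ∈ B := by
        simp only [List.mem_append, List.mem_cons] at hp
        rcases hp with hp | hp | rfl | hp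
        · exact hp
        · have := hD p hp; linarith
        · exact absurd hc (not_le.mpr h01)
        · have := hA p hp; linarith
      have hBne : B ≠ [] := List.ne_nil_of_mem hpB
      have hlast := List.getLast?_eq_some_getLast hBne
      have h2 := le_antisymm (hB _ (List.getLast_mem hBne)) (times_le_getLast cB' hlast hpB)
      refine ⟨B.dropLast, (B.getLast hBne).1, ?_⟩
      rw [← h2]
      exact (List.dropLast_append_getLast hBne).symm
  have hz : stepL (B ++ (D ++ (z, c) :: A)) t₁ = some z := by
    rw [stepL, (hdec (fun s => t₁ ≤ s) fun s s' h h' => h'.trans h).2.1 (not_le.mpr h01) le_rfl,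
      stepAt_eq_none fun p hp => not_le.mpr (hD p hp).2]; rfl
  have hzR : stepR (B ++ (D ++ (z, c) :: A)) t₁ = stepR ((z, c) :: A) t₁ := by
    rw [stepR, (hdec (fun s => t₁ < s) fun s s' h h' => h'.trans_le h).2.2 (lt_irrefl _)]
  have hz_ne := hne z hz
  rw [hzR] at hz_ne
  rw [fReflect_eq h01 hB hD hc hA, hrw]
  set rD := D.map fun p => (r p.1, p.2) with hrD
  have crD : rD.IsChain fun p p' => p.2 < p'.2 ∧ p'.1 ≠ p.1 := isChain_map_reflect hr cD
  have jrD : ∀ p ∈ rD.getLast?, p.2 < t₁ ∧ r z ≠ p.1 := by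
    intro p hp
    rw [hrD, List.getLast?_map] at hp
    obtain ⟨d, hd, rfl⟩ := Option.map_eq_some_iff.mp (Option.mem_def.mp hp)
    have := jD d hd (z, c) rfl
    exact ⟨(hD d (List.mem_of_getLast? hd)).2, hr.ne this.2⟩
  obtain ⟨A', hA'⟩ : ∃ A', A' = if c = t₁ then A else (z, c) :: A := ⟨_, rfl⟩
  obtain ⟨B', hB'⟩ : ∃ B', B' = if B.getLast?.map Prod.fst = (some (r w, s')).map Prod.fst then
    B.dropLast else B := ⟨_, rfl⟩
  have hA'mem : ∀ p ∈ A', p ∈ (z, c) :: A := by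
    intro p hp
    rw [hA'] at hp
    split_ifs at hp
    · exact List.mem_cons_of_mem _ hp
    · exact hp
  have hB'mem : ∀ p ∈ B', p ∈ B := by
    intro p hp
    rw [hB'] at hp
    split_ifs at hp
    · exact List.mem_of_mem_dropLast hp
    · exact hp
  rw [← hA', ← hB']
  have cA' : ((r z, t₁) :: A').IsChain fun p p' => p.2 < p'.2 ∧ p'.1 ≠ p.1 := by
    rw [List.isChain_cons, hA']
    split_ifs with h
    · refine ⟨fun a ha => ⟨h ▸ (jA a ha).1, hz_ne a.1 ?_⟩, cA⟩
      rw [stepR, stepAt_cons_of_neg (p := (z, c)) (by rw [h]; exact lt_irrefl _)]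
      cases A with
      | nil => simp at ha
      | cons a' A =>
        have : a' = a := by simpa using ha
        subst this
        exact stepAt_cons_of_pos (h ▸ (jA a' ha).1) A
    · refine ⟨fun a ha => ?_, czA⟩
      have : (z, c) = a := by simpa using ha
      subst this
      have hlt := lt_of_le_of_ne hc (Ne.symm h)
      exact ⟨hlt, hz_ne z (stepAt_cons_of_pos (p := (z, c)) hlt A)⟩
  have cM : (rD ++ [(r z, t₁)] ++ A').IsChain fun p p' => p.2 < p'.2 ∧ p'.1 ≠ p.1 := by
    rw [List.append_assoc, List.singleton_append, List.isChain_append]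
    refine ⟨crD, cA', fun p hp a ha => ?_⟩
    have : (r z, t₁) = a := by simpa using ha
    subst this
    exact jrD p hp
  have hMhead : (rD ++ [(r z, t₁)] ++ A').head? = some (r w, s') := by
    rw [List.head?_append, hrw]; rfl
  refine ⟨⟨?_, ?_, ?_⟩, ?_, ?_⟩
  · rw [List.isChain_append, hMhead]
    refine ⟨?_, cM, ?_⟩
    · rw [hB']
      split_ifs
      · exact cB.dropLast
      · exact cB
    · intro p hp p' hp'
      have : (r w, s') = p' := by simpa using hp'
      subst this
      rw [hB'] at hp
      rcases hB0 with ⟨rfl, -⟩ | ⟨B₀, y, rfl⟩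
      · simp at hp
      · simp only [List.getLast?_append, List.getLast?_singleton, Option.some_or, Option.map_some,
          List.dropLast_concat, Option.some.injEq] at hp
        split_ifs at hp with h
        · rw [List.isChain_append] at cB
          have h3 := cB.2.2 p hp (y, t₀) rfl
          exact ⟨h3.1.trans hs', h ▸ h3.2⟩
        · have : (y, t₀) = p := by simpa using hp
          subst this
          exact ⟨hs', Ne.symm h⟩
  · intro p hp
    simp only [List.mem_append, List.mem_singleton] at hp
    rcases hp with hp | (hp | rfl) | hp
    · exact hl.pos p (by simp [hB'mem p hp])
    · obtain ⟨d, hd, rfl⟩ := List.mem_map.mp hp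
      exact hl.pos d (by simp [hd])
    · refine lt_of_le_of_lt ?_ h01
      rcases hB0 with ⟨-, h⟩ | ⟨B₀, y, rfl⟩
      · exact h.ge
      · exact (hl.pos (y, t₀) (by simp)).le
    · have := hA'mem p hp
      exact hl.pos p (by simp only [List.mem_append]; exact .inr (.inr this))
  · obtain ⟨p, hp, hp1⟩ := hl.last
    rcases List.eq_nil_or_concat A with rfl | ⟨A₀, a, rfl⟩
    · have : (z, c) = p := by simpa using hp
      subst this
      rw [hA']
      split_ifs with h
      · exact ⟨(r z, t₁), by simp, by rw [← h]; exact hp1⟩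
      · exact ⟨(z, c), by simp, hp1⟩
    · have : a = p := by
        simpa [List.getLast?_cons] using hp
      subst this
      refine ⟨a, ?_, hp1⟩
      rw [hA']
      split_ifs with h <;> simp [List.getLast?_append, List.getLast?_cons]
  · intro q hq hq0
    obtain ⟨d1, d2, d3⟩ := hdec q hq
    refine ⟨fun h => ?_, fun h h' => ?_, fun h => ?_⟩
    · rw [d1 h, stepAt_append]
      have hM : stepAt q (rD ++ [(r z, t₁)] ++ A') = some (r w) := by
        have hq' : q s' := hq _ _ hs'.le h
        cases hMM : rD ++ [(r z, t₁)] ++ A' with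
        | nil => rw [hMM] at hMhead; simp at hMhead
        | cons p l =>
          rw [hMM] at hMhead
          have : p = (r w, s') := by simpa using hMhead
          subst this
          exact stepAt_cons_of_pos (p := (r w, s')) hq' l
      rw [hM]
      rcases hB0 with ⟨rfl, h0⟩ | ⟨B₀, y, rfl⟩
      · exact (hq0 (h0 ▸ h)).elim
      · simp only [List.getLast?_append, List.getLast?_singleton, Option.some_or, Option.map_some,
          List.dropLast_concat, Option.some.injEq] at hB'
        rw [hB', stepAt_append, stepAt_cons_of_pos (p := (y, t₀)) h]
        split_ifs with hy
        · rw [hy]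
          cases stepAt q B₀ <;> rfl
        · rw [stepAt_append, stepAt_cons_of_pos (p := (y, t₀)) h]
          cases stepAt q B₀ <;> rfl
    · rw [d2 h h', stepAt_append, stepAt_append, stepAt_append,
        stepAt_eq_none fun p hp hp' => h (hq _ _ (hB p (hB'mem p hp)) hp'),
        Option.none_or, stepAt_cons_of_pos (p := (r z, t₁)) h', hrD, stepAt_map]
      cases stepAt q D <;> rfl
    · have h2 : ¬ q t₀ := fun h' => h (hq _ _ h01.le h')
      rw [d3 h, stepAt_append, stepAt_append, stepAt_append,
        stepAt_eq_none fun p hp hp' => h2 (hq _ _ (hB p (hB'mem p hp)) hp'),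
        Option.none_or, stepAt_cons_of_neg (p := (r z, t₁)) h, hrD, stepAt_map,
        stepAt_eq_none fun p hp hp' => h (hq _ _ (hD p hp).2.le hp'), hA']
      split_ifs with hct
      · rw [stepAt_cons_of_neg (p := (z, c)) (by rw [hct]; exact h)]; rfl
      · rfl
  · intro p hp
    simp only [List.mem_append, List.mem_singleton] at hp
    rcases hp with hp | (hp | rfl) | hp
    · exact .inr (.inr ⟨p, by simp [hB'mem p hp], rfl⟩)
    · obtain ⟨d, hd, rfl⟩ := List.mem_map.mp hp
      exact .inr (.inr ⟨d, by simp [hd], rfl⟩)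
    · exact .inr (.inl rfl)
    · have := hA'mem p hp
      exact .inr (.inr ⟨p, by simp only [List.mem_append]; exact .inr (.inr this), rfl⟩)

end Reflect

/-! ## Piecewise linear functions with integral local minima -/

/-- A piecewise linear function on `[0, 1]` with left slopes `dL` and right slopes `dR`, with
integral values at the end points and at the local minima. -/
structure IsHeightFn (H dL dR : ℝ → ℝ) : Prop where
  cont : ContinuousOn H (Set.Icc 0 1)
  left : ∀ t, 0 < t → t ≤ 1 → ∃ s, 0 ≤ s ∧ s < t ∧ ∀ u, s ≤ u → u ≤ t → H t - H u = (t - u) * dL t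
  right : ∀ t, 0 ≤ t → t < 1 → ∃ s, t < s ∧ s ≤ 1 ∧ ∀ u, t ≤ u → u ≤ s → H u - H t = (u - t) * dR t
  int : ∀ t, 0 < t → t < 1 → dL t ≤ 0 → 0 ≤ dR t → H t ∈ intReal
  zero : H 0 ∈ intReal
  one : H 1 ∈ intReal

theorem intReal_lt_iff {x y : ℝ} (hx : x ∈ intReal) (hy : y ∈ intReal) : x < y ↔ x + 1 ≤ y := by
  obtain ⟨m, rfl⟩ := hx
  obtain ⟨n, rfl⟩ := hy
  simp only [Int.coe_castAddHom]
  norm_cast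

theorem one_mem_intReal : (1 : ℝ) ∈ intReal := ⟨1, by simp⟩

theorem not_mem_intReal_of_between {x y : ℝ} (hx : x ∈ intReal) (h : x < y) (h' : y < x + 1) :
    y ∉ intReal := fun hy => by
  have := (intReal_lt_iff hx hy).mp h
  linarith

namespace IsHeightFn

variable {H dL dR : ℝ → ℝ}

/-- Time reversal swaps left and right slopes up to sign, and with them the roles of e_i and f_i. -/
theorem reverse (h : IsHeightFn H dL dR) :
    IsHeightFn (fun t => H (1 - t)) (fun t => - dR (1 - t)) (fun t => - dL (1 - t)) := by
  refine ⟨?_, fun t h0 h1 => ?_, fun t h0 h1 => ?_, fun t h0 h1 h2 h3 => ?_, ?_, ?_⟩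
  · refine h.cont.comp (by fun_prop) fun t ht => ?_
    exact ⟨by linarith [ht.2], by linarith [ht.1]⟩
  · obtain ⟨s, hs, hs', hu⟩ := h.right (1 - t) (by linarith) (by linarith)
    refine ⟨1 - s, by linarith, by linarith, fun u hu1 hu2 => ?_⟩
    have := hu (1 - u) (by linarith) (by linarith)
    linear_combination -this
  · obtain ⟨s, hs, hs', hu⟩ := h.left (1 - t) (by linarith) (by linarith)
    refine ⟨1 - s, by linarith, by linarith, fun u hu1 hu2 => ?_⟩
    have := hu (1 - u) (by linarith) (by linarith)
    linear_combination -this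
  · exact h.int (1 - t) (by linarith) (by linarith) (by linarith) (by linarith)
  · simpa using h.one
  · simpa using h.zero

theorem dL_nonpos (h : IsHeightFn H dL dR) {a t : ℝ} (ha : a < t) (h0 : 0 < t) (h1 : t ≤ 1)
    (hmin : ∀ u, a ≤ u → u ≤ t → 0 ≤ u → H t ≤ H u) : dL t ≤ 0 := by
  obtain ⟨s, hs0, hst, hs⟩ := h.left t h0 h1
  have h2 := hs (max a s) (le_max_right _ _) (max_le ha.le hst.le)
  have h3 := hmin (max a s) (le_max_left _ _) (max_le ha.le hst.le) (hs0.trans (le_max_right _ _))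
  have h4 : 0 < t - max a s := sub_pos.mpr (max_lt ha hst)
  by_contra hd
  have := mul_pos h4 (not_le.mp hd)
  linarith

theorem dR_nonneg (h : IsHeightFn H dL dR) {a t : ℝ} (ha : t < a) (h0 : 0 ≤ t) (h1 : t < 1)
    (hmin : ∀ u, t ≤ u → u ≤ a → u ≤ 1 → H t ≤ H u) : 0 ≤ dR t := by
  have := h.reverse.dL_nonpos (a := 1 - a) (t := 1 - t) (by linarith) (by linarith) (by linarith)
    fun u h2 h3 h4 => by
      have := hmin (1 - u) (by linarith) (by linarith) (by linarith)
      simpa using this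
  simp only [sub_sub_cancel] at this
  linarith

theorem local_min (h : IsHeightFn H dL dR) {a c t : ℝ} (ha : a < t) (hc : t < c) (h0 : 0 < t)
    (h1 : t < 1) (hmin : ∀ u, a ≤ u → u ≤ c → 0 ≤ u → u ≤ 1 → H t ≤ H u) : H t ∈ intReal :=
  h.int t h0 h1
    (h.dL_nonpos ha h0 h1.le fun u h2 h3 h4 => hmin u h2 (h3.trans hc.le) h4 (h3.trans h1.le))
    (h.dR_nonneg hc h0.le h1 fun u h2 h3 h4 => hmin u (ha.le.trans h2) h3 (h0.le.trans h2) h4)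

theorem exists_isLeast (h : IsHeightFn H dL dR) :
    IsLeast (H '' Set.Icc 0 1) (sInf (H '' Set.Icc 0 1)) :=
  (isCompact_Icc.image_of_continuousOn h.cont).isLeast_sInf
    ((Set.nonempty_Icc.mpr zero_le_one).image H)

theorem isCompact_level (h : IsHeightFn H dL dR) {a c : ℝ} (ha : 0 ≤ a) (hc : c ≤ 1) (m : ℝ) :
    IsCompact {t | t ∈ Set.Icc a c ∧ H t = m} := by
  have h1 : ContinuousOn H (Set.Icc a c) := h.cont.mono (Set.Icc_subset_Icc ha hc)
  have h2 := h1.preimage_isClosed_of_isClosed isClosed_Icc (isClosed_singleton (x := m))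
  exact isCompact_Icc.of_isClosed_subset h2 fun _ h => h.1

theorem min_mem (h : IsHeightFn H dL dR) {m : ℝ} (hm : IsLeast (H '' Set.Icc 0 1) m) :
    m ∈ intReal := by
  obtain ⟨⟨t, ht, rfl⟩, hle⟩ := hm
  rcases ht.1.eq_or_lt with rfl | h0
  · exact h.zero
  rcases ht.2.eq_or_lt with rfl | h1
  · exact h.one
  exact h.local_min h0 h1 h0 h1 fun u h2 h3 _ _ => hle ⟨u, ⟨h2, h3⟩, rfl⟩

/-- The interval on which `e_i` acts. -/
structure EInterval (H dL dR : ℝ → ℝ) (m t₀ t₁ : ℝ) : Prop where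
  zero_le : 0 ≤ t₀
  lt : t₀ < t₁
  le_one : t₁ ≤ 1
  min_mem : m ∈ intReal
  start_eq : H t₀ = m + 1
  end_eq : H t₁ = m
  min_le : ∀ t, 0 ≤ t → t ≤ 1 → m ≤ H t
  before : ∀ t, 0 ≤ t → t ≤ t₀ → m + 1 ≤ H t
  inside : ∀ t, t₀ < t → t < t₁ → m < H t ∧ H t < m + 1
  dL_neg : ∀ t, t₀ < t → t ≤ t₁ → dL t < 0
  dR_neg : ∀ t, t₀ ≤ t → t < t₁ → dR t < 0
  dL_start : 0 < t₀ → dL t₀ ≤ 0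
  dR_end : t₁ < 1 → 0 ≤ dR t₁

/-- Between t₀ and t₁ the values lie strictly between m and m + 1, so they are not integers and no
interior local minimum can occur. Strict descent on the interval and the bound before t₀ both
follow. -/
theorem eInterval (h : IsHeightFn H dL dR) {m t₀ t₁ : ℝ} (hm : IsLeast (H '' Set.Icc 0 1) m)
    (hm0 : H 0 ≠ m) (ht₁ : IsLeast {t | t ∈ Set.Icc 0 1 ∧ H t = m} t₁)
    (ht₀ : IsGreatest {t | t ∈ Set.Icc 0 t₁ ∧ H t = m + 1} t₀) : EInterval H dL dR m t₀ t₁ := by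
  have hmem := h.min_mem hm
  have hle : ∀ t, 0 ≤ t → t ≤ 1 → m ≤ H t := fun t h0 h1 => hm.2 ⟨t, ⟨h0, h1⟩, rfl⟩
  obtain ⟨⟨⟨h00, h1le⟩, hH1⟩, ht₁'⟩ := ht₁
  obtain ⟨⟨⟨h0le, h0le1⟩, hH0⟩, ht₀'⟩ := ht₀
  have h01 : t₀ < t₁ := lt_of_le_of_ne h0le1 fun e => by rw [e, hH1] at hH0; linarith
  have hgt : ∀ t, 0 ≤ t → t < t₁ → m < H t := fun t h0 h1 =>
    lt_of_le_of_ne (hle t h0 (h1.le.trans h1le)) fun e =>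
      absurd (ht₁' ⟨⟨h0, h1.le.trans h1le⟩, e.symm⟩) (not_le.mpr h1)
  have hlt : ∀ t, t₀ < t → t < t₁ → H t < m + 1 := by
    intro t h2 h3
    by_contra hcon
    have hcont : ContinuousOn H (Set.Icc t t₁) :=
      h.cont.mono (Set.Icc_subset_Icc (h0le.trans h2.le) h1le)
    obtain ⟨u, hu, hu'⟩ := intermediate_value_Icc' h3.le hcont
      (show m + 1 ∈ Set.Icc (H t₁) (H t) from ⟨by rw [hH1]; linarith, not_lt.mp hcon⟩)
    have := ht₀' ⟨⟨h0le.trans (h2.le.trans hu.1), hu.2⟩, hu'⟩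
    linarith [hu.1]
  have hnot : ∀ t, t₀ < t → t < t₁ → H t ∉ intReal := fun t h2 h3 =>
    not_mem_intReal_of_between hmem (hgt t (h0le.trans h2.le) h3) (hlt t h2 h3)
  -- A minimum on [0, t₀] below m + 1 would be attained in the interior, because H(0) ≥ m + 1 =
  -- H(t₀), and it would be a local minimum with a nonintegral value.
  have hbefore : ∀ t, 0 ≤ t → t ≤ t₀ → m + 1 ≤ H t := by
    have h0ge : m + 1 ≤ H 0 := (intReal_lt_iff hmem h.zero).mp
      (lt_of_le_of_ne (hle 0 le_rfl zero_le_one) (Ne.symm hm0))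
    obtain ⟨w, hw, hwmin⟩ := isCompact_Icc.exists_isMinOn (Set.nonempty_Icc.mpr h0le)
      (h.cont.mono (Set.Icc_subset_Icc le_rfl (h0le1.trans h1le)))
    intro t h2 h3
    refine le_trans ?_ (hwmin (show t ∈ Set.Icc 0 t₀ from ⟨h2, h3⟩))
    by_contra hcon
    have hw0 : 0 < w := lt_of_le_of_ne hw.1 fun e => hcon (e ▸ h0ge)
    have hw1 : w < t₀ := lt_of_le_of_ne hw.2 fun e => hcon (by rw [e, hH0])
    have h4 := h.local_min hw0 hw1 hw0 (hw1.trans_le (h0le1.trans h1le))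
      fun u h5 h6 _ _ => hwmin (show u ∈ Set.Icc 0 t₀ from ⟨h5, h6⟩)
    exact not_mem_intReal_of_between hmem (hgt w hw0.le (hw1.trans h01)) (not_le.mp hcon) h4
  have hdL : ∀ t, t₀ < t → t ≤ t₁ → dL t < 0 := by
    intro t h2 h3
    by_contra hcon
    have ht1 := h3.trans h1le
    have htpos := h0le.trans_lt h2
    obtain ⟨s, hs0, hst, hs⟩ := h.left t htpos ht1
    obtain ⟨u, hu1, hu2⟩ : ∃ u, max t₀ s < u ∧ u < t := exists_between (max_lt h2 hst)
    have hu0 := (le_max_left _ _).trans_lt hu1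
    have hHu : H u ≤ H t := by
      have := hs u ((le_max_right _ _).trans hu1.le) hu2.le
      have := mul_nonneg (sub_nonneg.mpr hu2.le) (not_lt.mp hcon)
      linarith
    rcases h3.eq_or_lt with rfl | h3
    · have := hgt u (h0le.trans hu0.le) hu2
      linarith
    obtain ⟨w, hw, hwmin⟩ := isCompact_Icc.exists_isMinOn (Set.nonempty_Icc.mpr h2.le)
      (h.cont.mono (Set.Icc_subset_Icc h0le ht1))
    have hwmin' : ∀ v, t₀ ≤ v → v ≤ t → H w ≤ H v := fun v h5 h6 =>
      hwmin (show v ∈ Set.Icc t₀ t from ⟨h5, h6⟩)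
    -- With a nonnegative left slope at t, some earlier u has H(u) ≤ H(t). A minimum of H on [t₀, t]
    -- at the endpoint t can thus be replaced by one at u, and t₀ is excluded by its larger value m
    -- + 1.
    obtain ⟨w', hw0, hw1, hw2⟩ : ∃ w', t₀ < w' ∧ w' < t ∧ ∀ v, t₀ ≤ v → v ≤ t → H w' ≤ H v := by
      rcases hw.2.eq_or_lt with e | hw2
      · exact ⟨u, hu0, hu2, fun v h5 h6 => hHu.trans (e ▸ hwmin' v h5 h6)⟩
      · refine ⟨w, lt_of_le_of_ne hw.1 fun e => ?_, hw2, hwmin'⟩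
        have h5 := hwmin' t h2.le le_rfl
        rw [← e, hH0] at h5
        linarith [hlt t h2 h3]
    exact hnot w' hw0 (hw1.trans h3) (h.local_min hw0 hw1 (h0le.trans_lt hw0)
      (hw1.trans_le ht1) fun v h5 h6 _ _ => hw2 v h5 h6)
  refine ⟨h0le, h01, h1le, hmem, hH0, hH1, hle, hbefore,
    fun t h2 h3 => ⟨hgt t (h0le.trans h2.le) h3, hlt t h2 h3⟩, hdL, ?_, ?_, ?_⟩
  · intro t h2 h3
    by_contra hcon
    rcases h2.eq_or_lt with rfl | h2
    · obtain ⟨s, hst, hs1, hs⟩ := h.right t₀ h0le (h3.trans_le h1le)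
      obtain ⟨u, hu1, hu2⟩ : ∃ u, t₀ < u ∧ u < min s t₁ := exists_between (lt_min hst h3)
      have h5 := hs u hu1.le (hu2.le.trans (min_le_left _ _))
      have h6 := mul_nonneg (sub_nonneg.mpr hu1.le) (not_lt.mp hcon)
      have h7 := hlt u hu1 (hu2.trans_le (min_le_right _ _))
      linarith
    · exact hnot t h2 h3 (h.int t (h0le.trans_lt h2) (h3.trans_le h1le) (hdL t h2 h3.le).le
        (not_lt.mp hcon))
  · intro hpos
    exact h.dL_nonpos hpos hpos (h0le1.trans h1le) fun u h5 h6 _ => by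
      rw [hH0]; exact hbefore u h5 h6
  · intro hlt1
    exact h.dR_nonneg hlt1 (h0le.trans h01.le) hlt1 fun u h5 h6 _ => by
      rw [hH1]; exact hle u ((h0le.trans h01.le).trans h5) h6

/-- The interval on which `f_i` acts. -/
structure FInterval (H dL dR : ℝ → ℝ) (m t₀ t₁ : ℝ) : Prop where
  zero_le : 0 ≤ t₀
  lt : t₀ < t₁
  le_one : t₁ ≤ 1
  min_mem : m ∈ intReal
  start_eq : H t₀ = m
  end_eq : H t₁ = m + 1
  min_le : ∀ t, 0 ≤ t → t ≤ 1 → m ≤ H t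
  after : ∀ t, t₁ ≤ t → t ≤ 1 → m + 1 ≤ H t
  inside : ∀ t, t₀ < t → t < t₁ → m < H t ∧ H t < m + 1
  dL_pos : ∀ t, t₀ < t → t ≤ t₁ → 0 < dL t
  dR_pos : ∀ t, t₀ ≤ t → t < t₁ → 0 < dR t
  dL_start : 0 < t₀ → dL t₀ ≤ 0
  dR_end : t₁ < 1 → 0 ≤ dR t₁

/-- The case of e_i for the reversed function, in which t₀ and t₁ become 1 - t₀ and 1 - t₁ and trade
places. -/
theorem fInterval (h : IsHeightFn H dL dR) {m t₀ t₁ : ℝ} (hm : IsLeast (H '' Set.Icc 0 1) m)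
    (hm0 : H 1 ≠ m) (ht₀ : IsGreatest {t | t ∈ Set.Icc 0 1 ∧ H t = m} t₀)
    (ht₁ : IsLeast {t | t ∈ Set.Icc t₀ 1 ∧ H t = m + 1} t₁) : FInterval H dL dR m t₀ t₁ := by
  have key := h.reverse.eInterval (m := m) (t₁ := 1 - t₀) (t₀ := 1 - t₁) ?_ (by simpa using hm0)
    ?_ ?_
  · refine ⟨by linarith [key.le_one], by linarith [key.lt], by linarith [key.zero_le], key.min_mem,
      by simpa using key.end_eq, by simpa using key.start_eq, fun t h1 h2 => ?_, fun t h1 h2 => ?_,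
      fun t h1 h2 => ?_, fun t h1 h2 => ?_, fun t h1 h2 => ?_, fun h1 => ?_, fun h1 => ?_⟩
    · simpa using key.min_le (1 - t) (by linarith) (by linarith)
    · simpa using key.before (1 - t) (by linarith) (by linarith)
    · simpa using key.inside (1 - t) (by linarith) (by linarith)
    · simpa using key.dR_neg (1 - t) (by linarith) (by linarith)
    · simpa using key.dL_neg (1 - t) (by linarith) (by linarith)
    · simpa using key.dR_end (by linarith)
    · simpa using key.dL_start (by linarith)
  · have : (fun t => H (1 - t)) '' Set.Icc 0 1 = H '' Set.Icc 0 1 := by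
      ext y
      constructor
      · rintro ⟨t, ht, rfl⟩
        exact ⟨1 - t, ⟨by linarith [ht.2], by linarith [ht.1]⟩, rfl⟩
      · rintro ⟨t, ht, rfl⟩
        exact ⟨1 - t, ⟨by linarith [ht.2], by linarith [ht.1]⟩, by simp⟩
    rwa [this]
  · refine ⟨⟨⟨by linarith [ht₀.1.1.2], by linarith [ht₀.1.1.1]⟩, by simpa using ht₀.1.2⟩, ?_⟩
    rintro t ⟨⟨h1, h2⟩, h3⟩
    have := ht₀.2 (show 1 - t ∈ _ from ⟨⟨by linarith, by linarith⟩, h3⟩)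
    linarith
  · refine ⟨⟨⟨by linarith [ht₁.1.1.2], by linarith [ht₁.1.1.1]⟩, by simpa using ht₁.1.2⟩, ?_⟩
    rintro t ⟨⟨h1, h2⟩, h3⟩
    have := ht₁.2 (show 1 - t ∈ _ from ⟨⟨by linarith, by linarith⟩, h3⟩)
    linarith

end IsHeightFn

section Paths

variable {ι M N : Type*} [Fintype ι] [AddCommGroup M] [Module ℂ M] [AddCommGroup N] [Module ℂ N]
variable {P : RootPairing ι ℂ M N} {b : P.Base} {θ : ι} {lam : AffDual M}

/-! ## Piecewise linear paths -/

theorem pathFrom_cons_of_le {a a' t : ℝ} {ν : AffDual M} {l : List (AffDual M × ℝ)} (h : t ≤ a') :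
    pathFrom a ((ν, a') :: l) t = ((t - a : ℝ) : ℂ) • ν := by
  rw [pathFrom, if_pos h]

theorem pathFrom_cons_of_lt {a a' t : ℝ} {ν : AffDual M} {l : List (AffDual M × ℝ)} (h : a' < t) :
    pathFrom a ((ν, a') :: l) t = ((a' - a : ℝ) : ℂ) • ν + pathFrom a' l t := by
  rw [pathFrom, if_neg (not_le.mpr h)]

theorem pathFrom_self {a : ℝ} {l : List (AffDual M × ℝ)} (h : ∀ p ∈ l, a ≤ p.2) :
    pathFrom a l a = 0 := by
  cases l with
  | nil => rw [pathFrom]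
  | cons p l =>
    obtain ⟨ν, a'⟩ := p
    rw [pathFrom_cons_of_le (h (ν, a') (by simp))]
    simp

theorem pathFrom_cons_of_ge {a a' t : ℝ} {ν : AffDual M} {l : List (AffDual M × ℝ)}
    (hl : ∀ p ∈ l, a' ≤ p.2) (h : a' ≤ t) :
    pathFrom a ((ν, a') :: l) t = ((a' - a : ℝ) : ℂ) • ν + pathFrom a' l t := by
  rcases h.eq_or_lt with rfl | h
  · rw [pathFrom_cons_of_le le_rfl, pathFrom_self hl, add_zero]
  · exact pathFrom_cons_of_lt h

theorem lt_of_isChain_cons {X : Type*} {p : X × ℝ} {l : List (X × ℝ)}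
    (hl : (p :: l).IsChain fun p p' => p.2 < p'.2) : ∀ p' ∈ l, p.2 < p'.2 := by
  intro p' hp'
  have : IsTrans (X × ℝ) fun p p' => p.2 < p'.2 := ⟨fun _ _ _ => lt_trans⟩
  exact List.rel_of_pairwise_cons (List.isChain_iff_pairwise.mp hl) hp'

theorem pathFrom_sub {l : List (AffDual M × ℝ)} (hl : l.IsChain fun p p' => p.2 < p'.2) {a s t : ℝ}
    (hst : s ≤ t) (hno : ∀ p ∈ l, s < p.2 → t ≤ p.2) {ν : AffDual M}
    (hν : stepL l t = some ν) :
    pathFrom a l t - pathFrom a l s = ((t - s : ℝ) : ℂ) • ν := by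
  induction l generalizing a with
  | nil => simp at hν
  | cons p l ih =>
    obtain ⟨μ, a'⟩ := p
    rcases le_or_gt t a' with h | h
    · have : μ = ν := by
        rw [stepL, stepAt_cons_of_pos (p := (μ, a')) h] at hν
        simpa using hν
      subst this
      rw [pathFrom_cons_of_le h, pathFrom_cons_of_le (hst.trans h), ← sub_smul]
      congr 1
      push_cast
      ring
    · rw [stepL, stepAt_cons_of_neg (p := (μ, a')) (not_le.mpr h)] at hν
      have hs : a' ≤ s := by
        by_contra hs
        exact absurd (hno (μ, a') (by simp) (not_le.mp hs)) (not_le.mpr h)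
      rw [pathFrom_cons_of_lt h,
        pathFrom_cons_of_ge (fun p hp => (lt_of_isChain_cons hl p hp).le) hs, add_sub_add_left_eq_sub]
      exact ih (List.isChain_cons.mp hl).2 (fun p hp => hno p (by simp [hp])) hν

theorem pathMap_zero {l : List (AffDual M × ℝ)} (hl : IsReducedList l) : pathMap l 0 = 0 :=
  pathFrom_self fun p hp => (hl.pos p hp).le

theorem pathMap_sub {l : List (AffDual M × ℝ)} (hl : IsReducedList l) {s t : ℝ}
    (hst : s ≤ t) (hno : ∀ p ∈ l, s < p.2 → t ≤ p.2) {ν : AffDual M}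
    (hν : stepL l t = some ν) :
    pathMap l t - pathMap l s = ((t - s : ℝ) : ℂ) • ν :=
  pathFrom_sub hl.chain_lt hst hno hν

theorem continuous_pathFrom (h : AffCartan N) {l : List (AffDual M × ℝ)}
    (hl : l.IsChain fun p p' => p.2 < p'.2) (a : ℝ) :
    Continuous fun t => (pair P h (pathFrom a l t)).re := by
  induction l generalizing a with
  | nil => simpa [pathFrom] using continuous_const
  | cons p l ih =>
    obtain ⟨ν, a'⟩ := p
    have e : (fun t => (pair P h (pathFrom a ((ν, a') :: l) t)).re) = fun t =>
        if t ≤ a' then (t - a) * (pair P h ν).re else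
          (a' - a) * (pair P h ν).re + (pair P h (pathFrom a' l t)).re := by
      funext t
      split_ifs with ht
      · rw [pathFrom_cons_of_le ht, map_smul, smul_eq_mul, Complex.re_ofReal_mul]
      · rw [pathFrom_cons_of_lt (not_le.mp ht), map_add, map_smul, smul_eq_mul, Complex.add_re,
          Complex.re_ofReal_mul]
    rw [e]
    refine Continuous.if_le (by fun_prop) (continuous_const.add (ih (List.isChain_cons.mp hl).2 a'))
      continuous_id continuous_const fun t ht => ?_
    change t = a' at ht
    subst ht
    rw [pathFrom_self fun p hp => (lt_of_isChain_cons hl p hp).le]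
    simp

/-- A function that does not change between consecutive break points is constant. -/
theorem eq_of_breakpoints {V : Type*} (T : Finset ℝ) {φ : ℝ → V}
    (h : ∀ s t, 0 ≤ s → s ≤ t → t ≤ 1 → (∀ u ∈ T, s < u → t ≤ u) → φ t = φ s) {t : ℝ} (h0 : 0 ≤ t)
    (h1 : t ≤ 1) : φ t = φ 0 := by
  classical
  induction hn : (T.filter fun u => 0 < u ∧ u < t).card using Nat.strong_induction_on
    generalizing t with
  | _ n ih =>
    rcases (T.filter fun u => 0 < u ∧ u < t).eq_empty_or_nonempty with he | hne
    · refine h 0 t le_rfl h0 h1 fun u hu hu0 => ?_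
      by_contra hcon
      have : u ∈ T.filter fun u => 0 < u ∧ u < t := by simp [hu, hu0, not_le.mp hcon]
      rw [he] at this
      simp at this
    · set w := (T.filter fun u => 0 < u ∧ u < t).max' hne with hw
      have hmem := Finset.max'_mem _ hne
      rw [← hw, Finset.mem_filter] at hmem
      rw [h w t hmem.2.1.le hmem.2.2.le h1 fun u hu hwu => ?_]
      · refine ih _ ?_ hmem.2.1.le (hmem.2.2.le.trans h1) rfl
        rw [← hn]
        apply Finset.card_lt_card
        rw [Finset.ssubset_iff_of_subset]
        · exact ⟨w, by simp [hmem.1, hmem.2.1, hmem.2.2], by simp⟩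
        · intro u hu
          rw [Finset.mem_filter] at hu ⊢
          exact ⟨hu.1, hu.2.1, hu.2.2.trans hmem.2.2⟩
      · by_contra hcon
        have : u ∈ T.filter fun u => 0 < u ∧ u < t := by
          simp [hu, not_le.mp hcon, hmem.2.1.trans hwu]
        exact absurd (Finset.le_max' _ _ this) (not_le.mpr hwu)

theorem exists_no_time_left {X : Type*} (l : List (X × ℝ)) {t : ℝ} (ht : 0 < t) :
    ∃ s, 0 ≤ s ∧ s < t ∧ ∀ p ∈ l, s < p.2 → t ≤ p.2 := by
  induction l with
  | nil => exact ⟨0, le_rfl, ht, by simp⟩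
  | cons p l ih =>
    obtain ⟨s, h0, hs, h⟩ := ih
    refine ⟨if p.2 < t then max s p.2 else s, ?_, ?_, ?_⟩
    · split_ifs
      exacts [h0.trans (le_max_left _ _), h0]
    · split_ifs with h'
      exacts [max_lt hs h', hs]
    · intro p' hp' hlt
      have h1 : s < p'.2 := by
        split_ifs at hlt
        exacts [(le_max_left _ _).trans_lt hlt, hlt]
      rcases List.mem_cons.mp hp' with rfl | hp'
      · by_contra hcon
        rw [if_pos (not_le.mp hcon)] at hlt
        exact absurd hlt (not_lt.mpr (le_max_right _ _))
      · exact h p' hp' h1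

theorem exists_no_time_right {X : Type*} (l : List (X × ℝ)) {t : ℝ} (ht : t < 1) :
    ∃ s, t < s ∧ s ≤ 1 ∧ ∀ p ∈ l, t < p.2 → s ≤ p.2 := by
  induction l with
  | nil => exact ⟨1, ht, le_rfl, by simp⟩
  | cons p l ih =>
    obtain ⟨s, hs, h1, h⟩ := ih
    refine ⟨if t < p.2 then min s p.2 else s, ?_, ?_, ?_⟩
    · split_ifs with h'
      exacts [lt_min hs h', hs]
    · split_ifs
      exacts [(min_le_left _ _).trans h1, h1]
    · intro p' hp' hlt
      rcases List.mem_cons.mp hp' with rfl | hp'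
      · rw [if_pos hlt]; exact min_le_right _ _
      · have := h p' hp' hlt
        split_ifs
        exacts [(min_le_left _ _).trans this, this]

variable [P.IsCrystallographic]

/-- The slope `⟨α_i^∨, ν⟩` on the left of the time `t`. -/
def slopeL (b : P.Base) (θ : ι) (l : List (AffDual M × ℝ)) (i : Option b.support) (t : ℝ) : ℝ :=
  ((stepL l t).map fun ν => (evInt P θ (simpleRoot b θ i) ν : ℝ)).getD 0

/-- The slope `⟨α_i^∨, ν⟩` on the right of the time `t`. -/
def slopeR (b : P.Base) (θ : ι) (l : List (AffDual M × ℝ)) (i : Option b.support) (t : ℝ) : ℝ :=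
  ((stepR l t).map fun ν => (evInt P θ (simpleRoot b θ i) ν : ℝ)).getD 0

variable [P.IsRootSystem] [P.IsReduced]

/-- The conditions on an LS path that are used for its height functions: at each time the directed
path between the neighbouring directions changes the direction by the root lattice, and turning
upwards is possible at integral heights only. -/
structure IsIntegralPath (b : P.Base) (θ : ι) (lam : AffDual M) (l : List (AffDual M × ℝ)) :
    Prop where
  reduced : IsReducedList l
  mem_orbit : ∀ p ∈ l, p.1 ∈ orbit b θ lam
  sub_mem : ∀ t, ∀ μ ∈ stepR l t, ∀ ν ∈ stepL l t, (t : ℂ) • (ν - μ) ∈ affRootLattice P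
  turn : ∀ t, ∀ μ ∈ stepR l t, ∀ ν ∈ stepL l t, ∀ i, 0 ≤ simpleEv b θ i μ → simpleEv b θ i ν ≤ 0 →
    t * simpleEv b θ i μ ∈ intReal

namespace IsIntegralPath

variable {l : List (AffDual M × ℝ)} {i : Option b.support}

theorem stepAt_mem_orbit (h : IsIntegralPath b θ lam l) {q : ℝ → Prop} {ν : AffDual M}
    (hν : stepAt q l = some ν) : ν ∈ orbit b θ lam := by
  obtain ⟨p, hp, -, rfl⟩ := exists_of_stepAt hν
  exact h.mem_orbit p hp

theorem slopeL_eq {t : ℝ} {ν : AffDual M} (hν : stepL l t = some ν) :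
    slopeL b θ l i t = simpleEv b θ i ν := by
  simp [slopeL, hν]

theorem slopeR_eq {t : ℝ} {ν : AffDual M} (hν : stepR l t = some ν) :
    slopeR b θ l i t = simpleEv b θ i ν := by
  simp [slopeR, hν]

theorem height_sub (h : IsIntegralPath b θ lam l) (hlam : IsLevelZeroDominant b θ lam) {s t : ℝ}
    (hst : s ≤ t) (ht : t ≤ 1) (hno : ∀ p ∈ l, s < p.2 → t ≤ p.2) :
    height b θ l i t - height b θ l i s = (t - s) * slopeL b θ l i t := by
  obtain ⟨ν, hν⟩ := h.reduced.exists_stepL ht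
  have h1 := pathMap_sub h.reduced hst hno hν
  have h2 := congrArg (fun μ => (pair P (realCoroot P θ (simpleRoot b θ i)) μ).re) h1
  simp only [map_sub, Complex.sub_re, map_smul, smul_eq_mul, Complex.re_ofReal_mul] at h2
  rw [slopeL_eq hν, height, height, h2, pair_orbit hlam (h.stepAt_mem_orbit hν), Complex.intCast_re]

theorem height_zero (h : IsIntegralPath b θ lam l) : height b θ l i 0 = 0 := by
  rw [height, pathMap_zero h.reduced, map_zero, Complex.zero_re]

/-- The value of the path at `t` is congruent to `t ν`, where `ν` is the direction at `t`. -/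
theorem pathMap_sub_smul_mem (h : IsIntegralPath b θ lam l) {t : ℝ} {ν : AffDual M}
    (hν : stepL l t = some ν) : pathMap l t - (t : ℂ) • ν ∈ affRootLattice P := by
  -- Summation by parts: π(t) - tν is the sum of a_u(ν_u - ν_{u+1}) over the breaks before t. The
  -- term a · p.1 accounts for a list that starts at time a.
  have key : ∀ (l : List (AffDual M × ℝ)) (p : AffDual M × ℝ) (a : ℝ),
      (p :: l).IsChain (fun p p' => p.2 < p'.2) →
      (p :: l).IsChain (fun p p' => (p.2 : ℂ) • (p.1 - p'.1) ∈ affRootLattice P) →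
      stepL (p :: l) t = some ν →
      pathFrom a (p :: l) t - (t : ℂ) • ν + (a : ℂ) • p.1 ∈ affRootLattice P := by
    intro l
    induction l with
    | nil =>
      intro p a hc hs hν
      obtain ⟨μ, a'⟩ := p
      have ht : t ≤ a' := by
        by_contra ht
        rw [stepL, stepAt_cons_of_neg (p := (μ, a')) ht] at hν
        simp at hν
      rw [stepL, stepAt_cons_of_pos (p := (μ, a')) ht] at hν
      have : μ = ν := by simpa using hν
      subst this
      rw [pathFrom_cons_of_le ht]
      convert zero_mem (affRootLattice P) using 1
      push_cast
      module
    | cons p' l ih =>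
      intro p a hc hs hν
      obtain ⟨μ, a'⟩ := p
      rcases le_or_gt t a' with ht | ht
      · rw [stepL, stepAt_cons_of_pos (p := (μ, a')) ht] at hν
        have : μ = ν := by simpa using hν
        subst this
        rw [pathFrom_cons_of_le ht]
        convert zero_mem (affRootLattice P) using 1
        push_cast
        module
      · rw [stepL, stepAt_cons_of_neg (p := (μ, a')) (not_le.mpr ht)] at hν
        rw [List.isChain_cons] at hc hs
        have h1 := ih p' a' hc.2 hs.2 hν
        have h2 := hs.1 p' (by simp)
        rw [pathFrom_cons_of_lt ht]
        convert add_mem h1 h2 using 1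
        push_cast
        module
  have hs : l.IsChain (fun p p' => (p.2 : ℂ) • (p.1 - p'.1) ∈ affRootLattice P) :=
    (isChain_iff_step (S := fun t μ ν => (t : ℂ) • (ν - μ) ∈ affRootLattice P)
      (fun t x => by simp [zero_mem]) h.reduced.chain_lt).mpr h.sub_mem
  cases l with
  | nil => simp at hν
  | cons p l => rw [pathMap]; simpa using key l p 0 h.reduced.chain_lt hs hν

theorem height_sub_mul_mem (h : IsIntegralPath b θ lam l) (hlam : IsLevelZeroDominant b θ lam)
    {t : ℝ} {ν : AffDual M} (hν : stepL l t = some ν) :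
    height b θ l i t - t * simpleEv b θ i ν ∈ intReal := by
  obtain ⟨n, hn⟩ := pair_affRootLattice (θ := θ) (simpleRoot b θ i) (h.pathMap_sub_smul_mem hν)
  refine ⟨n, ?_⟩
  have := congrArg Complex.re hn
  simp only [map_sub, map_smul, pair_orbit hlam (h.stepAt_mem_orbit hν), Complex.sub_re,
    smul_eq_mul, Complex.re_ofReal_mul, Complex.intCast_re] at this
  rw [height, this]; rfl

theorem height_sub_mul_mem' (h : IsIntegralPath b θ lam l) (hlam : IsLevelZeroDominant b θ lam)
    {t : ℝ} {ν : AffDual M} (ht : t < 1) (hν : stepR l t = some ν) :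
    height b θ l i t - t * simpleEv b θ i ν ∈ intReal := by
  obtain ⟨μ, hμ⟩ := h.reduced.exists_stepL ht.le
  have h1 := h.height_sub_mul_mem (i := i) hlam hμ
  have h2 := sub_mem_intReal hlam (h.stepAt_mem_orbit hν) (h.stepAt_mem_orbit hμ)
    (h.sub_mem t ν hν μ hμ) i
  have := add_mem h1 h2
  convert this using 1
  ring

/-- Modulo ℤ, H(t) equals t⟨α_i^∨, ν⟩ for either adjacent direction ν. The `turn` condition makes
this integral wherever the slope passes from nonpositive to nonnegative, and t = 1 is immediate as
⟨α_i^∨, ν⟩ is an integer. -/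
theorem isHeightFn (h : IsIntegralPath b θ lam l) (hlam : IsLevelZeroDominant b θ lam) :
    IsHeightFn (height b θ l i) (slopeL b θ l i) (slopeR b θ l i) := by
  refine ⟨?_, fun t h0 h1 => ?_, fun t h0 h1 => ?_, fun t h0 h1 hL hR => ?_, ?_, ?_⟩
  · exact (continuous_pathFrom _ h.reduced.chain_lt 0).continuousOn
  · obtain ⟨s, hs0, hst, hs⟩ := exists_no_time_left l h0
    exact ⟨s, hs0, hst, fun u hu hut => h.height_sub hlam hut h1
      fun p hp hup => hs p hp (hu.trans_lt hup)⟩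
  · obtain ⟨s, hts, hs1, hs⟩ := exists_no_time_right l h1
    refine ⟨s, hts, hs1, fun u htu hus => ?_⟩
    rw [h.height_sub hlam htu (hus.trans hs1) fun p hp hup => hus.trans (hs p hp hup)]
    rcases htu.eq_or_lt with rfl | htu
    · simp
    · have : stepL l u = stepR l t :=
        stepAt_congr fun p hp => ⟨fun hup => htu.trans_le hup, fun htp => hus.trans (hs p hp htp)⟩
      rw [slopeL, slopeR, this]
  · obtain ⟨μ, hμ⟩ := h.reduced.exists_stepR h1
    obtain ⟨ν, hν⟩ := h.reduced.exists_stepL h1.le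
    rw [slopeL_eq hν] at hL
    rw [slopeR_eq hμ] at hR
    have h3 := h.turn t μ hμ ν hν i (by exact_mod_cast hR) (by exact_mod_cast hL)
    have := add_mem (h.height_sub_mul_mem' (i := i) hlam h1 hμ) h3
    rwa [sub_add_cancel] at this
  · rw [h.height_zero]; exact zero_mem _
  · obtain ⟨ν, hν⟩ := h.reduced.exists_stepL le_rfl
    have := add_mem (h.height_sub_mul_mem (i := i) hlam hν)
      (intCast_mem_intReal (simpleEv b θ i ν))
    rwa [one_mul, sub_add_cancel] at this

end IsIntegralPath

end Paths

section ReflectedPaths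

variable {ι M N : Type*} [Fintype ι] [AddCommGroup M] [Module ℂ M] [AddCommGroup N] [Module ℂ N]
variable {P : RootPairing ι ℂ M N} {b : P.Base} {θ : ι} {lam : AffDual M}
variable [P.IsCrystallographic] [P.IsRootSystem] [P.IsReduced]

/-! ## The interval of a root operator, and the reflected path -/

namespace IsIntegralPath

variable {l l' : List (AffDual M × ℝ)} {i : Option b.support} {t₀ t₁ : ℝ}

theorem isLeast_minHeight (h : IsIntegralPath b θ lam l) (hlam : IsLevelZeroDominant b θ lam) :
    IsLeast (height b θ l i '' Set.Icc 0 1) (minHeight b θ l i) :=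
  (h.isHeightFn hlam).exists_isLeast

theorem minHeight_nonpos (h : IsIntegralPath b θ lam l) (hlam : IsLevelZeroDominant b θ lam) :
    minHeight b θ l i ≤ 0 := by
  rw [← h.height_zero (i := i)]
  exact (h.isLeast_minHeight hlam).2 ⟨0, ⟨le_rfl, zero_le_one⟩, rfl⟩

theorem eInterval (h : IsIntegralPath b θ lam l) (hlam : IsLevelZeroDominant b θ lam)
    (hm : minHeight b θ l i ≠ 0) :
    IsHeightFn.EInterval (height b θ l i) (slopeL b θ l i) (slopeR b θ l i) (minHeight b θ l i)
      (eStart b θ l i) (eEnd b θ l i) := by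
  have hf := h.isHeightFn (i := i) hlam
  have hleast := h.isLeast_minHeight (i := i) hlam
  have hend : IsLeast {t | t ∈ Set.Icc 0 1 ∧ height b θ l i t = minHeight b θ l i}
      (eEnd b θ l i) := by
    refine (hf.isCompact_level le_rfl le_rfl _).isLeast_sInf ?_
    obtain ⟨t, ht, ht'⟩ := hleast.1
    exact ⟨t, ht, ht'⟩
  refine hf.eInterval hleast (by rw [h.height_zero]; exact hm.symm) hend ?_
  refine (hf.isCompact_level le_rfl hend.1.1.2 _).isGreatest_sSup ?_
  have hcont : ContinuousOn (height b θ l i) (Set.Icc 0 (eEnd b θ l i)) :=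
    hf.cont.mono (Set.Icc_subset_Icc le_rfl hend.1.1.2)
  obtain ⟨u, hu, hu'⟩ := intermediate_value_Icc' hend.1.1.1 hcont
    (show minHeight b θ l i + 1 ∈ Set.Icc (height b θ l i (eEnd b θ l i)) (height b θ l i 0) from
      ⟨by rw [hend.1.2]; linarith, by
        rw [h.height_zero]
        exact (intReal_lt_iff (hf.min_mem hleast) (zero_mem _)).mp
          (lt_of_le_of_ne (h.minHeight_nonpos hlam) hm)⟩)
  exact ⟨u, hu, hu'⟩

theorem fInterval (h : IsIntegralPath b θ lam l) (hlam : IsLevelZeroDominant b θ lam)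
    (hm : height b θ l i 1 - minHeight b θ l i ≠ 0) :
    IsHeightFn.FInterval (height b θ l i) (slopeL b θ l i) (slopeR b θ l i) (minHeight b θ l i)
      (fStart b θ l i) (fEnd b θ l i) := by
  have hf := h.isHeightFn (i := i) hlam
  have hleast := h.isLeast_minHeight (i := i) hlam
  have hstart : IsGreatest {t | t ∈ Set.Icc 0 1 ∧ height b θ l i t = minHeight b θ l i}
      (fStart b θ l i) := by
    refine (hf.isCompact_level le_rfl le_rfl _).isGreatest_sSup ?_
    obtain ⟨t, ht, ht'⟩ := hleast.1
    exact ⟨t, ht, ht'⟩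
  have hne : height b θ l i 1 ≠ minHeight b θ l i := sub_ne_zero.mp hm
  refine hf.fInterval hleast hne hstart ?_
  refine (hf.isCompact_level hstart.1.1.1 le_rfl _).isLeast_sInf ?_
  have hcont : ContinuousOn (height b θ l i) (Set.Icc (fStart b θ l i) 1) :=
    hf.cont.mono (Set.Icc_subset_Icc hstart.1.1.1 le_rfl)
  obtain ⟨u, hu, hu'⟩ := intermediate_value_Icc hstart.1.1.2 hcont
    (show minHeight b θ l i + 1 ∈ Set.Icc (height b θ l i (fStart b θ l i)) (height b θ l i 1) from
      ⟨by rw [hstart.1.2]; linarith, (intReal_lt_iff (hf.min_mem hleast) hf.one).mp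
          (lt_of_le_of_ne (hleast.2 ⟨1, ⟨zero_le_one, le_rfl⟩, rfl⟩) hne.symm)⟩)
  exact ⟨u, hu, hu'⟩

/-- Reflecting a direction ν subtracts ⟨α_i^∨, ν⟩α_i, which integrates to the increase of H times
α_i. The nested max and min clamp t to [t₀, t₁], so one formula serves on all of [0, 1]. -/
theorem pathMap_reflect (h : IsIntegralPath b θ lam l) (hlam : IsLevelZeroDominant b θ lam)
    (hr : IsReflection (fun ν => simpleRefl b θ i ν) t₀ t₁ l l') (h0 : 0 ≤ t₀)
    {t : ℝ} (ht : 0 ≤ t) (ht' : t ≤ 1) :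
    pathMap l' t = pathMap l t - ((height b θ l i (max t₀ (min t t₁)) - height b θ l i t₀ : ℝ) : ℂ) •
      realRoot P (simpleRoot b θ i) := by
  classical
  -- The difference of the two sides is shown to be constant between consecutive breaks of both
  -- lists, with t₀ and t₁ added as break points.
  have key := eq_of_breakpoints (insert t₀ (insert t₁ ((l.map Prod.snd).toFinset ∪
      (l'.map Prod.snd).toFinset))) (φ := fun t => pathMap l' t - pathMap l t +
      ((height b θ l i (max t₀ (min t t₁)) - height b θ l i t₀ : ℝ) : ℂ) •
      realRoot P (simpleRoot b θ i)) ?_ ht ht'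
  · simp only [pathMap_zero h.reduced, pathMap_zero hr.reduced,
      max_eq_left ((min_le_left 0 t₁).trans h0), sub_self, Complex.ofReal_zero, zero_smul,
      add_zero] at key
    rw [sub_add] at key
    exact sub_eq_zero.mp key
  · intro s t hs hst ht1 hno
    rcases hst.eq_or_lt with rfl | hst'
    · rfl
    have hpos := hs.trans_lt hst'
    have hl : ∀ p ∈ l, s < p.2 → t ≤ p.2 := fun p hp => hno p.2 (by
      simp only [Finset.mem_insert, Finset.mem_union, List.mem_toFinset, List.mem_map]
      exact .inr (.inr (.inl ⟨p, hp, rfl⟩)))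
    have hl' : ∀ p ∈ l', s < p.2 → t ≤ p.2 := fun p hp => hno p.2 (by
      simp only [Finset.mem_insert, Finset.mem_union, List.mem_toFinset, List.mem_map]
      exact .inr (.inr (.inr ⟨p, hp, rfl⟩)))
    have ht0 := hno t₀ (by simp)
    have ht1' := hno t₁ (by simp)
    obtain ⟨ν, hν⟩ := h.reduced.exists_stepL ht1
    have h2 := pathMap_sub h.reduced hst hl hν
    by_cases hc0 : t ≤ t₀
    · have h3 := pathMap_sub hr.reduced hst hl' ((hr.stepL_of_le hpos hc0).trans hν)
      rw [max_eq_left ((min_le_left t t₁).trans hc0),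
        max_eq_left ((min_le_left s t₁).trans (hst.trans hc0))]
      rw [sub_eq_iff_eq_add.mp h2, sub_eq_iff_eq_add.mp h3]
      module
    have hs0 : t₀ ≤ s := by
      by_contra hcon
      exact hc0 (ht0 (not_le.mp hcon))
    by_cases hc1 : t ≤ t₁
    · have h3 := pathMap_sub hr.reduced hst hl'
        ((hr.stepL_of_mem hpos (not_le.mp hc0) hc1).trans (by rw [hν]; rfl))
      have h4 := h.height_sub (i := i) hlam hst ht1 hl
      rw [slopeL_eq hν] at h4
      rw [min_eq_left hc1, min_eq_left (hst.trans hc1), max_eq_right (not_le.mp hc0).le,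
        max_eq_right hs0]
      have h5 : simpleRefl b θ i ν = ν - (simpleEv b θ i ν : ℂ) • realRoot P (simpleRoot b θ i) := by
        rw [simpleRefl, realRefl_apply, pair_orbit hlam (h.stepAt_mem_orbit hν)]
      simp only [h5] at h3
      have h6 : height b θ l i t = height b θ l i s + (t - s) * simpleEv b θ i ν := by linarith
      rw [h6, sub_eq_iff_eq_add.mp h2, sub_eq_iff_eq_add.mp h3]
      push_cast
      module
    · have hs1 : t₁ ≤ s := by
        by_contra hcon
        exact hc1 (ht1' (not_le.mp hcon))
      have h3 := pathMap_sub hr.reduced hst hl' ((hr.stepL_of_lt hpos (not_le.mp hc1)).trans hν)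
      rw [min_eq_right (not_le.mp hc1).le, min_eq_right hs1]
      rw [sub_eq_iff_eq_add.mp h2, sub_eq_iff_eq_add.mp h3]
      module

theorem height_reflect (h : IsIntegralPath b θ lam l) (hlam : IsLevelZeroDominant b θ lam)
    (hr : IsReflection (fun ν => simpleRefl b θ i ν) t₀ t₁ l l') (h0 : 0 ≤ t₀)
    {t : ℝ} (ht : 0 ≤ t) (ht' : t ≤ 1) :
    height b θ l' i t = height b θ l i t -
      2 * (height b θ l i (max t₀ (min t t₁)) - height b θ l i t₀) := by
  have h1 := congrArg (fun μ => (pair P (realCoroot P θ (simpleRoot b θ i)) μ).re)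
    (h.pathMap_reflect hlam hr h0 ht ht')
  simp only [map_sub, map_smul, pair_realCoroot_realRoot, smul_eq_mul, Complex.sub_re,
    Complex.re_ofReal_mul, Complex.re_ofNat] at h1
  rw [height, h1, ← height]
  ring

/-- The path obtained by applying `e_i`. -/
theorem reflect_e (h : IsIntegralPath b θ lam l) (hlam : IsLevelZeroDominant b θ lam)
    (hm : minHeight b θ l i ≠ 0)
    (hr : IsReflection (fun ν => simpleRefl b θ i ν) (eStart b θ l i) (eEnd b θ l i) l l') :
    minHeight b θ l' i = minHeight b θ l i + 1 ∧ height b θ l' i 1 = height b θ l i 1 + 2 ∧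
      fStart b θ l' i = eStart b θ l i ∧ fEnd b θ l' i = eEnd b θ l i ∧
      pathMap l' 1 = pathMap l 1 + realRoot P (simpleRoot b θ i) := by
  have hI := h.eInterval hlam hm
  set m := minHeight b θ l i
  set t₀ := eStart b θ l i
  set t₁ := eEnd b θ l i
  have hH := fun t ht ht' => h.height_reflect (t := t) hlam hr hI.zero_le ht ht'
  -- The new height is the old one up to t₀, its mirror image in the level m + 1 on [t₀, t₁], and
  -- the old one raised by 2 afterwards.
  have hA : ∀ t, 0 ≤ t → t ≤ t₀ → height b θ l' i t = height b θ l i t := by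
    intro t ht ht'
    rw [hH t ht (ht'.trans (hI.lt.le.trans hI.le_one)), max_eq_left ((min_le_left _ _).trans ht')]
    ring
  have hB : ∀ t, t₀ ≤ t → t ≤ t₁ → height b θ l' i t = 2 * (m + 1) - height b θ l i t := by
    intro t ht ht'
    rw [hH t (hI.zero_le.trans ht) (ht'.trans hI.le_one), min_eq_left ht', max_eq_right ht, hI.start_eq]
    ring
  have hC : ∀ t, t₁ ≤ t → t ≤ 1 → height b θ l' i t = height b θ l i t + 2 := by
    intro t ht ht'
    rw [hH t (hI.zero_le.trans (hI.lt.le.trans ht)) ht', min_eq_right ht, max_eq_right hI.lt.le,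
      hI.start_eq, hI.end_eq]
    ring
  have hB' : ∀ t, t₀ < t → t < t₁ → m + 1 < height b θ l' i t ∧ height b θ l' i t < m + 2 := by
    intro t ht ht'
    have := hI.inside t ht ht'
    rw [hB t ht.le ht'.le]
    constructor <;> linarith
  have hC' : ∀ t, t₁ ≤ t → t ≤ 1 → m + 2 ≤ height b θ l' i t := by
    intro t ht ht'
    have := hI.min_le t (hI.zero_le.trans (hI.lt.le.trans ht)) ht'
    rw [hC t ht ht']
    linarith
  have hs : height b θ l' i t₀ = m + 1 := by rw [hA t₀ hI.zero_le le_rfl, hI.start_eq]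
  have he : height b θ l' i t₁ = m + 2 := by rw [hC t₁ le_rfl hI.le_one, hI.end_eq]
  have hmin : minHeight b θ l' i = m + 1 := by
    refine IsLeast.csInf_eq ⟨⟨t₀, ⟨hI.zero_le, hI.lt.le.trans hI.le_one⟩, hs⟩, ?_⟩
    rintro _ ⟨t, ⟨ht, ht'⟩, rfl⟩
    by_cases h1 : t ≤ t₀
    · rw [hA t ht h1]; exact hI.before t ht h1
    by_cases h2 : t < t₁
    · exact (hB' t (not_le.mp h1) h2).1.le
    · have := hC' t (not_lt.mp h2) ht'
      linarith
  have hstart : fStart b θ l' i = t₀ := by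
    refine IsGreatest.csSup_eq ⟨⟨⟨hI.zero_le, hI.lt.le.trans hI.le_one⟩, by rw [hs, hmin]⟩, ?_⟩
    rintro t ⟨⟨ht, ht'⟩, h3⟩
    rw [hmin] at h3
    by_contra h1
    by_cases h2 : t < t₁
    · have := (hB' t (not_le.mp h1) h2).1
      linarith
    · have := hC' t (not_lt.mp h2) ht'
      linarith
  refine ⟨hmin, hC 1 hI.le_one le_rfl, hstart, ?_, ?_⟩
  · rw [fEnd, hstart, hmin]
    refine IsLeast.csInf_eq ⟨⟨⟨hI.lt.le, hI.le_one⟩, by rw [he]; ring⟩, ?_⟩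
    rintro t ⟨⟨ht, ht'⟩, h3⟩
    by_contra h2
    rcases ht.eq_or_lt with rfl | ht
    · rw [hs] at h3; linarith
    · have := (hB' t ht (not_le.mp h2)).2
      linarith
  · rw [h.pathMap_reflect hlam hr hI.zero_le zero_le_one le_rfl, min_eq_right hI.le_one,
      max_eq_right hI.lt.le, hI.start_eq, hI.end_eq]
    push_cast
    module

/-- The path obtained by applying `f_i`. -/
theorem reflect_f (h : IsIntegralPath b θ lam l) (hlam : IsLevelZeroDominant b θ lam)
    (hm : height b θ l i 1 - minHeight b θ l i ≠ 0)
    (hr : IsReflection (fun ν => simpleRefl b θ i ν) (fStart b θ l i) (fEnd b θ l i) l l') :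
    minHeight b θ l' i = minHeight b θ l i - 1 ∧ height b θ l' i 1 = height b θ l i 1 - 2 ∧
      eStart b θ l' i = fStart b θ l i ∧ eEnd b θ l' i = fEnd b θ l i ∧
      pathMap l' 1 = pathMap l 1 - realRoot P (simpleRoot b θ i) := by
  have hI := h.fInterval hlam hm
  set m := minHeight b θ l i
  set t₀ := fStart b θ l i
  set t₁ := fEnd b θ l i
  have hH := fun t ht ht' => h.height_reflect (t := t) hlam hr hI.zero_le ht ht'
  -- The new height is the old one up to t₀, its mirror image in the level m on [t₀, t₁], and the
  -- old one lowered by 2 afterwards.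
  have hA : ∀ t, 0 ≤ t → t ≤ t₀ → height b θ l' i t = height b θ l i t := by
    intro t ht ht'
    rw [hH t ht (ht'.trans (hI.lt.le.trans hI.le_one)), max_eq_left ((min_le_left _ _).trans ht')]
    ring
  have hB : ∀ t, t₀ ≤ t → t ≤ t₁ → height b θ l' i t = 2 * m - height b θ l i t := by
    intro t ht ht'
    rw [hH t (hI.zero_le.trans ht) (ht'.trans hI.le_one), min_eq_left ht', max_eq_right ht, hI.start_eq]
    ring
  have hC : ∀ t, t₁ ≤ t → t ≤ 1 → height b θ l' i t = height b θ l i t - 2 := by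
    intro t ht ht'
    rw [hH t (hI.zero_le.trans (hI.lt.le.trans ht)) ht', min_eq_right ht, max_eq_right hI.lt.le,
      hI.start_eq, hI.end_eq]
    ring
  have hA' : ∀ t, 0 ≤ t → t ≤ t₀ → m ≤ height b θ l' i t := by
    intro t ht ht'
    rw [hA t ht ht']
    exact hI.min_le t ht (ht'.trans (hI.lt.le.trans hI.le_one))
  have hB' : ∀ t, t₀ < t → t < t₁ → m - 1 < height b θ l' i t ∧ height b θ l' i t < m := by
    intro t ht ht'
    have := hI.inside t ht ht'
    rw [hB t ht.le ht'.le]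
    constructor <;> linarith
  have hs : height b θ l' i t₀ = m := by rw [hA t₀ hI.zero_le le_rfl, hI.start_eq]
  have he : height b θ l' i t₁ = m - 1 := by rw [hC t₁ le_rfl hI.le_one, hI.end_eq]; ring
  have h1pos := hI.zero_le.trans hI.lt.le
  have hmin : minHeight b θ l' i = m - 1 := by
    refine IsLeast.csInf_eq ⟨⟨t₁, ⟨h1pos, hI.le_one⟩, he⟩, ?_⟩
    rintro _ ⟨t, ⟨ht, ht'⟩, rfl⟩
    by_cases h1 : t ≤ t₀
    · have := hA' t ht h1
      linarith
    by_cases h2 : t < t₁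
    · exact (hB' t (not_le.mp h1) h2).1.le
    · have := hI.after t (not_lt.mp h2) ht'
      rw [hC t (not_lt.mp h2) ht']
      linarith
  have hend : eEnd b θ l' i = t₁ := by
    refine IsLeast.csInf_eq ⟨⟨⟨h1pos, hI.le_one⟩, by rw [he, hmin]⟩, ?_⟩
    rintro t ⟨⟨ht, ht'⟩, h3⟩
    rw [hmin] at h3
    by_contra h2
    by_cases h1 : t ≤ t₀
    · have := hA' t ht h1
      linarith
    · have := (hB' t (not_le.mp h1) (not_le.mp h2)).1
      linarith
  refine ⟨hmin, hC 1 hI.le_one le_rfl, ?_, hend, ?_⟩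
  · rw [eStart, hend, hmin]
    refine IsGreatest.csSup_eq ⟨⟨⟨hI.zero_le, hI.lt.le⟩, by rw [hs]; ring⟩, ?_⟩
    rintro t ⟨⟨ht, ht'⟩, h3⟩
    by_contra h2
    rcases ht'.eq_or_lt with rfl | ht'
    · rw [he] at h3; linarith
    · have := (hB' t (not_le.mp h2) ht').2
      linarith
  · rw [h.pathMap_reflect hlam hr hI.zero_le zero_le_one le_rfl, min_eq_right hI.le_one,
      max_eq_right hI.lt.le, hI.start_eq, hI.end_eq]
    push_cast
    module

end IsIntegralPath

end ReflectedPaths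

section Stability

variable {ι M N : Type*} [Fintype ι] [AddCommGroup M] [Module ℂ M] [AddCommGroup N] [Module ℂ N]
variable {P : RootPairing ι ℂ M N} {b : P.Base} {θ : ι} {lam : AffDual M}
variable [P.IsCrystallographic] [P.IsRootSystem] [P.IsReduced]

/-! ## Stability of the set of semi-infinite LS paths -/

/-- A directed path in the a-subgraph already yields the weak order, so beyond distinctness of
neighbours nothing has to be said about the order, and the path condition can be read off the step
function. -/
theorem siLSPaths_iff {η : List ((AffDual M ≃ₗ[ℂ] AffDual M) × ℝ)} :
    η ∈ siLSPaths b θ lam ↔ IsReducedList η ∧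
      (∀ p ∈ η, p.1 ∈ cosetReps b θ (stabIndex b θ lam) ∧ ∃ q : ℚ, p.2 = q) ∧
      ∀ t, ∀ x ∈ stepR η t, ∀ y ∈ stepL η t, SiPath b θ lam t x y := by
  constructor
  · rintro ⟨h1, h2, h3⟩
    have hred : IsReducedList η :=
      ⟨h3.imp fun _ _ h => ⟨h.1, h.2.1.2⟩, fun p hp => (h1 p hp).2.1, h2⟩
    refine ⟨hred, fun p hp => ⟨(h1 p hp).1, (h1 p hp).2.2⟩, ?_⟩
    exact (isChain_iff_step (S := fun t x y => SiPath b θ lam t x y)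
      (fun t x => Relation.ReflTransGen.refl) hred.chain_lt).mp (h3.imp fun _ _ h => h.2.2)
  · rintro ⟨hred, h1, h2⟩
    refine ⟨fun p hp => ⟨(h1 p hp).1, hred.pos p hp, (h1 p hp).2⟩, hred.last, ?_⟩
    have h3 := (isChain_iff_step (S := fun t x y => x ∈ cosetReps b θ (stabIndex b θ lam) →
      SiPath b θ lam t x y) (fun t x _ => Relation.ReflTransGen.refl) hred.chain_lt).mpr
      (fun t x hx y hy _ => h2 t x hx y hy)
    have h4 : η.IsChain fun p p' => p'.1 ∈ cosetReps b θ (stabIndex b θ lam) := by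
      rw [List.isChain_iff_getElem]
      exact fun i hi => (h1 _ (List.getElem_mem _)).1
    rw [List.isChain_iff_getElem] at h3 h4 ⊢
    have h5 := hred.chain
    rw [List.isChain_iff_getElem] at h5
    intro i hi
    have hpath := h3 i hi (h4 i hi)
    exact ⟨(h5 i hi).1, ⟨hpath.siLE (h4 i hi), (h5 i hi).2⟩, hpath⟩

variable {η η' : List ((AffDual M ≃ₗ[ℂ] AffDual M) × ℝ)} {i : Option b.support}

theorem stepAt_proj (q : ℝ → Prop) (lam : AffDual M)
    (η : List ((AffDual M ≃ₗ[ℂ] AffDual M) × ℝ)) :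
    stepAt q (proj lam η) = (stepAt q η).map fun x => x lam :=
  stepAt_map q (fun x : AffDual M ≃ₗ[ℂ] AffDual M => x lam) η

theorem stepAt_proj_of_some {q : ℝ → Prop} {x : AffDual M ≃ₗ[ℂ] AffDual M}
    (hx : stepAt q η = some x) : stepAt q (proj lam η) = some (x lam) := by
  rw [stepAt_proj, hx]; rfl

theorem stepAt_mem_cosetReps (hη : η ∈ siLSPaths b θ lam) {q : ℝ → Prop}
    {x : AffDual M ≃ₗ[ℂ] AffDual M} (hx : stepAt q η = some x) :
    x ∈ cosetReps b θ (stabIndex b θ lam) := by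
  obtain ⟨p, hp, -, rfl⟩ := exists_of_stepAt hx
  exact (hη.1 p hp).1

theorem proj_mem_LSPaths (hθ : IsHighestRoot b θ) (hlam : IsLevelZeroDominant b θ lam)
    (hη : η ∈ siLSPaths b θ lam) : proj lam η ∈ LSPaths b θ lam := by
  obtain ⟨h1, ⟨p, hp, hp1⟩, h3⟩ := hη
  refine ⟨fun p hp => ?_, ⟨(p.1 lam, p.2), ?_, hp1⟩, ?_⟩
  · obtain ⟨p', hp', rfl⟩ := List.mem_map.mp hp
    exact ⟨mem_orbit (h1 p' hp').1.1, (h1 p' hp').2⟩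
  · rw [proj, List.getLast?_map, hp]; rfl
  · rw [proj, List.isChain_map]
    exact h3.imp fun _ _ h => ⟨h.1, h.2.1.1.wtLT hθ hlam h.2.1.2, h.2.2.wtPath hθ hlam⟩

theorem isReducedList_of_mem_LSPaths {π : List (AffDual M × ℝ)} (hπ : π ∈ LSPaths b θ lam) :
    IsReducedList π :=
  ⟨hπ.2.2.imp fun _ _ h => ⟨h.1, h.2.1.2⟩, fun p hp => (hπ.1 p hp).2.1, hπ.2.1⟩

/-- The `turn` condition is `SiPath.ev_mem` and the lattice condition is `SiPath.smul_sub_mem`,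
applied to the directed path at each break. -/
theorem isIntegralPath_proj (hθ : IsHighestRoot b θ) (hlam : IsLevelZeroDominant b θ lam)
    (hη : η ∈ siLSPaths b θ lam) : IsIntegralPath b θ lam (proj lam η) := by
  have hpr := proj_mem_LSPaths hθ hlam hη
  have hpath := (siLSPaths_iff.mp hη).2.2
  have hlift : ∀ {q : ℝ → Prop} {μ : AffDual M}, μ ∈ stepAt q (proj lam η) →
      ∃ x, x ∈ stepAt q η ∧ x lam = μ := by
    intro q μ hμ
    rw [stepAt_proj] at hμ
    exact Option.map_eq_some_iff.mp hμ
  refine ⟨isReducedList_of_mem_LSPaths hpr, fun p hp => (hpr.1 p hp).1, ?_, ?_⟩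
  · intro t μ hμ ν hν
    obtain ⟨x, hx, rfl⟩ := hlift hμ
    obtain ⟨y, hy, rfl⟩ := hlift hν
    exact (hpath t x hx y hy).smul_sub_mem hθ hlam
  · intro t μ hμ ν hν i h1 h2
    obtain ⟨x, hx, rfl⟩ := hlift hμ
    obtain ⟨y, hy, rfl⟩ := hlift hν
    exact (hpath t x hx y hy).ev_mem hθ hlam h1 h2

theorem slopeL_proj {t : ℝ} {x : AffDual M ≃ₗ[ℂ] AffDual M} (hx : stepL η t = some x) :
    slopeL b θ (proj lam η) i t = simpleEv b θ i (x lam) :=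
  IsIntegralPath.slopeL_eq (stepAt_proj_of_some hx)

theorem slopeR_proj {t : ℝ} {x : AffDual M ≃ₗ[ℂ] AffDual M} (hx : stepR η t = some x) :
    slopeR b θ (proj lam η) i t = simpleEv b θ i (x lam) :=
  IsIntegralPath.slopeR_eq (stepAt_proj_of_some hx)

theorem exists_rat_of_mul_mem {t : ℝ} {k : ℤ} (hk : k ≠ 0) (h : t * k ∈ intReal) :
    ∃ q : ℚ, t = q := by
  obtain ⟨n, hn⟩ := h
  simp only [Int.coe_castAddHom] at hn
  refine ⟨n / k, ?_⟩
  have : (k : ℝ) ≠ 0 := by exact_mod_cast hk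
  push_cast
  rw [hn, mul_div_cancel_right₀ _ this]

variable {t₀ t₁ m : ℝ}

theorem exists_time_of_slope_ne {l : List (AffDual M × ℝ)} {t : ℝ}
    (h : slopeL b θ l i t ≠ slopeR b θ l i t) : ∃ p ∈ l, p.2 = t := by
  apply IsReducedList.time_of_stepL_ne_stepR
  intro e
  exact h (by rw [slopeL, slopeR, e])

theorem exists_time_proj {t : ℝ} (h : ∃ p ∈ proj lam η, p.2 = t) : ∃ p ∈ η, p.2 = t := by
  obtain ⟨p, hp, rfl⟩ := h
  obtain ⟨p', hp', rfl⟩ := List.mem_map.mp hp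
  exact ⟨p', hp', rfl⟩

/-- The slope is negative before t₁ and nonnegative after it, unless t₁ = 1; either way t₁ is a
break. -/
theorem eInterval_time {l : List (AffDual M × ℝ)} (hl : IsReducedList l) {H : ℝ → ℝ}
    (hI : IsHeightFn.EInterval H (slopeL b θ l i) (slopeR b θ l i) m t₀ t₁) :
    ∃ p ∈ l, p.2 = t₁ := by
  rcases hI.le_one.eq_or_lt with h | h
  · rw [h]; exact hl.exists_time_one
  · have h1 := hI.dL_neg t₁ hI.lt le_rfl
    have h2 := hI.dR_end h
    exact exists_time_of_slope_ne (i := i) (h1.trans_le h2).ne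

theorem fInterval_time {l : List (AffDual M × ℝ)} {H : ℝ → ℝ}
    (hI : IsHeightFn.FInterval H (slopeL b θ l i) (slopeR b θ l i) m t₀ t₁) :
    t₀ = 0 ∨ ∃ p ∈ l, p.2 = t₀ := by
  rcases hI.zero_le.eq_or_lt with h | h
  · exact .inl h.symm
  · have h1 := hI.dR_pos t₀ le_rfl hI.lt
    have h2 := hI.dL_start h
    exact .inr (exists_time_of_slope_ne (i := i) (h2.trans_lt h1).ne)

/-- What remains is the directed paths at interior times: nonzero slopes keep the reflected entries
among the coset representatives, and the only possible new times are t₀ and t₁. -/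
theorem siStep_mem_of_reflection (hθ : IsHighestRoot b θ) (hlam : IsLevelZeroDominant b θ lam)
    (hη : η ∈ siLSPaths b θ lam)
    (hr : IsReflection (fun x => simpleRefl b θ i * x) t₀ t₁ η η')
    (hne : ∀ t, t₀ < t → t ≤ t₁ → slopeL b θ (proj lam η) i t ≠ 0)
    (h₀ : ∃ q : ℚ, t₀ = q) (h₁ : ∃ q : ℚ, t₁ = q)
    (hpath : ∀ t, 0 < t → t < 1 → ∀ x ∈ stepR η' t, ∀ y ∈ stepL η' t, SiPath b θ lam t x y) :
    η' ∈ siLSPaths b θ lam := by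
  refine siLSPaths_iff.mpr ⟨hr.reduced, fun p hp => ⟨?_, ?_⟩, fun t x hx y hy => ?_⟩
  · have h1 := stepL_eq_of_mem hr.reduced.chain_lt hp
    have hpos := hr.reduced.pos p hp
    by_cases h2 : p.2 ≤ t₀
    · rw [hr.stepL_of_le hpos h2] at h1
      exact stepAt_mem_cosetReps hη h1
    by_cases h3 : p.2 ≤ t₁
    · rw [hr.stepL_of_mem hpos (not_le.mp h2) h3] at h1
      obtain ⟨x, hx, hxp⟩ := Option.map_eq_some_iff.mp h1
      rw [← hxp]
      refine simpleRefl_mul_mem_cosetReps hθ hlam (stepAt_mem_cosetReps hη hx) fun h4 => ?_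
      have := hne p.2 (not_le.mp h2) h3
      rw [slopeL_proj hx, simpleEv, h4] at this
      simp at this
    · rw [hr.stepL_of_lt hpos (not_le.mp h3)] at h1
      exact stepAt_mem_cosetReps hη h1
  · rcases hr.time p hp with h | h | ⟨p', hp', h⟩
    · rw [h]; exact h₀
    · rw [h]; exact h₁
    · rw [← h]; exact (hη.1 p' hp').2.2
  · rcases le_or_gt t 0 with h0 | h0
    · have : stepL η' t = stepR η' t := IsReducedList.stepL_eq_stepR_of_not_mem t fun p hp e =>
        absurd (hr.reduced.pos p hp) (not_lt.mpr (e ▸ h0))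
      rw [this] at hy
      rw [Option.mem_unique hx hy]
      exact .refl
    rcases lt_or_ge t 1 with h1 | h1
    · exact hpath t h0 h1 x hx y hy
    · obtain ⟨p, hp, htp, -⟩ := exists_of_stepAt hx
      exact absurd (hr.reduced.le_one hp) (not_le.mpr (h1.trans_lt htp))

/-- H(t) is congruent to t⟨α_i^∨, xλ⟩ modulo ℤ and lies strictly between consecutive integers. -/
theorem height_mul_not_mem (hθ : IsHighestRoot b θ) (hlam : IsLevelZeroDominant b θ lam)
    (hη : η ∈ siLSPaths b θ lam) (hm : m ∈ intReal) {t : ℝ} (ht : t < 1)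
    (h : m < height b θ (proj lam η) i t ∧ height b θ (proj lam η) i t < m + 1)
    {x : AffDual M ≃ₗ[ℂ] AffDual M} (hx : stepR η t = some x) :
    t * simpleEv b θ i (x lam) ∉ intReal := fun hcon => by
  have h1 := (isIntegralPath_proj hθ hlam hη).height_sub_mul_mem' (i := i) (t := t) (ν := x lam) hlam
    ht (stepAt_proj_of_some hx)
  have h2 := add_mem h1 hcon
  rw [sub_add_cancel] at h2
  exact not_mem_intReal_of_between hm h.1 h.2 h2

/-- Only the directed paths at times in [t₀, t₁] change. At t₀ an edge labelled α_i is prepended,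
strictly inside the whole path is reflected, and at t₁ `SiPath.simpleRefl_right` removes an edge
labelled α_i. -/
theorem mem_siLSPaths_of_eInterval (hθ : IsHighestRoot b θ) (hlam : IsLevelZeroDominant b θ lam)
    (hη : η ∈ siLSPaths b θ lam)
    (hI : IsHeightFn.EInterval (height b θ (proj lam η) i) (slopeL b θ (proj lam η) i)
      (slopeR b θ (proj lam η) i) m t₀ t₁)
    (hr : IsReflection (fun x => simpleRefl b θ i * x) t₀ t₁ η η') :
    η' ∈ siLSPaths b θ lam := by
  obtain ⟨hred, hent, hpath⟩ := siLSPaths_iff.mp hη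
  have hint := isIntegralPath_proj hθ hlam hη
  have hev_start : ∀ x ∈ stepR η t₀, simpleEv b θ i (x lam) < 0 ∧
      t₀ * simpleEv b θ i (x lam) ∈ intReal := by
    intro x hx
    have h1 := hI.dR_neg t₀ le_rfl hI.lt
    rw [slopeR_proj hx] at h1
    refine ⟨by exact_mod_cast h1, ?_⟩
    have h2 := hint.height_sub_mul_mem' (i := i) (t := t₀) (ν := x lam) hlam
      (hI.lt.trans_le hI.le_one) (stepAt_proj_of_some hx)
    rw [hI.start_eq] at h2
    have := sub_mem (add_mem hI.min_mem one_mem_intReal) h2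
    rwa [sub_sub_cancel] at this
  refine siStep_mem_of_reflection hθ hlam hη hr (fun t h h' => (hI.dL_neg t h h').ne) ?_ ?_ ?_
  -- The cut t₀ is rational because its product with a nonzero integer slope is an integer, by H(t₀)
  -- = m + 1.
  · obtain ⟨x, hx⟩ := hred.exists_stepR (hI.lt.trans_le hI.le_one)
    obtain ⟨h1, h2⟩ := hev_start x hx
    exact exists_rat_of_mul_mem h1.ne h2
  · obtain ⟨p, hp, hpt⟩ := exists_time_proj (eInterval_time hint.reduced hI)
    rw [← hpt]; exact (hent p hp).2
  · intro t h0 h1 x hx y hy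
    rcases lt_trichotomy t t₀ with ht | rfl | ht
    · rw [hr.stepR_of_lt h0.le ht] at hx
      rw [hr.stepL_of_le h0 ht.le] at hy
      exact hpath t x hx y hy
    · rw [hr.stepR_of_mem h0.le le_rfl hI.lt] at hx
      rw [hr.stepL_of_le h0 le_rfl] at hy
      obtain ⟨u, hu, rfl⟩ := Option.map_eq_some_iff.mp hx
      obtain ⟨h2, h3⟩ := hev_start u hu
      exact .head (siStep_simpleRefl' hθ hlam (stepAt_mem_cosetReps hη hu) h2 h3) (hpath t u hu y hy)
    rcases lt_trichotomy t t₁ with ht' | rfl | ht'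
    · rw [hr.stepR_of_mem h0.le ht.le ht'] at hx
      rw [hr.stepL_of_mem h0 ht ht'.le] at hy
      obtain ⟨u, hu, rfl⟩ := Option.map_eq_some_iff.mp hx
      obtain ⟨v, hv, rfl⟩ := Option.map_eq_some_iff.mp hy
      have h2 := hI.dR_neg t ht.le ht'
      have h3 := hI.dL_neg t ht ht'.le
      rw [slopeR_proj hu] at h2
      rw [slopeL_proj hv] at h3
      exact (hpath t u hu v hv).simpleRefl_of_neg hθ hlam (by exact_mod_cast h2)
        (by exact_mod_cast h3)
        (height_mul_not_mem hθ hlam hη hI.min_mem h1 (hI.inside t ht ht') hu)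
    · rw [hr.stepR_of_le h0.le le_rfl] at hx
      rw [hr.stepL_of_mem h0 ht le_rfl] at hy
      obtain ⟨v, hv, rfl⟩ := Option.map_eq_some_iff.mp hy
      have h2 := hI.dR_end h1
      have h3 := hI.dL_neg t ht le_rfl
      rw [slopeR_proj hx] at h2
      rw [slopeL_proj hv] at h3
      exact (hpath t x hx v hv).simpleRefl_right hθ hlam (by exact_mod_cast h2)
        (by exact_mod_cast h3)
    · rw [hr.stepR_of_le h0.le ht'.le] at hx
      rw [hr.stepL_of_lt h0 ht'] at hy
      exact hpath t x hx y hy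

/-- As for e_i, with the roles of the ends exchanged: `SiPath.simpleRefl_left` removes an edge
labelled α_i at t₀, and such an edge is appended at t₁, where H(t₁) = m + 1 supplies integrality. -/
theorem mem_siLSPaths_of_fInterval (hθ : IsHighestRoot b θ) (hlam : IsLevelZeroDominant b θ lam)
    (hη : η ∈ siLSPaths b θ lam)
    (hI : IsHeightFn.FInterval (height b θ (proj lam η) i) (slopeL b θ (proj lam η) i)
      (slopeR b θ (proj lam η) i) m t₀ t₁)
    (hr : IsReflection (fun x => simpleRefl b θ i * x) t₀ t₁ η η') :
    η' ∈ siLSPaths b θ lam := by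
  obtain ⟨hred, hent, hpath⟩ := siLSPaths_iff.mp hη
  have hint := isIntegralPath_proj hθ hlam hη
  have hev_end : ∀ y ∈ stepL η t₁, 0 < simpleEv b θ i (y lam) ∧
      t₁ * simpleEv b θ i (y lam) ∈ intReal := by
    intro y hy
    have h1 := hI.dL_pos t₁ hI.lt le_rfl
    rw [slopeL_proj hy] at h1
    refine ⟨by exact_mod_cast h1, ?_⟩
    have h2 := hint.height_sub_mul_mem (i := i) (t := t₁) (ν := y lam) hlam
      (stepAt_proj_of_some hy)
    rw [hI.end_eq] at h2
    have := sub_mem (add_mem hI.min_mem one_mem_intReal) h2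
    rwa [sub_sub_cancel] at this
  refine siStep_mem_of_reflection hθ hlam hη hr (fun t h h' => (hI.dL_pos t h h').ne') ?_ ?_ ?_
  · rcases fInterval_time hI with h | h
    · exact ⟨0, by simp [h]⟩
    · obtain ⟨p, hp, hpt⟩ := exists_time_proj h
      rw [← hpt]; exact (hent p hp).2
  · obtain ⟨y, hy⟩ := hred.exists_stepL hI.le_one
    obtain ⟨h1, h2⟩ := hev_end y hy
    exact exists_rat_of_mul_mem h1.ne' h2
  · intro t h0 h1 x hx y hy
    rcases lt_trichotomy t t₀ with ht | rfl | ht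
    · rw [hr.stepR_of_lt h0.le ht] at hx
      rw [hr.stepL_of_le h0 ht.le] at hy
      exact hpath t x hx y hy
    · rw [hr.stepR_of_mem h0.le le_rfl hI.lt] at hx
      rw [hr.stepL_of_le h0 le_rfl] at hy
      obtain ⟨u, hu, rfl⟩ := Option.map_eq_some_iff.mp hx
      have h2 := hI.dR_pos t le_rfl hI.lt
      have h3 := hI.dL_start h0
      rw [slopeR_proj hu] at h2
      rw [slopeL_proj hy] at h3
      exact (hpath t u hu y hy).simpleRefl_left hθ hlam (by exact_mod_cast h2)
        (by exact_mod_cast h3)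
    rcases lt_trichotomy t t₁ with ht' | rfl | ht'
    · rw [hr.stepR_of_mem h0.le ht.le ht'] at hx
      rw [hr.stepL_of_mem h0 ht ht'.le] at hy
      obtain ⟨u, hu, rfl⟩ := Option.map_eq_some_iff.mp hx
      obtain ⟨v, hv, rfl⟩ := Option.map_eq_some_iff.mp hy
      have h2 := hI.dR_pos t ht.le ht'
      rw [slopeR_proj hu] at h2
      exact (hpath t u hu v hv).simpleRefl_of_pos hθ hlam (by exact_mod_cast h2)
        (height_mul_not_mem hθ hlam hη hI.min_mem h1 (hI.inside t ht ht') hu)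
    · rw [hr.stepR_of_le h0.le le_rfl] at hx
      rw [hr.stepL_of_mem h0 ht le_rfl] at hy
      obtain ⟨v, hv, rfl⟩ := Option.map_eq_some_iff.mp hy
      obtain ⟨h2, h3⟩ := hev_end v hv
      exact .tail (hpath t x hx v hv)
        (siStep_simpleRefl hθ hlam (stepAt_mem_cosetReps hη hv) h2 h3)
    · rw [hr.stepR_of_le h0.le ht'.le] at hx
      rw [hr.stepL_of_lt h0 ht'] at hy
      exact hpath t x hx y hy

/-! ## The root operators as reflections -/

theorem simpleEv_simpleRefl (hlam : IsLevelZeroDominant b θ lam) {μ : AffDual M}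
    (hμ : μ ∈ orbit b θ lam) : simpleEv b θ i (simpleRefl b θ i μ) = - simpleEv b θ i μ :=
  evInt_simpleRefl hlam hμ i

/-- The cut at t₀ creates no repeated entry: after reflection the slope to its right is positive,
while the slope to its left is nonpositive. -/
theorem IsIntegralPath.isReflection_e {l : List (AffDual M × ℝ)} (h : IsIntegralPath b θ lam l)
    (hlam : IsLevelZeroDominant b θ lam) (hm : minHeight b θ l i ≠ 0) :
    IsReflection (fun ν => simpleRefl b θ i ν) (eStart b θ l i) (eEnd b θ l i) l
      (eReflect (fun ν => simpleRefl b θ i ν) (eStart b θ l i) (eEnd b θ l i) l) := by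
  have hI := h.eInterval hlam hm
  refine isReflection_eReflect h.reduced (simpleRefl b θ i).injective hI.zero_le hI.lt
    (eInterval_time h.reduced hI) fun x hx y hy e => ?_
  have h1 := hI.dR_neg _ le_rfl hI.lt
  rw [slopeR_eq hx] at h1
  have hx0 : simpleEv b θ i x < 0 := by exact_mod_cast h1
  have h2 : simpleEv b θ i y ≤ 0 := by
    rcases hI.zero_le.eq_or_lt with h0 | h0
    · rw [← h0] at hx hy
      rw [h.reduced.stepL_zero_eq_stepR_zero] at hy
      rw [Option.mem_unique hy hx]; exact hx0.le
    · have := hI.dL_start h0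
      rw [slopeL_eq hy] at this
      exact_mod_cast this
  rw [e, simpleEv_simpleRefl hlam (h.stepAt_mem_orbit hx)] at h2
  lia

theorem IsIntegralPath.isReflection_f {l : List (AffDual M × ℝ)} (h : IsIntegralPath b θ lam l)
    (hlam : IsLevelZeroDominant b θ lam) (hm : height b θ l i 1 - minHeight b θ l i ≠ 0) :
    IsReflection (fun ν => simpleRefl b θ i ν) (fStart b θ l i) (fEnd b θ l i) l
      (fReflect (fun ν => simpleRefl b θ i ν) (fStart b θ l i) (fEnd b θ l i) l) := by
  have hI := h.fInterval hlam hm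
  refine isReflection_fReflect h.reduced (simpleRefl b θ i).injective hI.lt hI.le_one
    (fInterval_time hI) fun x hx y hy e => ?_
  have h1 := hI.dL_pos _ hI.lt le_rfl
  rw [slopeL_eq hx] at h1
  have hx0 : 0 < simpleEv b θ i x := by exact_mod_cast h1
  have h2 : 0 ≤ simpleEv b θ i y := by
    rcases hI.le_one.eq_or_lt with h0 | h0
    · obtain ⟨p, hp, htp, -⟩ := exists_of_stepAt hy
      rw [h0] at htp
      exact absurd (h.reduced.le_one hp) (not_le.mpr htp)
    · have := hI.dR_end h0
      rw [slopeR_eq hy] at this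
      exact_mod_cast this
  rw [e, simpleEv_simpleRefl hlam (h.stepAt_mem_orbit hx)] at h2
  lia

theorem isReflection_siE (hθ : IsHighestRoot b θ) (hlam : IsLevelZeroDominant b θ lam)
    (hη : η ∈ siLSPaths b θ lam) (hm : minHeight b θ (proj lam η) i ≠ 0) :
    IsReflection (fun x => simpleRefl b θ i * x) (eStart b θ (proj lam η) i)
      (eEnd b θ (proj lam η) i) η (eReflect (fun x => simpleRefl b θ i * x)
        (eStart b θ (proj lam η) i) (eEnd b θ (proj lam η) i) η) := by
  have hint := isIntegralPath_proj hθ hlam hη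
  have hred := (siLSPaths_iff.mp hη).1
  have hI := hint.eInterval hlam hm
  refine isReflection_eReflect hred (mul_right_injective _) hI.zero_le hI.lt
    (exists_time_proj (eInterval_time hint.reduced hI)) fun x hx y hy e => ?_
  have h1 := hI.dR_neg _ le_rfl hI.lt
  rw [slopeR_proj hx] at h1
  have hx0 : simpleEv b θ i (x lam) < 0 := by exact_mod_cast h1
  have h2 : simpleEv b θ i (y lam) ≤ 0 := by
    rcases hI.zero_le.eq_or_lt with h0 | h0
    · rw [← h0] at hx hy
      rw [hred.stepL_zero_eq_stepR_zero] at hy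
      rw [Option.mem_unique hy hx]; exact hx0.le
    · have := hI.dL_start h0
      rw [slopeL_proj hy] at this
      exact_mod_cast this
  rw [e, LinearEquiv.mul_apply,
    simpleEv_simpleRefl hlam (mem_orbit (stepAt_mem_cosetReps hη hx).1)] at h2
  lia

theorem isReflection_siF (hθ : IsHighestRoot b θ) (hlam : IsLevelZeroDominant b θ lam)
    (hη : η ∈ siLSPaths b θ lam)
    (hm : height b θ (proj lam η) i 1 - minHeight b θ (proj lam η) i ≠ 0) :
    IsReflection (fun x => simpleRefl b θ i * x) (fStart b θ (proj lam η) i)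
      (fEnd b θ (proj lam η) i) η (fReflect (fun x => simpleRefl b θ i * x)
        (fStart b θ (proj lam η) i) (fEnd b θ (proj lam η) i) η) := by
  have hint := isIntegralPath_proj hθ hlam hη
  have hred := (siLSPaths_iff.mp hη).1
  have hI := hint.fInterval hlam hm
  refine isReflection_fReflect hred (mul_right_injective _) hI.lt hI.le_one
    ((fInterval_time hI).imp id exists_time_proj) fun x hx y hy e => ?_
  have h1 := hI.dL_pos _ hI.lt le_rfl
  rw [slopeL_proj hx] at h1
  have hx0 : 0 < simpleEv b θ i (x lam) := by exact_mod_cast h1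
  have h2 : 0 ≤ simpleEv b θ i (y lam) := by
    rcases hI.le_one.eq_or_lt with h0 | h0
    · obtain ⟨p, hp, htp, -⟩ := exists_of_stepAt hy
      rw [h0] at htp
      exact absurd (hred.le_one hp) (not_le.mpr htp)
    · have := hI.dR_end h0
      rw [slopeR_proj hy] at this
      exact_mod_cast this
  rw [e, LinearEquiv.mul_apply,
    simpleEv_simpleRefl hlam (mem_orbit (stepAt_mem_cosetReps hη hx).1)] at h2
  lia

/-- The projected list stays reduced, since consecutive entries are joined by nontrivial directed
paths, which strictly raise the weight. -/
theorem IsReflection.proj (hθ : IsHighestRoot b θ) (hlam : IsLevelZeroDominant b θ lam)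
    (hη' : η' ∈ siLSPaths b θ lam)
    (hr : IsReflection (fun x => simpleRefl b θ i * x) t₀ t₁ η η') :
    IsReflection (fun ν => simpleRefl b θ i ν) t₀ t₁ (proj lam η) (proj lam η') :=
  hr.map (f := fun x : AffDual M ≃ₗ[ℂ] AffDual M => x lam) (fun _ => rfl)
    (isIntegralPath_proj hθ hlam hη').reduced

end Stability

section Lattice

variable {ι M N : Type*} [Fintype ι] [AddCommGroup M] [Module ℂ M] [AddCommGroup N] [Module ℂ N]
variable {P : RootPairing ι ℂ M N} {b : P.Base} {θ : ι} {lam : AffDual M}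
variable [P.IsCrystallographic] [P.IsRootSystem] [P.IsReduced]

/-! ## Weights -/

namespace WeightLattice

variable (L : WeightLattice b θ)

theorem simpleRefl_mem (i : Option b.support) {μ : AffDual M} (hμ : μ ∈ L.lattice) :
    simpleRefl b θ i μ ∈ L.lattice := by
  obtain ⟨n, hn⟩ := L.integral i μ hμ
  rw [simpleRefl, realRefl_apply, hn, Int.cast_smul_eq_zsmul]
  exact sub_mem hμ (zsmul_mem (L.simpleRoot_mem i) n)

/-- The lattice contains the simple roots and is stable under simple reflections, hence contains all
positive real roots and their negatives. -/
theorem affRootLattice_le (hθ : IsHighestRoot b θ) : affRootLattice P ≤ L.lattice := by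
  have hpos : ∀ β ∈ posRealRoots b, realRoot P β ∈ L.lattice := by
    intro β hβ
    induction hβ using posRealRoots_induction hθ with
    | simple i => exact L.simpleRoot_mem i
    | step β i hβ hne hi hγ ih =>
      have := L.simpleRefl_mem i ih
      rwa [simpleRefl, realRefl_realRoot, reflIdx_reflIdx] at this
  rw [affRootLattice, AddSubgroup.closure_le]
  rintro _ ⟨β, rfl⟩
  by_cases hβ : β ∈ posRealRoots b
  · exact hpos β hβ
  · have h1 := hpos _ ((neg_pos_iff β).mpr hβ)
    have h2 : realRoot P (P.reflectionPerm β.1 β.1, -β.2) = - realRoot P β := by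
      ext <;> simp [realRoot]
    rw [h2] at h1
    simpa using h1

theorem orbit_subset (hlam : lam ∈ L.lattice) {μ : AffDual M} (hμ : μ ∈ orbit b θ lam) :
    μ ∈ L.lattice := by
  obtain ⟨x, hx, rfl⟩ := hμ
  induction hx using affineWeyl_induction with
  | one => exact hlam
  | mul i x hx ih => exact L.simpleRefl_mem i ih

theorem pair_corootLattice {μ : AffDual M} (h : ∀ i : b.support, ∃ n : ℤ,
    pair P (realCoroot P θ (simpleRoot b θ (some i))) μ = n) {ξ : N} (hξ : ξ ∈ corootLattice b) :
    ∃ n : ℤ, pair P (ξ, 0, 0) μ = n := by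
  induction hξ using AddSubgroup.closure_induction with
  | mem x hx =>
    obtain ⟨j, hj, rfl⟩ := hx
    obtain ⟨n, hn⟩ := h ⟨j, hj⟩
    exact ⟨n, by rw [← hn]; simp [realCoroot, simpleRoot]⟩
  | zero => exact ⟨0, by simp [pair_apply]⟩
  | add x y _ _ hx hy =>
    obtain ⟨m, hm⟩ := hx
    obtain ⟨n, hn⟩ := hy
    refine ⟨m + n, ?_⟩
    rw [pair_apply] at hm hn ⊢
    simp only [zero_mul, add_zero] at hm hn ⊢
    rw [map_add, hm, hn]; push_cast; rfl
  | neg x _ hx =>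
    obtain ⟨m, hm⟩ := hx
    refine ⟨-m, ?_⟩
    rw [pair_apply] at hm ⊢
    simp only [zero_mul, add_zero] at hm ⊢
    rw [map_neg, hm]; push_cast; rfl

theorem pair_corootLattice_eq_zero {μ : AffDual M} (h : ∀ i : b.support,
    pair P (realCoroot P θ (simpleRoot b θ (some i))) μ = 0) {ξ : N} (hξ : ξ ∈ corootLattice b) :
    pair P (ξ, 0, 0) μ = 0 := by
  induction hξ using AddSubgroup.closure_induction with
  | mem x hx =>
    obtain ⟨j, hj, rfl⟩ := hx
    simpa [realCoroot, simpleRoot] using h ⟨j, hj⟩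
  | zero => simp [pair_apply]
  | add x y _ _ hx hy =>
    rw [pair_apply] at hx hy ⊢
    simp only [zero_mul, add_zero] at hx hy ⊢
    rw [map_add, hx, hy, add_zero]
  | neg x _ hx =>
    rw [pair_apply] at hx ⊢
    simp only [zero_mul, add_zero] at hx ⊢
    rw [map_neg, hx, neg_zero]

/-- The canonical central element is `α_0^∨ + θ^∨`. -/
theorem pair_central (μ : AffDual M) : pair P (central N) μ =
    pair P (realCoroot P θ (simpleRoot b θ none)) μ + pair P (P.coroot θ, 0, 0) μ := by
  have h : normForm P θ (P.coroot (P.reflectionPerm θ θ)) (P.coroot (P.reflectionPerm θ θ)) = 2 := by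
    rw [normForm_reflectionPerm, normForm_coroot_self]
  simp only [pair_apply, central, realCoroot, simpleRoot, h]
  simp

theorem central_integral {μ : AffDual M} (hμ : μ ∈ L.lattice) :
    ∃ n : ℤ, pair P (central N) μ = n := by
  obtain ⟨m, hm⟩ := L.integral none μ hμ
  obtain ⟨n, hn⟩ := pair_corootLattice (θ := θ) (fun i => L.integral (some i) μ hμ)
    (coroot_mem_corootLattice (b := b) θ)
  exact ⟨m + n, by rw [pair_central (b := b) (θ := θ), hm, hn]; push_cast; rfl⟩

/-- Λ_0 vanishes on the finite simple coroots, so the summand θ^∨ of c contributes nothing.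
Subtracting ⟨c, Λ_i⟩Λ_0 therefore really produces level zero. -/
theorem central_fund_none : pair P (central N) (L.fund none) = 1 := by
  rw [pair_central (b := b) (θ := θ), L.pair_fund, pair_corootLattice_eq_zero (b := b) (θ := θ) _
    (coroot_mem_corootLattice (b := b) θ)]
  · simp
  · intro i; rw [L.pair_fund]; simp

theorem levelZeroFund_mem (i : b.support) : L.levelZeroFund i ∈ L.lattice := by
  obtain ⟨n, hn⟩ := L.central_integral (L.fund_mem (some i))
  rw [levelZeroFund, hn, Int.cast_smul_eq_zsmul]
  exact sub_mem (L.fund_mem _) (zsmul_mem (L.fund_mem _) n)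

theorem dominant_mem (m : b.support → ℕ) : L.dominant m ∈ L.lattice :=
  sum_mem fun i _ => nsmul_mem (L.levelZeroFund_mem i) _

theorem isLevelZeroDominant (m : b.support → ℕ) : IsLevelZeroDominant b θ (L.dominant m) := by
  refine ⟨?_, fun j => ⟨m j, ?_⟩⟩
  · have h : ∀ μ : AffDual M, pair P (central N) μ = μ.2.1 := fun μ => by
      simp [pair_apply, central]
    rw [← h, dominant, map_sum]
    refine Finset.sum_eq_zero fun i _ => ?_
    rw [map_nsmul, levelZeroFund, map_sub, map_smul, L.central_fund_none]
    simp
  · rw [dominant, map_sum, Finset.sum_eq_single j]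
    · rw [map_nsmul, levelZeroFund, map_sub, map_smul, L.pair_fund, L.pair_fund]
      simp
    · intro i _ hij
      rw [map_nsmul, levelZeroFund, map_sub, map_smul, L.pair_fund, L.pair_fund]
      simp [hij]
    · simp

end WeightLattice

/-- At t = 1 the path differs from its last direction by an element of the root lattice. -/
theorem IsIntegralPath.endpoint_mem (hθ : IsHighestRoot b θ) (L : WeightLattice b θ)
    (hL : lam ∈ L.lattice) {l : List (AffDual M × ℝ)} (h : IsIntegralPath b θ lam l) :
    pathMap l 1 ∈ L.lattice := by
  obtain ⟨ν, hν⟩ := h.reduced.exists_stepL le_rfl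
  have h1 := L.affRootLattice_le hθ (h.pathMap_sub_smul_mem hν)
  rw [Complex.ofReal_one, one_smul] at h1
  have := add_mem h1 (L.orbit_subset hL (h.stepAt_mem_orbit hν))
  rwa [sub_add_cancel] at this

end Lattice

section Crystals

variable {ι M N : Type*} [Fintype ι] [AddCommGroup M] [Module ℂ M] [AddCommGroup N] [Module ℂ N]
variable {P : RootPairing ι ℂ M N} {b : P.Base} {θ : ι} {lam : AffDual M}

/-! ## Crystals from root operators -/

/-- Operators `opE i`, `opF i` on a set `S`, with the numbers `E i x`, `F i x` of times they can be
applied, that satisfy the axioms of a crystal. -/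
structure IsRootOperatorSystem {X : Type*} (L : WeightLattice b θ) (S : Set X)
    (opE opF : Option b.support → X → Option X) (endpt : X → AffDual M)
    (E F : Option b.support → X → ℕ) : Prop where
  endpt_mem : ∀ x ∈ S, endpt x ∈ L.lattice
  e_mem : ∀ i, ∀ x ∈ S, ∀ y, opE i x = some y → y ∈ S
  f_mem : ∀ i, ∀ x ∈ S, ∀ y, opF i x = some y → y ∈ S
  e_none : ∀ i, ∀ x ∈ S, opE i x = none ↔ E i x = 0
  f_none : ∀ i, ∀ x ∈ S, opF i x = none ↔ F i x = 0
  e_some : ∀ i, ∀ x ∈ S, ∀ y, opE i x = some y → opF i y = some x ∧ E i x = E i y + 1 ∧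
    F i y = F i x + 1 ∧ endpt y = endpt x + realRoot P (simpleRoot b θ i)
  f_some : ∀ i, ∀ x ∈ S, ∀ y, opF i x = some y → opE i y = some x
  pair_endpt : ∀ i, ∀ x ∈ S,
    (F i x : ℂ) = E i x + pair P (realCoroot P θ (simpleRoot b θ i)) (endpt x)

/-- A counter that drops by one at each application and vanishes exactly where the operator is
undefined counts the possible applications. -/
theorem isGreatest_iterate {X : Type*} {S : Set X} {op : X → Option X} {n : X → ℕ}
    (hmem : ∀ x ∈ S, ∀ y, op x = some y → y ∈ S) (hnone : ∀ x ∈ S, op x = none ↔ n x = 0)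
    (hsome : ∀ x ∈ S, ∀ y, op x = some y → n x = n y + 1) {x : X} (hx : x ∈ S) :
    IsGreatest {k : ℕ | (fun z : Option X => z.bind op)^[k] (some x) ≠ none} (n x) := by
  have hnn : ∀ k, (fun z : Option X => z.bind op)^[k] none = none := fun k =>
    Function.iterate_fixed rfl k
  have key : ∀ k, ∀ x ∈ S, (fun z : Option X => z.bind op)^[k] (some x) ≠ none ↔ k ≤ n x := by
    intro k
    induction k with
    | zero => intro x _; simp
    | succ k ih =>
      intro x hx
      rw [Function.iterate_succ_apply, Option.bind_some]
      rcases hop : op x with _ | y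
      · rw [hnn, (hnone x hx).mp hop]; simp
      · rw [ih y (hmem x hx y hop), hsome x hx y hop]; lia
  exact ⟨(key _ x hx).mpr le_rfl, fun k hk => (key k x hx).mp hk⟩

namespace IsRootOperatorSystem

variable {X Y : Type*} {L : WeightLattice b θ} {S : Set X} {T : Set Y}
  {opE opF : Option b.support → X → Option X} {endpt : X → AffDual M}
  {E F : Option b.support → X → ℕ}

theorem restrict_eq_some {op : X → Option X} (h : ∀ x ∈ S, ∀ y, op x = some y → y ∈ S) (x y : S) :
    (op x).pmap Subtype.mk (h x x.2) = some y ↔ op x = some y := by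
  rw [Option.pmap_eq_some_iff]
  constructor
  · rintro ⟨a, ha, ha', rfl⟩; exact ha'
  · intro h; exact ⟨y, y.2, h, rfl⟩

/-- The crystal of a system of root operators. -/
def crystal (h : IsRootOperatorSystem L S opE opF endpt E F) : Crystal L S where
  wt x := ⟨endpt x, h.endpt_mem x x.2⟩
  e i x := (opE i x).pmap Subtype.mk (h.e_mem i x x.2)
  f i x := (opF i x).pmap Subtype.mk (h.f_mem i x x.2)
  ε i x := ((E i x : ℤ) : WithBot ℤ)
  φ i x := ((F i x : ℤ) : WithBot ℤ)
  φ_eq i x n hn := by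
    have h1 := h.pair_endpt i x x.2
    rw [hn] at h1
    have h2 : (F i x : ℤ) = E i x + n := by exact_mod_cast h1
    rw [h2, WithBot.coe_add]
  wt_e i x y hxy := by
    rw [restrict_eq_some (h.e_mem i)] at hxy
    exact (h.e_some i x x.2 y hxy).2.2.2
  wt_f i x y hxy := by
    rw [restrict_eq_some (h.f_mem i)] at hxy
    have := (h.e_some i y y.2 x (h.f_some i x x.2 y hxy)).2.2.2
    exact eq_sub_of_add_eq this.symm
  ε_e i x y hxy := by
    rw [restrict_eq_some (h.e_mem i)] at hxy
    rw [(h.e_some i x x.2 y hxy).2.1, Nat.cast_add, WithBot.coe_add]; rfl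
  φ_e i x y hxy := by
    rw [restrict_eq_some (h.e_mem i)] at hxy
    rw [(h.e_some i x x.2 y hxy).2.2.1, Nat.cast_add, WithBot.coe_add]; rfl
  ε_f i x y hxy := by
    rw [restrict_eq_some (h.f_mem i)] at hxy
    rw [(h.e_some i y y.2 x (h.f_some i x x.2 y hxy)).2.1, Nat.cast_add, WithBot.coe_add]; rfl
  φ_f i x y hxy := by
    rw [restrict_eq_some (h.f_mem i)] at hxy
    rw [(h.e_some i y y.2 x (h.f_some i x x.2 y hxy)).2.2.1, Nat.cast_add, WithBot.coe_add]; rfl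
  e_iff_f i x y := by
    rw [restrict_eq_some (h.e_mem i), restrict_eq_some (h.f_mem i)]
    exact ⟨fun hxy => (h.e_some i x x.2 y hxy).1, fun hxy => h.f_some i y y.2 x hxy⟩
  e_bot i x hx := absurd hx (WithBot.coe_ne_bot)
  f_bot i x hx := absurd hx (WithBot.coe_ne_bot)

theorem map_val_restrict {op : X → Option X} (h : ∀ x ∈ S, ∀ y, op x = some y → y ∈ S) (x : S) :
    ((op x).pmap Subtype.mk (h x x.2)).map Subtype.val = op x := by
  rw [Option.map_pmap]
  simp

theorem isCrystalOf (h : IsRootOperatorSystem L S opE opF endpt E F) :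
    IsCrystalOf h.crystal opE opF endpt where
  wt_eq _ := rfl
  e_eq i x := map_val_restrict (h.e_mem i) x
  f_eq i x := map_val_restrict (h.f_mem i) x
  ε_eq i x := ⟨E i x, rfl, isGreatest_iterate (h.e_mem i) (h.e_none i)
    (fun x hx y hxy => (h.e_some i x hx y hxy).2.1) x.2⟩
  φ_eq i x := ⟨F i x, rfl, isGreatest_iterate (h.f_mem i) (h.f_none i)
    (fun x hx y hxy => (h.e_some i y (h.f_mem i x hx y hxy) x (h.f_some i x hx y hxy)).2.2.1) x.2⟩

variable {opE' opF' : Option b.support → Y → Option Y} {endpt' : Y → AffDual M}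
  {E' F' : Option b.support → Y → ℕ}

/-- Systems of root operators descend along surjections compatible with the operators. -/
theorem image (h : IsRootOperatorSystem L S opE opF endpt E F) {ψ : X → Y}
    (hsurj : ∀ y ∈ T, ∃ x ∈ S, ψ x = y) (hmaps : ∀ x ∈ S, ψ x ∈ T)
    (he : ∀ i, ∀ x ∈ S, opE' i (ψ x) = (opE i x).map ψ)
    (hf : ∀ i, ∀ x ∈ S, opF' i (ψ x) = (opF i x).map ψ)
    (hendpt : ∀ x ∈ S, endpt' (ψ x) = endpt x) (hE : ∀ i, ∀ x ∈ S, E' i (ψ x) = E i x)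
    (hF : ∀ i, ∀ x ∈ S, F' i (ψ x) = F i x) :
    IsRootOperatorSystem L T opE' opF' endpt' E' F' := by
  refine ⟨fun y hy => ?_, fun i y hy z hz => ?_, fun i y hy z hz => ?_, fun i y hy => ?_,
    fun i y hy => ?_, fun i y hy z hz => ?_, fun i y hy z hz => ?_, fun i y hy => ?_⟩ <;>
    obtain ⟨x, hx, rfl⟩ := hsurj y hy
  · rw [hendpt x hx]; exact h.endpt_mem x hx
  · rw [he i x hx] at hz
    obtain ⟨x', hx', rfl⟩ := Option.map_eq_some_iff.mp hz
    exact hmaps x' (h.e_mem i x hx x' hx')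
  · rw [hf i x hx] at hz
    obtain ⟨x', hx', rfl⟩ := Option.map_eq_some_iff.mp hz
    exact hmaps x' (h.f_mem i x hx x' hx')
  · rw [he i x hx, hE i x hx, Option.map_eq_none_iff]; exact h.e_none i x hx
  · rw [hf i x hx, hF i x hx, Option.map_eq_none_iff]; exact h.f_none i x hx
  · rw [he i x hx] at hz
    obtain ⟨x', hx', rfl⟩ := Option.map_eq_some_iff.mp hz
    have hm := h.e_mem i x hx x' hx'
    obtain ⟨h1, h2, h3, h4⟩ := h.e_some i x hx x' hx'
    rw [hf i x' hm, hE i x hx, hE i x' hm, hF i x hx, hF i x' hm, hendpt x hx, hendpt x' hm, h1]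
    exact ⟨rfl, h2, h3, h4⟩
  · rw [hf i x hx] at hz
    obtain ⟨x', hx', rfl⟩ := Option.map_eq_some_iff.mp hz
    rw [he i x' (h.f_mem i x hx x' hx'), h.f_some i x hx x' hx']; rfl
  · rw [hF i x hx, hE i x hx, hendpt x hx]; exact h.pair_endpt i x hx

/-- A surjection compatible with the operators is a strict morphism. -/
theorem isStrictMorphism (h : IsRootOperatorSystem L S opE opF endpt E F)
    (h' : IsRootOperatorSystem L T opE' opF' endpt' E' F') {ψ : X → Y}
    (hmaps : ∀ x ∈ S, ψ x ∈ T)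
    (he : ∀ i, ∀ x ∈ S, opE' i (ψ x) = (opE i x).map ψ)
    (hf : ∀ i, ∀ x ∈ S, opF' i (ψ x) = (opF i x).map ψ)
    (hendpt : ∀ x ∈ S, endpt' (ψ x) = endpt x) (hE : ∀ i, ∀ x ∈ S, E' i (ψ x) = E i x)
    (hF : ∀ i, ∀ x ∈ S, F' i (ψ x) = F i x) :
    IsStrictMorphism h.crystal h'.crystal
      (Option.map fun x : S => (⟨ψ x, hmaps x x.2⟩ : T)) := by
  have key : ∀ {op : X → Option X} {op' : Y → Option Y}
      (hm : ∀ x ∈ S, ∀ y, op x = some y → y ∈ S) (hm' : ∀ x ∈ T, ∀ y, op' x = some y → y ∈ T)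
      (_ : ∀ x ∈ S, op' (ψ x) = (op x).map ψ) (x : S),
      ((op x).pmap Subtype.mk (hm x x.2)).map (fun x : S => (⟨ψ x, hmaps x x.2⟩ : T)) =
        (op' (ψ x)).pmap Subtype.mk (hm' (ψ x) (hmaps x x.2)) := by
    intro op op' hm hm' hop x
    apply Option.map_injective (Subtype.val_injective (p := (· ∈ T)))
    rw [map_val_restrict hm' ⟨ψ x, hmaps x x.2⟩, hop x x.2, Option.map_map]
    conv_rhs => rw [← map_val_restrict hm x, Option.map_map]
    rfl
  refine ⟨rfl, ?_, ?_, ?_, ?_, ?_⟩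
  · rintro x _ ⟨⟩
    exact Subtype.ext (hendpt x x.2)
  · rintro i x _ ⟨⟩
    exact congrArg (fun n : ℕ => ((n : ℤ) : WithBot ℤ)) (hE i x x.2)
  · rintro i x _ ⟨⟩
    exact congrArg (fun n : ℕ => ((n : ℤ) : WithBot ℤ)) (hF i x x.2)
  · rintro i (_ | x)
    · rfl
    · exact key (h.e_mem i) (h'.e_mem i) (he i) x
  · rintro i (_ | x)
    · rfl
    · exact key (h.f_mem i) (h'.f_mem i) (hf i) x

end IsRootOperatorSystem

end Crystals

/-! ### The crystal of semi-infinite LS paths and its projection to LS paths. -/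

section Assembly

variable {ι M N : Type*} [Fintype ι] [AddCommGroup M] [Module ℂ M] [AddCommGroup N] [Module ℂ N]
variable {P : RootPairing ι ℂ M N} {b : P.Base} {θ : ι} {lam : AffDual M}
variable [P.IsCrystallographic] [P.IsRootSystem] [P.IsReduced]

/-- The natural number `-m_i^π`. -/
def epsNat (b : P.Base) (θ : ι) (i : Option b.support) (π : List (AffDual M × ℝ)) : ℕ :=
  ⌊- minHeight b θ π i⌋₊

/-- The natural number `H_i^π(1) - m_i^π`. -/
def phiNat (b : P.Base) (θ : ι) (i : Option b.support) (π : List (AffDual M × ℝ)) : ℕ :=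
  ⌊height b θ π i 1 - minHeight b θ π i⌋₊

theorem natFloor_eq {x : ℝ} (hx : x ∈ intReal) (h0 : 0 ≤ x) : (⌊x⌋₊ : ℝ) = x := by
  obtain ⟨n, rfl⟩ := hx
  simp only [Int.coe_castAddHom] at h0 ⊢
  lift n to ℕ using (by exact_mod_cast h0)
  simp

namespace IsIntegralPath

variable {l : List (AffDual M × ℝ)}

theorem epsNat_eq (h : IsIntegralPath b θ lam l) (hlam : IsLevelZeroDominant b θ lam)
    (i : Option b.support) : (epsNat b θ i l : ℝ) = - minHeight b θ l i :=
  natFloor_eq (neg_mem ((h.isHeightFn hlam).min_mem (h.isLeast_minHeight hlam)))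
    (neg_nonneg.mpr (h.minHeight_nonpos hlam))

theorem minHeight_le_one (h : IsIntegralPath b θ lam l) (hlam : IsLevelZeroDominant b θ lam)
    (i : Option b.support) : minHeight b θ l i ≤ height b θ l i 1 :=
  (h.isLeast_minHeight hlam).2 ⟨1, ⟨zero_le_one, le_rfl⟩, rfl⟩

theorem phiNat_eq (h : IsIntegralPath b θ lam l) (hlam : IsLevelZeroDominant b θ lam)
    (i : Option b.support) : (phiNat b θ i l : ℝ) = height b θ l i 1 - minHeight b θ l i :=
  natFloor_eq (AddSubgroup.sub_mem _ (h.isHeightFn hlam).one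
    ((h.isHeightFn hlam).min_mem (h.isLeast_minHeight hlam)))
    (sub_nonneg.mpr (h.minHeight_le_one hlam i))

theorem pair_endpoint (hθ : IsHighestRoot b θ) (L : WeightLattice b θ) (hL : lam ∈ L.lattice)
    (h : IsIntegralPath b θ lam l) (i : Option b.support) :
    pair P (realCoroot P θ (simpleRoot b θ i)) (pathMap l 1) = height b θ l i 1 := by
  obtain ⟨n, hn⟩ := L.integral i _ (h.endpoint_mem hθ L hL)
  rw [height, hn]
  simp

end IsIntegralPath

variable {η η' : List ((AffDual M ≃ₗ[ℂ] AffDual M) × ℝ)}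

theorem siE_eq_some (hθ : IsHighestRoot b θ) (hlam : IsLevelZeroDominant b θ lam)
    (hη : η ∈ siLSPaths b θ lam) {i : Option b.support} (h : siE b θ lam i η = some η') :
    minHeight b θ (proj lam η) i ≠ 0 ∧ η' ∈ siLSPaths b θ lam ∧
      IsReflection (fun x => simpleRefl b θ i * x) (eStart b θ (proj lam η) i)
        (eEnd b θ (proj lam η) i) η η' := by
  rw [siE, rootE] at h
  split_ifs at h with hm
  obtain rfl := Option.some_injective _ h
  have hr := isReflection_siE hθ hlam hη hm
  exact ⟨hm, mem_siLSPaths_of_eInterval hθ hlam hη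
    ((isIntegralPath_proj hθ hlam hη).eInterval hlam hm) hr, hr⟩

theorem siF_eq_some (hθ : IsHighestRoot b θ) (hlam : IsLevelZeroDominant b θ lam)
    (hη : η ∈ siLSPaths b θ lam) {i : Option b.support} (h : siF b θ lam i η = some η') :
    height b θ (proj lam η) i 1 - minHeight b θ (proj lam η) i ≠ 0 ∧ η' ∈ siLSPaths b θ lam ∧
      IsReflection (fun x => simpleRefl b θ i * x) (fStart b θ (proj lam η) i)
        (fEnd b θ (proj lam η) i) η η' := by
  rw [siF, rootF] at h
  split_ifs at h with hm
  obtain rfl := Option.some_injective _ h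
  have hr := isReflection_siF hθ hlam hη hm
  exact ⟨hm, mem_siLSPaths_of_fInterval hθ hlam hη
    ((isIntegralPath_proj hθ hlam hη).fInterval hlam hm) hr, hr⟩

/-- The interval of f_i for e_i η is the interval of e_i for η, and conversely (`reflect_e`,
`reflect_f`). Reflecting twice on the same interval gives η back, and the counters -m and H(1) - m
can be read off the new heights. -/
theorem isRootOperatorSystem_siLSPaths (hθ : IsHighestRoot b θ)
    (hlam : IsLevelZeroDominant b θ lam) (L : WeightLattice b θ) (hL : lam ∈ L.lattice) :
    IsRootOperatorSystem L (siLSPaths b θ lam) (siE b θ lam) (siF b θ lam)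
      (fun η => pathMap (proj lam η) 1) (fun i η => epsNat b θ i (proj lam η))
      (fun i η => phiNat b θ i (proj lam η)) := by
  refine ⟨fun η hη => (isIntegralPath_proj hθ hlam hη).endpoint_mem hθ L hL,
    fun i η hη η' h => (siE_eq_some hθ hlam hη h).2.1,
    fun i η hη η' h => (siF_eq_some hθ hlam hη h).2.1, fun i η hη => ?_, fun i η hη => ?_,
    fun i η hη η' h => ?_, fun i η hη η' h => ?_, fun i η hη => ?_⟩
  · have h1 := (isIntegralPath_proj hθ hlam hη).epsNat_eq hlam i
    rw [siE, rootE, ite_eq_left_iff, ← Nat.cast_eq_zero (R := ℝ), h1, neg_eq_zero]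
    simp
  · have h1 := (isIntegralPath_proj hθ hlam hη).phiNat_eq hlam i
    rw [siF, rootF, ite_eq_left_iff, ← Nat.cast_eq_zero (R := ℝ), h1]
    simp
  · have hint := isIntegralPath_proj hθ hlam hη
    obtain ⟨hm, hη', hr⟩ := siE_eq_some hθ hlam hη h
    have hint' := isIntegralPath_proj hθ hlam hη'
    obtain ⟨h1, h2, h3, h4, h5⟩ := hint.reflect_e hlam hm (hr.proj hθ hlam hη')
    have hle := hint.minHeight_le_one hlam i
    have hm' : height b θ (proj lam η') i 1 - minHeight b θ (proj lam η') i ≠ 0 := by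
      rw [h1, h2]; intro e; linarith
    have hr' := isReflection_siF hθ hlam hη' hm'
    refine ⟨?_, ?_, ?_, h5⟩
    · rw [siF, rootF, if_neg hm', h3, h4]
      rw [h3, h4] at hr'
      rw [hr.eq_of_involutive (simpleRefl_mul_cancel i) (siLSPaths_iff.mp hη).1 hr']
    · have := hint.epsNat_eq hlam i
      have h' := hint'.epsNat_eq hlam i
      rw [h1] at h'
      have : (epsNat b θ i (proj lam η) : ℝ) = epsNat b θ i (proj lam η') + 1 := by linarith
      exact_mod_cast this
    · have := hint.phiNat_eq hlam i
      have h' := hint'.phiNat_eq hlam i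
      rw [h1, h2] at h'
      have : (phiNat b θ i (proj lam η') : ℝ) = phiNat b θ i (proj lam η) + 1 := by linarith
      exact_mod_cast this
  · have hint := isIntegralPath_proj hθ hlam hη
    obtain ⟨hm, hη', hr⟩ := siF_eq_some hθ hlam hη h
    obtain ⟨h1, h2, h3, h4, h5⟩ := hint.reflect_f hlam hm (hr.proj hθ hlam hη')
    have hle := hint.minHeight_nonpos hlam (i := i)
    have hm' : minHeight b θ (proj lam η') i ≠ 0 := by
      rw [h1]; intro e; linarith
    have hr' := isReflection_siE hθ hlam hη' hm'
    rw [siE, rootE, if_neg hm', h3, h4]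
    rw [h3, h4] at hr'
    rw [hr.eq_of_involutive (simpleRefl_mul_cancel i) (siLSPaths_iff.mp hη).1 hr']
  · have hint := isIntegralPath_proj hθ hlam hη
    have h1 := hint.epsNat_eq hlam i
    have h2 := hint.phiNat_eq hlam i
    have h3 : (phiNat b θ i (proj lam η) : ℝ) =
        epsNat b θ i (proj lam η) + height b θ (proj lam η) i 1 := by linarith
    rw [hint.pair_endpoint hθ L hL]
    exact_mod_cast h3

/-- Merging of equal neighbours need not be compared list by list: both sides are reductions of the
same reflected step function, hence equal by `IsReflection.unique`. -/
theorem lsE_proj (hθ : IsHighestRoot b θ) (hlam : IsLevelZeroDominant b θ lam)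
    (hη : η ∈ siLSPaths b θ lam) (i : Option b.support) :
    lsE b θ i (proj lam η) = (siE b θ lam i η).map (proj lam) := by
  have hint := isIntegralPath_proj hθ hlam hη
  by_cases hm : minHeight b θ (proj lam η) i = 0
  · rw [lsE, siE, rootE, rootE, if_pos hm, if_pos hm]; rfl
  · obtain ⟨-, hη', hr⟩ := siE_eq_some (i := i) (η' := _) hθ hlam hη (by rw [siE, rootE, if_neg hm])
    rw [lsE, siE, rootE, rootE, if_neg hm, if_neg hm, Option.map_some,
      (hint.isReflection_e hlam hm).unique (hr.proj hθ hlam hη')]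

theorem lsF_proj (hθ : IsHighestRoot b θ) (hlam : IsLevelZeroDominant b θ lam)
    (hη : η ∈ siLSPaths b θ lam) (i : Option b.support) :
    lsF b θ i (proj lam η) = (siF b θ lam i η).map (proj lam) := by
  have hint := isIntegralPath_proj hθ hlam hη
  by_cases hm : height b θ (proj lam η) i 1 - minHeight b θ (proj lam η) i = 0
  · rw [lsF, siF, rootF, rootF, if_pos hm, if_pos hm]; rfl
  · obtain ⟨-, hη', hr⟩ := siF_eq_some (i := i) (η' := _) hθ hlam hη (by rw [siF, rootF, if_neg hm])
    rw [lsF, siF, rootF, rootF, if_neg hm, if_neg hm, Option.map_some,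
      (hint.isReflection_f hlam hm).unique (hr.proj hθ hlam hη')]

/-- Every LS path is the projection of a semi-infinite LS path. -/
theorem exists_lift (hθ : IsHighestRoot b θ) (hlam : IsLevelZeroDominant b θ lam)
    {π : List (AffDual M × ℝ)} (hπ : π ∈ LSPaths b θ lam) :
    ∃ η ∈ siLSPaths b θ lam, proj lam η = π := by
  obtain ⟨h1, ⟨p, hp, hp1⟩, h3⟩ := hπ
  -- Directed paths run from ν_{u+1} to ν_u. So a representative is chosen freely only for the last
  -- direction, and the others are reached by lifting from it.
  have key : ∀ l : List (AffDual M × ℝ), (∀ p ∈ l, p.1 ∈ orbit b θ lam) →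
      (l.IsChain fun p p' => p.2 < p'.2 ∧ WtLT b θ lam p'.1 p.1 ∧ WtPath b θ lam p.2 p'.1 p.1) →
      ∃ η, proj lam η = l ∧ (∀ p ∈ η, p.1 ∈ cosetReps b θ (stabIndex b θ lam)) ∧
        η.IsChain fun p p' => p.2 < p'.2 ∧
          (SiLE b θ (stabIndex b θ lam) p'.1 p.1 ∧ p'.1 ≠ p.1) ∧ SiPath b θ lam p.2 p'.1 p.1 := by
    intro l
    induction l with
    | nil => exact fun _ _ => ⟨[], rfl, by simp, List.isChain_nil⟩
    | cons p l ih =>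
      intro hl hc
      rw [List.isChain_cons] at hc
      obtain ⟨η, rfl, hη, hηc⟩ := ih (fun p hp => hl p (by simp [hp])) hc.2
      cases η with
      | nil =>
        obtain ⟨x, hx, hxp⟩ := exists_cosetReps_of_mem_orbit hθ hlam (hl p (by simp))
        refine ⟨[(x, p.2)], ?_, by simpa using hx, List.isChain_singleton _⟩
        simp [proj, hxp]
      | cons p' η =>
        obtain ⟨hlt, hwt, hpath⟩ := hc.1 (p'.1 lam, p'.2) rfl
        obtain ⟨y, hy, hyp, hxy⟩ := hpath.lift hθ hlam (hη p' (by simp)) rfl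
        refine ⟨(y, p.2) :: p' :: η, ?_, ?_, ?_⟩
        · simp [proj, hyp]
        · intro q hq
          rcases List.mem_cons.mp hq with rfl | hq
          exacts [hy, hη q hq]
        · rw [List.isChain_cons_cons]
          refine ⟨⟨hlt, ⟨hxy.siLE (hη p' (by simp)), fun e => hwt.2 ?_⟩, hxy⟩, hηc⟩
          change p'.1 = y at e
          rw [← hyp, ← e]
  obtain ⟨η, rfl, hη, hηc⟩ := key π (fun p hp => (h1 p hp).1) h3
  refine ⟨η, ⟨fun p hp => ⟨hη p hp, (h1 (p.1 lam, p.2) (List.mem_map.mpr ⟨p, hp, rfl⟩)).2⟩, ?_,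
    hηc⟩, rfl⟩
  rw [proj, List.getLast?_map] at hp
  obtain ⟨p', hp', rfl⟩ := Option.map_eq_some_iff.mp hp
  exact ⟨p', hp', hp1⟩

end Assembly

end

end SiLS

theorem theorem3p1 {ι M N : Type*} [Fintype ι] [AddCommGroup M] [Module ℂ M]
    [AddCommGroup N] [Module ℂ N] (P : RootPairing ι ℂ M N) [P.IsRootSystem]
    [P.IsCrystallographic] [P.IsReduced] [P.IsIrreducible] (b : P.Base) (θ : ι)
    (hθ : SiLS.IsHighestRoot b θ) (L : SiLS.WeightLattice b θ) (m : b.support → ℕ)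
    (lam : SiLS.AffDual M) (hlam : lam = L.dominant m) :
    -- stability under the root operators
    (∀ η ∈ SiLS.siLSPaths b θ lam, ∀ i : Option b.support,
      (∀ η', SiLS.siE b θ lam i η = some η' → η' ∈ SiLS.siLSPaths b θ lam) ∧
      (∀ η', SiLS.siF b θ lam i η = some η' → η' ∈ SiLS.siLSPaths b θ lam)) ∧
    -- the crystal of semi-infinite LS paths, and its projection to the crystal of LS paths
    ∃ (C : SiLS.Crystal L (SiLS.siLSPaths b θ lam)) (C' : SiLS.Crystal L (SiLS.LSPaths b θ lam))
      (pr : SiLS.siLSPaths b θ lam → SiLS.LSPaths b θ lam),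
      SiLS.IsCrystalOf C (SiLS.siE b θ lam) (SiLS.siF b θ lam)
        (fun η => SiLS.pathMap (SiLS.proj lam η) 1) ∧
      SiLS.IsCrystalOf C' (SiLS.lsE b θ) (SiLS.lsF b θ) (fun π => SiLS.pathMap π 1) ∧
      (∀ η, (pr η : List (SiLS.AffDual M × ℝ)) = SiLS.proj lam η) ∧
      Function.Surjective pr ∧ SiLS.IsStrictMorphism C C' (Option.map pr) := by
  have hdom : SiLS.IsLevelZeroDominant b θ lam := hlam ▸ L.isLevelZeroDominant m
  have hL : lam ∈ L.lattice := hlam ▸ L.dominant_mem m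
  have hsys := SiLS.isRootOperatorSystem_siLSPaths hθ hdom L hL
  have hmaps := fun η (hη : η ∈ SiLS.siLSPaths b θ lam) => SiLS.proj_mem_LSPaths hθ hdom hη
  have hE := fun i η (hη : η ∈ SiLS.siLSPaths b θ lam) => SiLS.lsE_proj hθ hdom hη i
  have hF := fun i η (hη : η ∈ SiLS.siLSPaths b θ lam) => SiLS.lsF_proj hθ hdom hη i
  -- For LS paths the crystal properties are not proved anew but descend along the surjection.
  -- Weights and counters are defined on projected paths, so they agree definitionally.
  have hsys' : SiLS.IsRootOperatorSystem L (SiLS.LSPaths b θ lam) (SiLS.lsE b θ) (SiLS.lsF b θ)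
      (fun π => SiLS.pathMap π 1) (SiLS.epsNat b θ) (SiLS.phiNat b θ) :=
    hsys.image (fun π hπ => SiLS.exists_lift hθ hdom hπ) hmaps hE hF (fun _ _ => rfl)
      (fun _ _ _ => rfl) fun _ _ _ => rfl
  refine ⟨fun η hη i => ⟨fun η' h => hsys.e_mem i η hη η' h, fun η' h => hsys.f_mem i η hη η' h⟩,
    hsys.crystal, hsys'.crystal, fun η => ⟨SiLS.proj lam η, hmaps η η.2⟩, hsys.isCrystalOf,
    hsys'.isCrystalOf, fun _ => rfl, ?_, ?_⟩
  · rintro ⟨π, hπ⟩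
    obtain ⟨η, hη, rfl⟩ := SiLS.exists_lift hθ hdom hπ
    exact ⟨⟨η, hη⟩, rfl⟩
  · exact hsys.isStrictMorphism hsys' hmaps hE hF (fun _ _ => rfl) (fun _ _ _ => rfl)
      fun _ _ _ => rfl
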